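/- **Lattice and spins.** Spins sit on the edges of the square lattice $\mathbb Z^2$; each has the state space $\mathbb C^d=\mathbb C^2\oplus\mathbb C^{q+1}$, $d=q+3$: a Toric Code (TC) part and a classical part with basis the colours $0$ (black)$,1,\dots,q$. Let $\mathbb 1_{tc},\mathbb 1_{cl}$ be the projectors onto the two parts. A star consists of the four edges at a vertex, a plaquette of the four edges of a unit square; a tile or star configuration is written $(N,E,S,W)$ (colours of the north, east, south, west edge). Neighbouring spins $i\sim j$ are a horizontal and a vertical edge with a common vertex. **Prime period tiling.** Let $q\ge 3$, $f\ge2$, and let $r_{ij}\ge 1$ ($1\le i\le f$, $1\le j\le m_i$, $m_i\ge1$) be integers with $r_{ij}\le q$, $r_{ij}\le q-1$ if $1<i<f$, $\sum_i m_i\le q$, and such that the row periods $p_i=\sum_j r_{ij}$ are pairwise coprime. Put $h_0=0$, $h_i=h_{i-1}+m_i$, $l_i=h_{i-1}+1$, $V_i=\{l_i,\dots,h_i\}$, $V_0:=V_f$. The tile weights $a_w$ are: $3/2$ for $(0,0,0,0)$; $1$ for $(0,1,0,0)$, for $(3,2,0,0)$, for the row tiles $(t,c',h_{i-1}+j,c)$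 with $t\in V_{i-1}$, $1\le c\le r_{ij}$, $c'=c+1$ if $c<r_{ij}$ and $c'=1$ if $c=r_{ij}$, and, for $1<i<f$, for $(h_{i-1},q,h_i,r_{im_i})$ and $(l_{i-1},2,l_i,q)$; $0$ for all other tiles. A star $(N,E,S,W)$ is allowed if, with $S$ arbitrary, one of the following holds: $W=E=h_{i-1}+j$ and $2\le N\le r_{ij}$; $N=1$, $W=h_{i-1}+j$ and $E$ is the cyclically next element of $V_i$; $N=q$, $W=h_i$, $E=l_i$ with $1<i<f$; exactly one of $W,E$ is black. The star weight $b_s$ is $1$ for allowed stars and $0$ for others, lowered by $1$ for the stars $(k_i,l_i,1,h_i)$, $1\le i<f-1$, and by $2$ for the period marker $(k_{f-1},l_{f-1},1,h_{f-1})$, where $k_1=1$ and $k_i=q$ for $i>1$. **Hamiltonian.** $H^{(d)}=H_{TC}+H_{CL}+H'$ is the formal sum of the following terms, each extended by zero to the full spaces of the spins involved: $H_{TC}$ has a term $\varepsilon\mathbb 1_{tc}^{\otimes4}-J\prod\sigma^x$ for every star and $\varepsilon\mathbb 1_{tc}^{\otimes 4}-J\prod\sigma^z$ for every plaquette; $H_{CL}$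 has a term $\mathbb 1_{cl}^{\otimes4}-\sum_w a_w\bigotimes_e|w_e\rangle\langle w_e|$ for every plaquette and the same with $b_s$ for every star; $H'=C\sum_{i\sim j}(\mathbb 1_{tc}^i\mathbb 1_{cl}^j+\mathbb 1_{cl}^i\mathbb 1_{tc}^j)$, each unordered pair counted once. Here $J>0$, $\varepsilon\le\min(J,\tfrac12)$ and $C\ge1$. ($\varepsilon=J\le\frac12$ gives the Toric Code ground state energy zero and each violated stabilizer energy at most $1$; $\varepsilon=0$ is the unshifted Toric Code.) **States.** Let $\mathcal A$ be the quasi-local algebra, the norm closure of the union of the matrix algebras $\mathcal B_\Lambda=\mathcal B(\bigotimes_{\Lambda}\mathbb C^d)$, $\Lambda$ a finite set of spins. A state is a positive normalised linear functional on $\mathcal A$. $H_R$ is the sum of the terms of $H$ supported in $R$, and $\bar\Lambda$ is $\Lambda$ together with all spins that share a term with a spin of $\Lambda$. A state $\omega$ is a ground state of $H$ if $\omega(A^\dagger[H_{\bar\Lambda},A])\ge0$ for all finite $\Lambda$ and all $A\in\mathcal B_\Lambda$. An equilibrium state at inverse temperature $\beta$ is a state which is, on local observables, the limit of the Gibbs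 states of $H_{R_n}+W_n$ on $R_n$ at inverse temperature $\beta$, for some increasing sequence of finite regions $R_n$ exhausting the lattice and some self-adjoint boundary terms $W_n\in\mathcal B_{R_n}$ (possibly zero) such that for every finite $\Lambda$, $W_n\in\mathcal B_{R_n\setminus\Lambda}$ for all large $n$. Let $\Pi_{TC,\Lambda}=\prod_{e\in\Lambda}\mathbb 1^e_{tc}$. **Corollary.** 1. Every ground state $\omega$ of $H^{(d)}$ is fully supported in the Toric Code subspace: $\omega(\mathbb 1-\Pi_{TC,\Lambda})=0$ for every finite $\Lambda$. 2. If $\omega$ is a weak-* limit of equilibrium states $\omega_n$ of $H^{(d)}$ at inverse temperatures $\beta_n\to\infty$, then $\omega$ is a ground state of the Toric Code: $\omega(\mathbb 1-\Pi_{TC,\Lambda})=0$ for every finite $\Lambda$, and $\omega(A^\dagger[(H^0_{TC})_{\bar\Lambda},A])\ge0$ for every finite $\Lambda$ and every $A\in\mathcal B_\Lambda$ with $A=\Pi_{TC,\Lambda}A\,\Pi_{TC,\Lambda}$, where $H^0_{TC}=-J\sum_s\prod_{i\in s}\sigma^x_i-J\sum_p\prod_{i\in p}\sigma^z_i$. 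-/

import Mathlib

open scoped ComplexOrder Topology

noncomputable section

namespace ToricTiling

/-! ### The spin lattice: spins on the edges of the square lattice -/

/-- Spins sit on the edges of `ℤ²`: `(false, x, y)` is the horizontal edge from `(x, y)` to
`(x + 1, y)` and `(true, x, y)` is the vertical edge from `(x, y)` to `(x, y + 1)`. -/
abbrev Site := Bool × ℤ × ℤ

def hEdge (x y : ℤ) : Site := (false, x, y)

def vEdge (x y : ℤ) : Site := (true, x, y)

/-- The four sides of a cell: of a plaquette (its edges) or of a star (the edges at a vertex). -/
inductive Side
  | north | east | south | west

/-- The edges of the plaquette with lower left corner `(x, y)`. -/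
def plaqEdge (x y : ℤ) : Side → Site
  | .north => hEdge x (y + 1)
  | .east => vEdge (x + 1) y
  | .south => hEdge x y
  | .west => vEdge x y

/-- The edges meeting at the vertex `(x, y)`. -/
def starEdge (x y : ℤ) : Side → Site
  | .north => vEdge x y
  | .east => hEdge x y
  | .south => vEdge x (y - 1)
  | .west => hEdge (x - 1) y

/-- The kinds of interaction terms: stars, plaquettes, and nearest-neighbour pairs of spins.
Nearest neighbours are a horizontal and a vertical edge sharing a vertex, so that each spin has
four of them; there are four such pairs at each vertex. -/
inductive Kind
  | star | plaquette | pairNE | pairNW | pairSW | pairSE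
  deriving DecidableEq

instance : Fintype Kind where
  elems := {.star, .plaquette, .pairNE, .pairNW, .pairSW, .pairSE}
  complete := fun k => by cases k <;> decide

/-- An interaction: its kind and the vertex (for a plaquette, lower left corner) it sits at. -/
abbrev Interaction := Kind × ℤ × ℤ

/-- The set of spins on which an interaction acts. -/
def supp : Interaction → Finset Site
  | (.star, x, y) =>
      {starEdge x y .north, starEdge x y .east, starEdge x y .south, starEdge x y .west}
  | (.plaquette, x, y) =>
      {plaqEdge x y .north, plaqEdge x y .east, plaqEdge x y .south, plaqEdge x y .west}
  | (.pairNE, x, y) => {starEdge x y .north, starEdge x y .east}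
  | (.pairNW, x, y) => {starEdge x y .north, starEdge x y .west}
  | (.pairSW, x, y) => {starEdge x y .south, starEdge x y .west}
  | (.pairSE, x, y) => {starEdge x y .south, starEdge x y .east}

/-- A finite set of interactions which contains all those that meet `R`. -/
def candidates (R : Finset Site) : Finset Interaction :=
  R.biUnion fun e => Finset.univ ×ˢ
    (Finset.Icc (e.2.1 - 1) (e.2.1 + 1) ×ˢ Finset.Icc (e.2.2 - 1) (e.2.2 + 1))

/-- The interactions that act on at least one spin of `R`. -/
def meeting (R : Finset Site) : Finset Interaction :=
  (candidates R).filter fun X => ∃ e ∈ R, e ∈ supp X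

/-- The interactions that are totally contained in `R`. -/
def inside (R : Finset Site) : Finset Interaction :=
  (candidates R).filter fun X => supp X ⊆ R

/-- `Λ` together with its exterior boundary: the spins outside `Λ` that share an interaction
with a spin of `Λ`. -/
def bar (Λ : Finset Site) : Finset Site :=
  Λ ∪ (meeting Λ).biUnion supp

theorem mem_candidates {R : Finset Site} {X : Interaction} {e : Site} (he : e ∈ R)
    (hX : e ∈ supp X) : X ∈ candidates R := by
  obtain ⟨k, x, y⟩ := X
  obtain ⟨b, u, v⟩ := e
  refine Finset.mem_biUnion.2 ⟨_, he, ?_⟩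
  simp only [Finset.mem_product, Finset.mem_univ, Finset.mem_Icc, true_and]
  cases k <;>
    simp only [supp, plaqEdge, starEdge, hEdge, vEdge, Finset.mem_insert, Finset.mem_singleton,
      Prod.mk.injEq] at hX <;> omega

theorem mem_meeting {R : Finset Site} {X : Interaction} :
    X ∈ meeting R ↔ ∃ e ∈ R, e ∈ supp X := by
  simp only [meeting, Finset.mem_filter, and_iff_right_iff_imp]
  rintro ⟨e, he, hX⟩
  exact mem_candidates he hX

theorem supp_nonempty (X : Interaction) : (supp X).Nonempty := by
  obtain ⟨k, x, y⟩ := X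
  cases k <;> exact ⟨_, Finset.mem_insert_self _ _⟩

theorem mem_inside {R : Finset Site} {X : Interaction} : X ∈ inside R ↔ supp X ⊆ R := by
  simp only [inside, Finset.mem_filter, and_iff_right_iff_imp]
  intro h
  obtain ⟨e, he⟩ := supp_nonempty X
  exact mem_candidates (h he) he

theorem mem_bar {Λ : Finset Site} {e : Site} :
    e ∈ bar Λ ↔ e ∈ Λ ∨ ∃ X, e ∈ supp X ∧ ∃ e' ∈ Λ, e' ∈ supp X := by
  simp only [bar, Finset.mem_union, Finset.mem_biUnion, mem_meeting]
  constructor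
  · rintro (h | ⟨X, h, h'⟩)
    · exact Or.inl h
    · exact Or.inr ⟨X, h', h⟩
  · rintro (h | ⟨X, h, h'⟩)
    · exact Or.inl h
    · exact Or.inr ⟨X, h', h⟩

/-! ### The quasi-local algebra -/

/-- Basis of the one-spin space `ℂ^d = ℂ² ⊕ ℂ^(q+1)`, `d = q + 3`: two Toric Code states and
the `q + 1` colours, of which colour `0` is black. -/
abbrev Local (q : ℕ) := Fin 2 ⊕ Fin (q + 1)

/-- Classical configurations of the infinite lattice. -/
abbrev Config (q : ℕ) := Site → Local q

/-- The Hilbert space `ℓ²(Config)`; each finite matrix algebra acts on it faithfully, through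
the spins in its region. -/
abbrev Hil (q : ℕ) := lp (fun _ : Config q => ℂ) 2

abbrev Op (q : ℕ) := Hil q →L[ℂ] Hil q

/-- The function underlying the action of the matrix unit `|a⟩⟨b|` at the spin `e`. -/
def unitFun {q : ℕ} (e : Site) (a b : Local q) (f : Config q → ℂ) : Config q → ℂ :=
  fun σ => if σ e = a then f (Function.update σ e b) else 0

theorem update_injOn {q : ℕ} (e : Site) (a b : Local q) :
    Function.Injective fun σ : {σ : Config q // σ e = a} => Function.update σ.1 e b := by
  rintro ⟨σ, hσ⟩ ⟨τ, hτ⟩ h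
  refine Subtype.ext (funext fun x => ?_)
  by_cases hx : x = e
  · subst hx
    exact hσ.trans hτ.symm
  · have := congrFun h x
    simpa [Function.update_of_ne hx] using this

theorem unitFun_sq {q : ℕ} (e : Site) (a b : Local q) (f : Hil q) :
    Summable (fun σ => ‖unitFun e a b f σ‖ ^ (2 : ℝ)) ∧
      ∑' σ, ‖unitFun e a b f σ‖ ^ (2 : ℝ) ≤ ∑' σ, ‖f σ‖ ^ (2 : ℝ) := by
  have hf : Summable fun σ => ‖f σ‖ ^ (2 : ℝ) := by
    simpa using (lp.memℓp f).summable (by norm_num)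
  have hs : (fun σ => ‖unitFun e a b f σ‖ ^ (2 : ℝ)) =
      Set.indicator {σ : Config q | σ e = a}
        (fun σ => ‖f (Function.update σ e b)‖ ^ (2 : ℝ)) := by
    funext σ
    by_cases h : σ e = a <;> simp [unitFun, Set.indicator, h]
  have h1 := hf.comp_injective (update_injOn e a b)
  rw [hs]
  refine ⟨summable_subtype_iff_indicator.1 h1, ?_⟩
  rw [← tsum_subtype]
  exact tsum_comp_le_tsum_of_inj hf (fun _ => by positivity) (update_injOn e a b)

/-- The matrix unit `|a⟩⟨b|` of the spin `e`, acting on the whole lattice. -/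
def siteUnit {q : ℕ} (e : Site) (a b : Local q) : Op q :=
  LinearMap.mkContinuous
    { toFun := fun f => ⟨unitFun e a b f,
        memℓp_gen (by simpa using (unitFun_sq e a b f).1)⟩
      map_add' := fun f g => by
        ext σ
        change unitFun e a b (f + g : Hil q) σ = unitFun e a b f σ + unitFun e a b g σ
        by_cases h : σ e = a <;> simp [unitFun, h]
      map_smul' := fun c f => by
        ext σ
        by_cases h : σ e = a <;> simp [unitFun, h] }
    1 (fun f => by
      rw [one_mul]
      have h2 : (0 : ℝ) < (2 : ENNReal).toReal := by norm_num
      refine (Real.rpow_le_rpow_iff (norm_nonneg _) (norm_nonneg _) h2).1 ?_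
      rw [lp.norm_rpow_eq_tsum h2, lp.norm_rpow_eq_tsum h2]
      simpa using (unitFun_sq e a b f).2)

theorem siteUnit_apply {q : ℕ} (e : Site) (a b : Local q) (f : Hil q) (σ : Config q) :
    siteUnit e a b f σ = if σ e = a then f (Function.update σ e b) else 0 := rfl

/-- The algebra `B_Λ` of observables of the region `Λ`, a copy of the matrix algebra
`⨂_{e ∈ Λ} M_d(ℂ)`: it is generated by the matrix units of the spins in `Λ`. -/
def localAlgebra (q : ℕ) (Λ : Finset Site) : StarSubalgebra ℂ (Op q) :=
  StarAlgebra.adjoin ℂ {T | ∃ e ∈ Λ, ∃ a b, T = siteUnit e a b}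

/-- The quasi-local algebra: the norm closure of the (directed) union of all `B_Λ`. -/
def quasiLocal (q : ℕ) : StarSubalgebra ℂ (Op q) :=
  (⨆ Λ : Finset Site, localAlgebra q Λ).topologicalClosure

abbrev QL (q : ℕ) := ↥(quasiLocal q)

theorem siteUnit_mem {q : ℕ} (e : Site) (a b : Local q) :
    siteUnit e a b ∈ quasiLocal q := by
  refine StarSubalgebra.le_topologicalClosure _ ?_
  refine (le_iSup (localAlgebra q) {e}) ?_
  exact StarAlgebra.subset_adjoin ℂ _ ⟨e, by simp, a, b, rfl⟩

/-- The matrix unit `|a⟩⟨b|` of the spin `e` as an element of the quasi-local algebra. -/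
def mu {q : ℕ} (e : Site) (a b : Local q) : QL q := ⟨siteUnit e a b, siteUnit_mem e a b⟩

/-- `A ∈ B_Λ`. -/
def IsLocal {q : ℕ} (Λ : Finset Site) (A : QL q) : Prop := (A : Op q) ∈ localAlgebra q Λ

/-- A state in the thermodynamic limit: a linear, positive and normalised functional on the
quasi-local algebra. -/
structure State (q : ℕ) where
  toLin : QL q →ₗ[ℂ] ℂ
  nonneg : ∀ a : QL q, 0 ≤ toLin (star a * a)
  normalised : toLin 1 = 1

/-! ### One-spin operators -/

/-- The projector onto the Toric Code subspace of the spin `e`. -/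
def tcProj {q : ℕ} (e : Site) : QL q := ∑ k : Fin 2, mu e (.inl k) (.inl k)

/-- The projector onto the classical (tiling) subspace of the spin `e`. -/
def clProj {q : ℕ} (e : Site) : QL q := ∑ k : Fin (q + 1), mu e (.inr k) (.inr k)

/-- Pauli `σˣ` on the Toric Code subspace, extended by zero. -/
def sigmaX {q : ℕ} (e : Site) : QL q := mu e (.inl 0) (.inl 1) + mu e (.inl 1) (.inl 0)

/-- Pauli `σᶻ` on the Toric Code subspace, extended by zero. -/
def sigmaZ {q : ℕ} (e : Site) : QL q := mu e (.inl 0) (.inl 0) - mu e (.inl 1) (.inl 1)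

theorem tcProj_apply {q : ℕ} (e : Site) (f : Hil q) (σ : Config q) :
    (tcProj e : QL q).1 f σ = if (σ e).isLeft then f σ else 0 := by
  have h : (tcProj e : QL q).1 = siteUnit e (.inl 0) (.inl 0) + siteUnit e (.inl 1) (.inl 1) := by
    simp [tcProj, mu, Fin.sum_univ_two]
  rw [h]
  change siteUnit e (.inl 0) (.inl 0) f σ + siteUnit e (.inl 1) (.inl 1) f σ = _
  rw [siteUnit_apply, siteUnit_apply]
  rcases hs : σ e with k | k
  · fin_cases k
    · have : Function.update σ e (Sum.inl 0) = σ := by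
        rw [Function.update_eq_self_iff]; exact hs.symm
      simp [this]
    · have : Function.update σ e (Sum.inl 1) = σ := by
        rw [Function.update_eq_self_iff]; exact hs.symm
      simp [this]
  · simp

theorem tcProj_commute {q : ℕ} (e e' : Site) : Commute (tcProj e : QL q) (tcProj e') := by
  refine Subtype.ext (ContinuousLinearMap.ext fun f => lp.ext (funext fun σ => ?_))
  change (tcProj e : QL q).1 ((tcProj e' : QL q).1 f) σ =
    (tcProj e' : QL q).1 ((tcProj e : QL q).1 f) σ
  simp only [tcProj_apply]
  split_ifs <;> rfl

/-- `Π_{TC,Λ}`, the projector onto the states for which every spin of `Λ` is in the Toric Code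
subspace. -/
def tcRegion {q : ℕ} (Λ : Finset Site) : QL q :=
  Λ.noncommProd tcProj fun e _ e' _ _ => tcProj_commute e e'

/-- The product of one-spin operators over the four spins of a star or a plaquette. -/
def prod4 {q : ℕ} (s : Side → Site) (T : Side → Site → QL q) : QL q :=
  T .north (s .north) * T .east (s .east) * T .south (s .south) * T .west (s .west)

/-! ### The prime period tiling -/

/-- Rows of sub-period lengths `r i 1, …, r i (m i)`, `i = 1, …, f`, for `q` colours. The
sub-periods are numbered consecutively by colours of `{1, …, q}`, so their total number is at
most `q` (in particular `f ≤ q` and `m i ≤ q`). -/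
structure Rows (q : ℕ) where
  f : ℕ
  m : ℕ → ℕ
  r : ℕ → ℕ → ℕ
  three_le_q : 3 ≤ q
  two_le_f : 2 ≤ f
  one_le_m : ∀ i, 1 ≤ i → i ≤ f → 1 ≤ m i
  one_le_r : ∀ i j, 1 ≤ i → i ≤ f → 1 ≤ j → j ≤ m i → 1 ≤ r i j
  r_le : ∀ i j, 1 ≤ i → i ≤ f → 1 ≤ j → j ≤ m i → r i j ≤ q
  r_lt : ∀ i j, 1 < i → i < f → 1 ≤ j → j ≤ m i → r i j < q
  labels : ∑ i ∈ Finset.Icc 1 f, m i ≤ q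
  coprime : ∀ i k, 1 ≤ i → i < k → k ≤ f →
    Nat.Coprime (∑ j ∈ Finset.Icc 1 (m i), r i j) (∑ j ∈ Finset.Icc 1 (m k), r k j)

namespace Rows

variable {q : ℕ} (ρ : Rows q)

/-- The highest label `h_i` of row `i`; `h_0 = 0`. -/
def hi (i : ℕ) : ℕ := ∑ k ∈ Finset.Icc 1 i, ρ.m k

/-- The lowest label `l_i` of row `i`. -/
def lo (i : ℕ) : ℕ := ρ.hi (i - 1) + 1

/-- The label of the sub-period `j` of row `i`. -/
def label (i j : ℕ) : ℕ := ρ.hi (i - 1) + j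

/-- The row on top of row `i`, cyclically. -/
def above (i : ℕ) : ℕ := if i = 1 then ρ.f else i - 1

/-- The tiles of row `i`: counting cyclically through `1, …, r i j` on the vertical edges, with
the label of the sub-period at the bottom and any label of the preceding row on top. -/
def RowTile (N E S W : ℕ) : Prop :=
  ∃ i j, 1 ≤ i ∧ i ≤ ρ.f ∧ 1 ≤ j ∧ j ≤ ρ.m i ∧
    ρ.lo (ρ.above i) ≤ N ∧ N ≤ ρ.hi (ρ.above i) ∧ S = ρ.label i j ∧
    1 ≤ W ∧ W ≤ ρ.r i j ∧ E = if W = ρ.r i j then 1 else W + 1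

/-- The two extra tiles of each row other than the first and the last, which allow to begin a
period with `q` instead of `1`. -/
def MarkTile (N E S W : ℕ) : Prop :=
  ∃ i, 1 < i ∧ i < ρ.f ∧
    ((N = ρ.hi (i - 1) ∧ E = q ∧ S = ρ.hi i ∧ W = ρ.r i (ρ.m i)) ∨
      (N = ρ.lo (i - 1) ∧ E = 2 ∧ S = ρ.lo i ∧ W = q))

/-- The two tiles with some black edges other than the all-black tile. -/
def EdgeTile (N E S W : ℕ) : Prop :=
  (N = 0 ∧ E = 1 ∧ S = 0 ∧ W = 0) ∨ (N = 3 ∧ E = 2 ∧ S = 0 ∧ W = 0)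

open Classical in
/-- Weights `a_w` of the tiles: `3/2` (a bonus of `1/2`) for the all-black tile, `1` for the
other tiles of the set, `0` for a tile that is not in the set. -/
def tileWeight (N E S W : ℕ) : ℝ :=
  if N = 0 ∧ E = 0 ∧ S = 0 ∧ W = 0 then 3 / 2
  else if ρ.RowTile N E S W ∨ ρ.MarkTile N E S W ∨ EdgeTile N E S W then 1
  else 0

/-- The allowed stars. Below a vertical edge of row `i` with colour `N ≥ 2` the label stays the
same; below a vertical edge `1` it moves on to the (cyclically) next label of the row; in the
rows with a marker, `q` may be used instead of `1` when the label returns to the first one. Next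
to a black horizontal edge there is no restriction, except that black must not appear to the
right of black. -/
def AllowedStar (N E W : ℕ) : Prop :=
  (∃ i j, 1 ≤ i ∧ i ≤ ρ.f ∧ 1 ≤ j ∧ j ≤ ρ.m i ∧ W = ρ.label i j ∧
    ((2 ≤ N ∧ N ≤ ρ.r i j ∧ E = W) ∨
      (N = 1 ∧ E = if j = ρ.m i then ρ.lo i else W + 1))) ∨
  (∃ i, 1 < i ∧ i < ρ.f ∧ N = q ∧ W = ρ.hi i ∧ E = ρ.lo i) ∨
  (W = 0 ∧ E ≠ 0) ∨ (W ≠ 0 ∧ E = 0)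

/-- Row `i` starts a period, all rows above it in the block having been marked to do so in the
same column, while a `1` (and not a `q`) appears in the row below. -/
def PenalisedStar (i N E S W : ℕ) : Prop :=
  N = (if i = 1 then 1 else q) ∧ E = ρ.lo i ∧ S = 1 ∧ W = ρ.hi i

open Classical in
/-- Weights `b_s` of the stars: `1` for the allowed ones, lowered by `1` for the penalised ones
and by `2` for the period marker (the case `i = f - 1`). -/
def starWeight (N E S W : ℕ) : ℝ :=
  (if ρ.AllowedStar N E W then 1 else 0)
    - (if ∃ i, 1 ≤ i ∧ i + 1 < ρ.f ∧ ρ.PenalisedStar i N E S W then 1 else 0)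
    - (if ρ.PenalisedStar (ρ.f - 1) N E S W then 2 else 0)

end Rows

/-! ### The Hamiltonian -/

/-- The generalised tiling interaction `𝟙 - ∑_w a_w ⨂ |w_e⟩⟨w_e|` on the classical subspace of
four spins, extended by zero. -/
def tilingTerm {q : ℕ} (s : Side → Site) (a : ℕ → ℕ → ℕ → ℕ → ℝ) : QL q :=
  prod4 s (fun _ e => clProj e) -
    ∑ w : Fin (q + 1) × Fin (q + 1) × Fin (q + 1) × Fin (q + 1),
      (a w.1 w.2.1 w.2.2.1 w.2.2.2 : ℂ) •
        prod4 s (fun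
          | .north, e => mu e (.inr w.1) (.inr w.1)
          | .east, e => mu e (.inr w.2.1) (.inr w.2.1)
          | .south, e => mu e (.inr w.2.2.1) (.inr w.2.2.1)
          | .west, e => mu e (.inr w.2.2.2) (.inr w.2.2.2))

/-- The stabilizer term `ε 𝟙 - J ∏ σ` on the Toric Code subspace of four spins, extended by
zero. -/
def stabilizerTerm {q : ℕ} (J ε : ℝ) (s : Side → Site) (σ : Site → QL q) : QL q :=
  (ε : ℂ) • prod4 s (fun _ e => tcProj e) - (J : ℂ) • prod4 s (fun _ e => σ e)

/-- The Ising-type penalty for neighbouring spins in different subspaces. -/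
def isingTerm {q : ℕ} (C : ℝ) (e e' : Site) : QL q :=
  (C : ℂ) • (tcProj e * clProj e' + clProj e * tcProj e')

/-- The Toric Code interactions. -/
def tcInteraction (q : ℕ) (J ε : ℝ) : Interaction → QL q
  | (.star, x, y) => stabilizerTerm J ε (starEdge x y) sigmaX
  | (.plaquette, x, y) => stabilizerTerm J ε (plaqEdge x y) sigmaZ
  | _ => 0

/-- All interactions of `H^(d) = H_TC + H_CL + H'`. -/
def interaction {q : ℕ} (ρ : Rows q) (J ε C : ℝ) : Interaction → QL q
  | (.star, x, y) =>
      tcInteraction q J ε (.star, x, y) + tilingTerm (starEdge x y) ρ.starWeight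
  | (.plaquette, x, y) =>
      tcInteraction q J ε (.plaquette, x, y) + tilingTerm (plaqEdge x y) ρ.tileWeight
  | (.pairNE, x, y) => isingTerm C (starEdge x y .north) (starEdge x y .east)
  | (.pairNW, x, y) => isingTerm C (starEdge x y .north) (starEdge x y .west)
  | (.pairSW, x, y) => isingTerm C (starEdge x y .south) (starEdge x y .west)
  | (.pairSE, x, y) => isingTerm C (starEdge x y .south) (starEdge x y .east)

/-- The restriction `H_R` of a Hamiltonian to all interactions totally contained in `R`. -/
def restrict {q : ℕ} (Φ : Interaction → QL q) (R : Finset Site) : QL q := ∑ X ∈ inside R, Φ X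

/-! ### Ground states and equilibrium states -/

/-- Ground states: `ω(A† [H_{Λ̄}, A]) ≥ 0` for all finite `Λ` and all `A ∈ B_Λ`. -/
def IsGroundState {q : ℕ} (Φ : Interaction → QL q) (ω : State q) : Prop :=
  ∀ (Λ : Finset Site) (A : QL q), IsLocal Λ A →
    0 ≤ ω.toLin (star A * (restrict Φ (bar Λ) * A - A * restrict Φ (bar Λ)))

/-- `ω(Π_{TC,Λ}^⊥) = 0` for all finite `Λ`. -/
def IsFullyTC {q : ℕ} (ω : State q) : Prop :=
  ∀ Λ : Finset Site, ω.toLin (1 - tcRegion Λ) = 0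

/-- Ground states of the Toric Code `-J ∑ A_s - J ∑ B_p`: states of the lattice of spins `ℂ²`,
i.e. states supported in the Toric Code subspace, that satisfy the ground state condition for the
observables `A = Π_{TC,Λ} A Π_{TC,Λ}` on that subspace. -/
def IsToricCodeGroundState {q : ℕ} (J : ℝ) (ω : State q) : Prop :=
  IsFullyTC ω ∧ ∀ (Λ : Finset Site) (A : QL q), IsLocal Λ A → tcRegion Λ * A * tcRegion Λ = A →
    0 ≤ ω.toLin (star A * (restrict (tcInteraction q J 0) (bar Λ) * A -
      A * restrict (tcInteraction q J 0) (bar Λ)))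

/-- The configuration that is `s` in `R` and black outside. -/
def extend {q : ℕ} (R : Finset Site) (s : R → Local q) : Config q :=
  fun e => if h : e ∈ R then s ⟨e, h⟩ else .inr 0

open Classical in
/-- The trace of an element of `B_R` over the spins in `R`. -/
def regionTrace {q : ℕ} (R : Finset Site) (T : Op q) : ℂ :=
  ∑ s : R → Local q, T (lp.single 2 (extend R s) (1 : ℂ)) (extend R s)

/-- The expectation value of `A ∈ B_R` in the Gibbs state of the region `R` with Hamiltonian
`K ∈ B_R`, at inverse temperature `β`. -/
def gibbs {q : ℕ} (R : Finset Site) (β : ℝ) (K A : QL q) : ℂ :=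
  regionTrace R (NormedSpace.exp (-(β : ℂ) • (K : Op q)) * (A : Op q)) /
    regionTrace R (NormedSpace.exp (-(β : ℂ) • (K : Op q)))

/-- Equilibrium states in the thermodynamic limit at inverse temperature `β`: limits of the Gibbs
states of an ascending sequence of finite regions exhausting the lattice, with arbitrary boundary
terms `W n` which move away from every fixed region (`W n = 0` is allowed). -/
def IsEquilibriumState {q : ℕ} (Φ : Interaction → QL q) (β : ℝ) (ω : State q) : Prop :=
  ∃ (R : ℕ → Finset Site) (W : ℕ → QL q), Monotone R ∧ (∀ e, ∃ n, e ∈ R n) ∧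
    (∀ n, IsSelfAdjoint (W n) ∧ IsLocal (R n) (W n)) ∧
    (∀ Λ : Finset Site, ∀ᶠ n in Filter.atTop, IsLocal (R n \ Λ) (W n)) ∧
    ∀ (Λ : Finset Site) (A : QL q), IsLocal Λ A →
      Filter.Tendsto (fun n => gibbs (R n) β (restrict Φ (R n) + W n) A) Filter.atTop
        (𝓝 (ω.toLin A))

/-- Zero temperature limits (in the weak-* topology) of equilibrium states of the infinite
lattice. -/
def IsZeroTemperatureLimit {q : ℕ} (Φ : Interaction → QL q) (ω : State q) : Prop :=
  ∃ (β : ℕ → ℝ) (ψ : ℕ → State q), Filter.Tendsto β Filter.atTop Filter.atTop ∧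
    (∀ n, IsEquilibriumState Φ (β n) (ψ n)) ∧
    ∀ A : QL q, Filter.Tendsto (fun n => (ψ n).toLin A) Filter.atTop (𝓝 (ω.toLin A))

end ToricTiling

end

/-! Every term of the Hamiltonian commutes with the projectors that tell, spin by spin, whether the
spin is in the Toric Code subspace or has a given colour. The state space therefore splits into
sectors (`Sector`), and the interactions act on a sector as numbers, apart from the stabilizers of
cells that lie wholly in the Toric Code subspace (`interaction_cell_mul_sectorProj`). The aim is to
show that a sector with a classical spin has weight zero in a ground state.

The ground state condition extends from single operators to completely positive local maps `T`, in
the form `0 ≤ ω (T H - T 1 * H)` (`IsKraus.ground`). Such a map replaces the classical spins in a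
finite set `D` by maximally mixed Toric Code spins and then repairs stabilizers by a sweep of
measurements and Pauli corrections along horizontal lines (`exists_channel`). Repairing a cell
through its eastern edge disturbs its eastern neighbour, which is repaired next; the uncertain cells
are those at the end of a line. Averaging the eastward and the westward sweep, a new toric cell
costs at most `0` if both of its eastern and western edges are in `D`, and at most `1/2` otherwise
(`flip_energy_le`). If this total is below the former energy of the sector, the sector is null
(`sector_null`).

It remains to find a profitable `D`. In a block without defects every row of tiles would be
periodic. The periods are coprime, so by the Chinese remainder theorem some column would see all
rows of a stack begin a period at once; the markers then propagate down the stack and force a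
penalty (`Rows.no_perfect_block`). Hence each classical spin is near a defect. A defect yields an
energy gain: a cell that is partly classical has two cut corners and `C ≥ 1`, and a violated tile or
star costs at least `1`. The bonus `1/2` of an all-black plaquette is paid for by a defect or a
doubly black star on each of its horizontal sides (`starGain_ge`, `plaqGain_ge`, `black_le`). So a
finite classical region has a gain proportional to its size (`card_le_gain`). In a general sector
this holds in a box up to a boundary term. If no box had a gain, the number of classical spins would
grow exponentially with the radius, although the volume is quadratic; a suitable box thus exists
within a radius that does not depend on the sector (`exists_gain`). Summing over the sectors of one
large box gives `clProj_null`, and the Cauchy–Schwarz inequality extends this to all finite regions.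

For positive temperature, the elementary bound `1 - exp (-x) ≤ x` applied to pairs of energy levels
shows that a Gibbs state satisfies `ω (A† A - A A†) ≤ β ω (A† [H, A])`. The inequality passes to the
thermodynamic limit, because boundary terms eventually commute with `A`; after division by `β → ∞`
it becomes the ground state condition. On the Toric Code subspace the full Hamiltonian differs from
the Toric Code by a constant, so the condition is inherited (`isToricCodeGroundState`). -/

noncomputable section

namespace ToricTiling

/-! ### Shortcuts for instances of the quasi-local algebra -/

scoped instance (q : ℕ) : Ring (QL q) := inferInstance
scoped instance (q : ℕ) : Semiring (QL q) := inferInstance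
scoped instance (q : ℕ) : NonUnitalNonAssocSemiring (QL q) := inferInstance
scoped instance (q : ℕ) : NonUnitalNonAssocRing (QL q) := inferInstance
scoped instance (q : ℕ) : Monoid (QL q) := inferInstance
scoped instance (q : ℕ) : MulOneClass (QL q) := inferInstance
scoped instance (q : ℕ) : Semigroup (QL q) := inferInstance
scoped instance (q : ℕ) : Mul (QL q) := inferInstance
scoped instance (q : ℕ) : Add (QL q) := inferInstance
scoped instance (q : ℕ) : Sub (QL q) := inferInstance
scoped instance (q : ℕ) : Neg (QL q) := inferInstance
scoped instance (q : ℕ) : One (QL q) := inferInstance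
scoped instance (q : ℕ) : Zero (QL q) := inferInstance
scoped instance (q : ℕ) : AddCommGroup (QL q) := inferInstance
scoped instance (q : ℕ) : AddCommMonoid (QL q) := inferInstance
scoped instance (q : ℕ) : AddGroup (QL q) := inferInstance
scoped instance (q : ℕ) : AddMonoid (QL q) := inferInstance
scoped instance (q : ℕ) : AddZeroClass (QL q) := inferInstance
scoped instance (q : ℕ) : MulZeroClass (QL q) := inferInstance
scoped instance (q : ℕ) : StarRing (QL q) := inferInstance
scoped instance (q : ℕ) : StarMul (QL q) := inferInstance
scoped instance (q : ℕ) : Star (QL q) := inferInstance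
scoped instance (q : ℕ) : Algebra ℂ (QL q) := inferInstance
scoped instance (q : ℕ) : Module ℂ (QL q) := inferInstance
scoped instance (q : ℕ) : SMul ℂ (QL q) := inferInstance
scoped instance (q : ℕ) : StarModule ℂ (QL q) := inferInstance

/-! ### Relations between the matrix units -/

section MatrixUnits

variable {q : ℕ}

theorem QL.ext_apply {A B : QL q} (h : ∀ (f : Hil q) σ, (A : Op q) f σ = (B : Op q) f σ) :
    A = B :=
  Subtype.ext (ContinuousLinearMap.ext fun f => lp.ext (funext fun σ => h f σ))

theorem mu_apply (e : Site) (a b : Local q) (f : Hil q) (σ : Config q) :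
    (mu e a b : QL q).1 f σ = if σ e = a then f (Function.update σ e b) else 0 := rfl

theorem QL.mul_apply (A B : QL q) (f : Hil q) (σ : Config q) :
    ((A * B : QL q) : Op q) f σ = (A : Op q) ((B : Op q) f) σ := rfl

theorem mu_mul_mu (e : Site) (a b c d : Local q) :
    (mu e a b : QL q) * mu e c d = if b = c then mu e a d else 0 := by
  refine QL.ext_apply fun f σ => ?_
  rw [QL.mul_apply, mu_apply, mu_apply]
  split_ifs with h1 h2 h3 h3 <;> simp_all [mu_apply]

theorem mu_mul_mu_same (e : Site) (a b d : Local q) :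
    (mu e a b : QL q) * mu e b d = mu e a d := by simp [mu_mul_mu]

theorem mu_mul_mu_of_ne (e : Site) {a b c d : Local q} (h : b ≠ c) :
    (mu e a b : QL q) * mu e c d = 0 := by simp [mu_mul_mu, h]

theorem mu_commute {e e' : Site} (h : e ≠ e') (a b c d : Local q) :
    Commute (mu e a b : QL q) (mu e' c d) := by
  refine QL.ext_apply fun f σ => ?_
  rw [QL.mul_apply, QL.mul_apply]
  simp only [mu_apply, Function.update_of_ne h, Function.update_of_ne h.symm]
  rw [Function.update_comm h]
  split_ifs <;> rfl

/-- Both inner products are sums over the configurations with a prescribed value at `e`; changing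
that value is a bijection between the two index sets. -/
theorem star_mu (e : Site) (a b : Local q) : star (mu e a b : QL q) = mu e b a := by
  refine Subtype.ext ?_
  change star (siteUnit e a b) = siteUnit e b a
  rw [ContinuousLinearMap.star_eq_adjoint]
  symm
  rw [ContinuousLinearMap.eq_adjoint_iff]
  intro f g
  rw [lp.inner_eq_tsum, lp.inner_eq_tsum]
  simp only [siteUnit_apply]
  have e1 : ∀ σ : Config q, inner ℂ (if σ e = b then f (Function.update σ e a) else 0) (g σ) =
      Set.indicator {σ : Config q | σ e = b}
        (fun σ => inner ℂ (f (Function.update σ e a)) (g σ)) σ := by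
    intro σ; by_cases h : σ e = b <;> simp [Set.indicator, h]
  have e2 : ∀ σ : Config q, inner ℂ (f σ) (if σ e = a then g (Function.update σ e b) else 0) =
      Set.indicator {σ : Config q | σ e = a}
        (fun σ => inner ℂ (f σ) (g (Function.update σ e b))) σ := by
    intro σ; by_cases h : σ e = a <;> simp [Set.indicator, h]
  rw [tsum_congr e1, tsum_congr e2, ← tsum_subtype, ← tsum_subtype]
  let φ : {σ : Config q // σ e = b} ≃ {σ : Config q // σ e = a} :=
    { toFun := fun σ => ⟨Function.update σ.1 e a, by simp⟩
      invFun := fun σ => ⟨Function.update σ.1 e b, by simp⟩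
      left_inv := by rintro ⟨σ, rfl⟩; simp
      right_inv := by rintro ⟨σ, rfl⟩; simp }
  refine Eq.trans (tsum_congr ?_) (φ.tsum_eq fun σ : {σ : Config q // σ e = a} =>
    inner ℂ (f σ.1) (g (Function.update σ.1 e b)))
  rintro ⟨σ, rfl⟩
  simp [φ]

theorem sum_mu (e : Site) : ∑ a : Local q, (mu e a a : QL q) = 1 := by
  refine QL.ext_apply fun f σ => ?_
  have : ((∑ a : Local q, (mu e a a : QL q) : QL q) : Op q) f σ =
      ∑ a : Local q, (mu e a a : QL q).1 f σ := by
    rw [AddSubmonoidClass.coe_finsetSum, sum_apply, lp.coeFn_sum,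
      Finset.sum_apply]
  rw [this]
  simp only [mu_apply]
  rw [Finset.sum_ite_eq]
  simp

theorem tcProj_add_clProj (e : Site) : (tcProj e : QL q) + clProj e = 1 := by
  rw [← sum_mu e, Fintype.sum_sum_type]; rfl

end MatrixUnits

/-! ### Local observables -/

section Locality

variable {q : ℕ}

theorem localAlgebra_mono {Λ Λ' : Finset Site} (h : Λ ⊆ Λ') :
    localAlgebra q Λ ≤ localAlgebra q Λ' := by
  refine StarAlgebra.adjoin_mono ?_
  rintro T ⟨e, he, a, b, rfl⟩
  exact ⟨e, h he, a, b, rfl⟩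

theorem IsLocal.mono {Λ Λ' : Finset Site} {A : QL q} (hA : IsLocal Λ A) (h : Λ ⊆ Λ') :
    IsLocal Λ' A := localAlgebra_mono h hA

theorem isLocal_mu {Λ : Finset Site} {e : Site} (he : e ∈ Λ) (a b : Local q) :
    IsLocal Λ (mu e a b) := StarAlgebra.subset_adjoin ℂ _ ⟨e, he, a, b, rfl⟩

theorem IsLocal.add {Λ : Finset Site} {A B : QL q} (hA : IsLocal Λ A) (hB : IsLocal Λ B) :
    IsLocal Λ (A + B) := add_mem (S := StarSubalgebra ℂ (Op q)) hA hB

theorem IsLocal.sub {Λ : Finset Site} {A B : QL q} (hA : IsLocal Λ A) (hB : IsLocal Λ B) :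
    IsLocal Λ (A - B) := sub_mem (S := StarSubalgebra ℂ (Op q)) hA hB

theorem IsLocal.mul {Λ : Finset Site} {A B : QL q} (hA : IsLocal Λ A) (hB : IsLocal Λ B) :
    IsLocal Λ (A * B) := mul_mem (S := StarSubalgebra ℂ (Op q)) hA hB

theorem IsLocal.smul {Λ : Finset Site} {A : QL q} (c : ℂ) (hA : IsLocal Λ A) :
    IsLocal Λ (c • A) := (localAlgebra q Λ).smul_mem hA c

theorem IsLocal.star {Λ : Finset Site} {A : QL q} (hA : IsLocal Λ A) :
    IsLocal Λ (star A) := star_mem (S := StarSubalgebra ℂ (Op q)) hA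

theorem isLocal_one (Λ : Finset Site) : IsLocal Λ (1 : QL q) :=
  one_mem (localAlgebra q Λ)

theorem isLocal_zero (Λ : Finset Site) : IsLocal Λ (0 : QL q) :=
  zero_mem (localAlgebra q Λ)

theorem isLocal_sum {ι : Type*} {Λ : Finset Site} (s : Finset ι) (A : ι → QL q)
    (h : ∀ i ∈ s, IsLocal Λ (A i)) : IsLocal Λ (∑ i ∈ s, A i) := by
  classical
  induction s using Finset.induction_on with
  | empty => simpa using isLocal_zero Λ
  | insert i s hi ih =>
    rw [Finset.sum_insert hi]
    exact (h i (by simp)).add (ih fun j hj => h j (by simp [hj]))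

theorem isLocal_tcProj {Λ : Finset Site} {e : Site} (he : e ∈ Λ) :
    IsLocal Λ (tcProj e : QL q) := isLocal_sum _ _ fun _ _ => isLocal_mu he _ _

theorem isLocal_clProj {Λ : Finset Site} {e : Site} (he : e ∈ Λ) :
    IsLocal Λ (clProj e : QL q) := isLocal_sum _ _ fun _ _ => isLocal_mu he _ _

theorem isLocal_sigmaX {Λ : Finset Site} {e : Site} (he : e ∈ Λ) :
    IsLocal Λ (sigmaX e : QL q) := (isLocal_mu he _ _).add (isLocal_mu he _ _)

theorem isLocal_sigmaZ {Λ : Finset Site} {e : Site} (he : e ∈ Λ) :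
    IsLocal Λ (sigmaZ e : QL q) := (isLocal_mu he _ _).sub (isLocal_mu he _ _)

/-- The observables of disjoint regions commute. -/
theorem IsLocal.commute {Λ Λ' : Finset Site} (h : Disjoint Λ Λ') {A B : QL q}
    (hA : IsLocal Λ A) (hB : IsLocal Λ' B) : Commute A B := by
  have key : ∀ S ∈ localAlgebra q Λ, ∀ T ∈ localAlgebra q Λ', S * T = T * S := by
    intro S hS
    induction hS using StarAlgebra.adjoin_induction with
    | mem S hS =>
      obtain ⟨e, he, a, b, rfl⟩ := hS
      intro T hT
      -- All matrix units at once, since the adjoint case of the induction exchanges `a` and `b`.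
      have units : ∀ a b, siteUnit e a b * T = T * siteUnit e a b := by
        induction hT using StarAlgebra.adjoin_induction with
        | mem T hT =>
          obtain ⟨e', he', c, d, rfl⟩ := hT
          have hne : e ≠ e' := fun h' => (Finset.disjoint_left.1 h he) (h' ▸ he')
          exact fun a b => congrArg Subtype.val (mu_commute hne a b c d).eq
        | algebraMap r => exact fun a b => (Algebra.commutes r _).symm
        | add x y _ _ hx hy => intro a b; rw [mul_add, add_mul, hx, hy]
        | mul x y _ _ hx hy => intro a b; rw [← mul_assoc, hx, mul_assoc, hy, mul_assoc]
        | star x _ hx =>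
          intro a b
          have h1 : Star.star (siteUnit e b a : Op q) = siteUnit e a b :=
            congrArg Subtype.val (star_mu e b a)
          have := congrArg Star.star (hx b a)
          rw [star_mul, star_mul, h1] at this
          exact this.symm
      exact units a b
    | algebraMap r => intro T _; exact Algebra.commutes r _
    | add x y _ _ hx hy => intro T hT; rw [mul_add, add_mul, hx T hT, hy T hT]
    | mul x y _ _ hx hy =>
      intro T hT; rw [mul_assoc, hy T hT, ← mul_assoc, hx T hT, mul_assoc]
    | star x _ hx =>
      intro T hT
      have := congrArg Star.star (hx (Star.star T) (star_mem hT))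
      simpa using this.symm
  exact Subtype.ext (key _ hA _ hB)

end Locality

/-! ### One-spin operators -/

section OneSpin

variable {q : ℕ}

theorem star_tcProj (e : Site) : star (tcProj e : QL q) = tcProj e := by
  simp [tcProj, star_mu]

theorem tcProj_mul_inl (e : Site) (k : Fin 2) (b : Local q) :
    (tcProj e : QL q) * mu e (.inl k) b = mu e (.inl k) b := by
  fin_cases k <;> simp [tcProj, Fin.sum_univ_two, add_mul, mu_mul_mu]

theorem inl_mul_tcProj (e : Site) (a : Local q) (k : Fin 2) :
    (mu e a (.inl k) : QL q) * tcProj e = mu e a (.inl k) := by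
  fin_cases k <;> simp [tcProj, Fin.sum_univ_two, mul_add, mu_mul_mu]

theorem tcProj_mul_inr (e : Site) (c : Fin (q + 1)) (b : Local q) :
    (tcProj e : QL q) * mu e (.inr c) b = 0 := by
  simp [tcProj, Fin.sum_univ_two, add_mul, mu_mul_mu]

theorem inr_mul_tcProj (e : Site) (a : Local q) (c : Fin (q + 1)) :
    (mu e a (.inr c) : QL q) * tcProj e = 0 := by
  simp [tcProj, Fin.sum_univ_two, mul_add, mu_mul_mu]

theorem tcProj_mul_self (e : Site) : (tcProj e : QL q) * tcProj e = tcProj e := by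
  conv_lhs => rw [tcProj, Finset.sum_mul]
  exact Finset.sum_congr rfl fun k _ => inl_mul_tcProj e _ k

theorem clProj_eq (e : Site) : (clProj e : QL q) = 1 - tcProj e := by
  rw [← tcProj_add_clProj e, add_sub_cancel_left]

/-- The Pauli operators that enter the stabilizers: `σˣ` for stars, `σᶻ` for plaquettes. -/
def pauli : Bool → Site → QL q
  | true => sigmaX
  | false => sigmaZ

theorem isLocal_pauli {Λ : Finset Site} (t : Bool) {e : Site} (he : e ∈ Λ) :
    IsLocal Λ (pauli t e : QL q) := by
  cases t
  exacts [isLocal_sigmaZ he, isLocal_sigmaX he]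

theorem star_pauli (t : Bool) (e : Site) : star (pauli t e : QL q) = pauli t e := by
  cases t <;> simp [pauli, sigmaX, sigmaZ, star_mu, add_comm]

theorem pauli_mul_self (t : Bool) (e : Site) : (pauli t e : QL q) * pauli t e = tcProj e := by
  cases t <;>
    simp [pauli, sigmaX, sigmaZ, tcProj, Fin.sum_univ_two, mul_add, add_mul, mul_sub, sub_mul,
      mu_mul_mu, add_comm]

theorem tcProj_mul_pauli (t : Bool) (e : Site) :
    (tcProj e : QL q) * pauli t e = pauli t e := by
  cases t <;> simp [pauli, sigmaX, sigmaZ, mul_add, mul_sub, tcProj_mul_inl]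

theorem pauli_mul_tcProj (t : Bool) (e : Site) :
    (pauli t e : QL q) * tcProj e = pauli t e := by
  cases t <;> simp [pauli, sigmaX, sigmaZ, add_mul, sub_mul, inl_mul_tcProj]

theorem pauli_mul_inr (t : Bool) (e : Site) (c : Fin (q + 1)) (b : Local q) :
    (pauli t e : QL q) * mu e (.inr c) b = 0 := by
  cases t <;> simp [pauli, sigmaX, sigmaZ, add_mul, sub_mul, mu_mul_mu]

theorem inr_mul_pauli (t : Bool) (e : Site) (a : Local q) (c : Fin (q + 1)) :
    (mu e a (.inr c) : QL q) * pauli t e = 0 := by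
  cases t <;> simp [pauli, sigmaX, sigmaZ, mul_add, mul_sub, mu_mul_mu]

theorem pauli_not_mul_pauli (t : Bool) (e : Site) :
    (pauli (!t) e : QL q) * pauli t e = -(pauli t e * pauli (!t) e) := by
  cases t <;>
    simp [pauli, sigmaX, sigmaZ, mul_add, add_mul, mul_sub, sub_mul, mu_mul_mu] <;> abel

/-- Operators at different spins commute. -/
theorem commute_of_ne {e e' : Site} (h : e ≠ e') {A B : QL q} (hA : IsLocal {e} A)
    (hB : IsLocal {e'} B) : Commute A B :=
  hA.commute (by simpa using h) hB

theorem pauli_commute_of_ne {e e' : Site} (h : e ≠ e') (t t' : Bool) :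
    Commute (pauli t e : QL q) (pauli t' e') :=
  commute_of_ne h (isLocal_pauli t (by simp)) (isLocal_pauli t' (by simp))

theorem pauli_commute (t : Bool) (e e' : Site) : Commute (pauli t e : QL q) (pauli t e') := by
  by_cases h : e = e'
  · subst h; exact Commute.refl _
  · exact pauli_commute_of_ne h t t

/-- The projector onto the Toric Code subspace of a spin (`none`) or onto a colour. -/
def siteProj : Option (Fin (q + 1)) → Site → QL q
  | none, e => tcProj e
  | some c, e => mu e (.inr c) (.inr c)

theorem isLocal_siteProj {Λ : Finset Site} (o : Option (Fin (q + 1))) {e : Site} (he : e ∈ Λ) :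
    IsLocal Λ (siteProj o e : QL q) := by
  cases o
  exacts [isLocal_tcProj he, isLocal_mu he _ _]

theorem siteProj_mul_self (o : Option (Fin (q + 1))) (e : Site) :
    (siteProj o e : QL q) * siteProj o e = siteProj o e := by
  cases o
  exacts [tcProj_mul_self e, mu_mul_mu_same e _ _ _]

theorem star_siteProj (o : Option (Fin (q + 1))) (e : Site) :
    star (siteProj o e : QL q) = siteProj o e := by
  cases o
  exacts [star_tcProj e, star_mu e _ _]

theorem siteProj_mul_of_ne {o o' : Option (Fin (q + 1))} (h : o ≠ o') (e : Site) :
    (siteProj o e : QL q) * siteProj o' e = 0 := by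
  rcases o with _ | c <;> rcases o' with _ | c'
  · exact absurd rfl h
  · exact tcProj_mul_inr e _ _
  · exact inr_mul_tcProj e _ _
  · exact mu_mul_mu_of_ne e (by simpa using h)

theorem siteProj_commute (o o' : Option (Fin (q + 1))) (e e' : Site) :
    Commute (siteProj o e : QL q) (siteProj o' e') := by
  by_cases h : e = e'
  · subst h
    by_cases ho : o = o'
    · subst ho; exact Commute.refl _
    · rw [Commute, SemiconjBy, siteProj_mul_of_ne ho, siteProj_mul_of_ne (Ne.symm ho)]
  · exact commute_of_ne h (isLocal_siteProj o (by simp)) (isLocal_siteProj o' (by simp))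

theorem siteProj_commute_pauli (o : Option (Fin (q + 1))) (t : Bool) (e e' : Site) :
    Commute (siteProj o e : QL q) (pauli t e') := by
  by_cases h : e = e'
  · subst h
    rcases o with _ | c
    · rw [Commute, SemiconjBy, siteProj, tcProj_mul_pauli, pauli_mul_tcProj]
    · rw [Commute, SemiconjBy, siteProj, inr_mul_pauli, pauli_mul_inr]
  · exact commute_of_ne h (isLocal_siteProj o (by simp)) (isLocal_pauli t (by simp))

end OneSpin

/-! ### Sectors -/

/-- A sector assigns to each spin the Toric Code subspace (`none`) or a colour. -/
abbrev Sector (q : ℕ) := Site → Option (Fin (q + 1))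

section SectorProjector

variable {q : ℕ}

/-- The projector onto the states whose spins in `Λ` are in the sector `s`. -/
def sectorProj (s : Sector q) (Λ : Finset Site) : QL q :=
  Λ.noncommProd (fun e => siteProj (s e) e) fun e _ e' _ _ => siteProj_commute _ _ e e'

theorem tcRegion_eq_sectorProj (Λ : Finset Site) :
    (tcRegion Λ : QL q) = sectorProj (fun _ => none) Λ := rfl

theorem sectorProj_insert (s : Sector q) {Λ : Finset Site} {e : Site} (he : e ∉ Λ) :
    sectorProj s (insert e Λ) = siteProj (s e) e * sectorProj s Λ :=
  Finset.noncommProd_insert_of_notMem _ _ _ _ he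

theorem sectorProj_empty (s : Sector q) : sectorProj s ∅ = 1 := Finset.noncommProd_empty _ _

theorem sectorProj_congr {s s' : Sector q} {Λ : Finset Site} (h : ∀ e ∈ Λ, s e = s' e) :
    sectorProj s Λ = sectorProj s' Λ :=
  Finset.noncommProd_congr rfl (fun e he => by rw [h e he]) _

theorem commute_sectorProj {s : Sector q} {Λ : Finset Site} {A : QL q}
    (h : ∀ e ∈ Λ, Commute A (siteProj (s e) e)) : Commute A (sectorProj s Λ) :=
  Finset.noncommProd_commute _ _ _ _ h

theorem isLocal_sectorProj (s : Sector q) (Λ : Finset Site) : IsLocal Λ (sectorProj s Λ) := by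
  induction Λ using Finset.induction_on with
  | empty => rw [sectorProj_empty]; exact isLocal_one _
  | insert e Λ he ih =>
    rw [sectorProj_insert s he]
    exact (isLocal_siteProj _ (by simp)).mul (ih.mono (Finset.subset_insert _ _))

theorem siteProj_commute_sectorProj (s : Sector q) (Λ : Finset Site) (o : Option (Fin (q + 1)))
    (e : Site) : Commute (siteProj o e) (sectorProj s Λ) :=
  commute_sectorProj fun _ _ => siteProj_commute _ _ _ _

theorem pauli_commute_sectorProj (s : Sector q) (Λ : Finset Site) (t : Bool)
    (e : Site) : Commute (pauli t e) (sectorProj s Λ) :=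
  commute_sectorProj fun _ _ => (siteProj_commute_pauli _ _ _ _).symm

theorem star_sectorProj (s : Sector q) (Λ : Finset Site) :
    star (sectorProj s Λ) = sectorProj s Λ := by
  induction Λ using Finset.induction_on with
  | empty => simp [sectorProj_empty]
  | insert e Λ he ih =>
    rw [sectorProj_insert s he, star_mul, ih, star_siteProj,
      (siteProj_commute_sectorProj s Λ _ e).eq]

theorem siteProj_mul_sectorProj (s : Sector q) {Λ : Finset Site} {e : Site} (he : e ∈ Λ) :
    siteProj (s e) e * sectorProj s Λ = sectorProj s Λ := by
  rw [← Finset.insert_erase he, sectorProj_insert s (Finset.notMem_erase e Λ), ← mul_assoc,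
    siteProj_mul_self]

theorem sectorProj_mul_self (s : Sector q) (Λ : Finset Site) :
    sectorProj s Λ * sectorProj s Λ = sectorProj s Λ := by
  induction Λ using Finset.induction_on with
  | empty => simp [sectorProj_empty]
  | insert e Λ he ih =>
    rw [sectorProj_insert s he, mul_assoc, ← mul_assoc (sectorProj s Λ),
      ← (siteProj_commute_sectorProj s Λ _ e).eq, mul_assoc (siteProj (s e) e), ih, ← mul_assoc,
      siteProj_mul_self]

theorem siteProj_mul_sectorProj_of_ne (s : Sector q) {Λ : Finset Site} {e : Site} (he : e ∈ Λ)
    {o : Option (Fin (q + 1))} (h : o ≠ s e) : siteProj o e * sectorProj s Λ = 0 := by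
  rw [← siteProj_mul_sectorProj s he, ← mul_assoc, siteProj_mul_of_ne h, zero_mul]

/-- Inside a sector the one-spin projectors are the numbers `0` and `1`; in the form of a scalar
multiple they can be fed to `prod4_mul_of_smul`. -/
theorem tcProj_mul_sectorProj (s : Sector q) {Λ : Finset Site} {e : Site} (he : e ∈ Λ) :
    tcProj e * sectorProj s Λ = (if s e = none then (1 : ℂ) else 0) • sectorProj s Λ := by
  split_ifs with h
  · rw [one_smul, ← siteProj_mul_sectorProj s he, ← mul_assoc, h, siteProj, tcProj_mul_self]
  · rw [zero_smul]
    exact siteProj_mul_sectorProj_of_ne s he (o := none) (Ne.symm h)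

theorem clProj_mul_sectorProj (s : Sector q) {Λ : Finset Site} {e : Site} (he : e ∈ Λ) :
    clProj e * sectorProj s Λ = (if s e = none then (0 : ℂ) else 1) • sectorProj s Λ := by
  rw [clProj_eq, sub_mul, tcProj_mul_sectorProj s he]
  split_ifs <;> simp

theorem mu_mul_sectorProj (s : Sector q) {Λ : Finset Site} {e : Site} (he : e ∈ Λ)
    (c : Fin (q + 1)) :
    mu e (.inr c) (.inr c) * sectorProj s Λ =
      (if s e = some c then (1 : ℂ) else 0) • sectorProj s Λ := by
  split_ifs with h
  · have := siteProj_mul_sectorProj s he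
    rw [h] at this
    rw [one_smul]
    exact this
  · rw [zero_smul]
    exact siteProj_mul_sectorProj_of_ne s he (o := some c) (Ne.symm h)

theorem pauli_mul_sectorProj (s : Sector q) {Λ : Finset Site} {e : Site} (he : e ∈ Λ)
    (t : Bool) (h : s e ≠ none) : pauli t e * sectorProj s Λ = 0 := by
  rw [← pauli_mul_tcProj, mul_assoc, tcProj_mul_sectorProj s he, if_neg h, zero_smul, mul_zero]

/-- Changing the sector at one spin. -/
theorem sectorProj_update (s : Sector q) {Λ : Finset Site} {e : Site} (he : e ∈ Λ)
    (o : Option (Fin (q + 1))) :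
    sectorProj (Function.update s e o) Λ = siteProj o e * sectorProj s (Λ.erase e) := by
  conv_lhs => rw [← Finset.insert_erase he]
  rw [sectorProj_insert _ (Finset.notMem_erase e Λ), Function.update_self]
  congr 1
  refine sectorProj_congr fun e' he' => ?_
  rw [Function.update_of_ne (Finset.ne_of_mem_erase he')]

end SectorProjector

/-! ### Stabilizers -/

/-- The edges of a star (`true`) or a plaquette (`false`). -/
def cellEdge : Bool → ℤ → ℤ → Side → Site
  | true => starEdge
  | false => plaqEdge

section Stabilizers

variable {q : ℕ}

theorem commute_prod4 {A : QL q} {s : Side → Site} {T : Side → Site → QL q}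
    (h : ∀ i, Commute A (T i (s i))) : Commute A (prod4 s T) :=
  (((h _).mul_right (h _)).mul_right (h _)).mul_right (h _)

theorem isLocal_prod4 {Λ : Finset Site} {s : Side → Site} {T : Side → Site → QL q}
    (h : ∀ i, IsLocal Λ (T i (s i))) : IsLocal Λ (prod4 s T) :=
  (((h _).mul (h _)).mul (h _)).mul (h _)

theorem prod4_mul_of_smul {P : QL q} {s : Side → Site} {T : Side → Site → QL q} {c : Side → ℂ}
    (h : ∀ i, T i (s i) * P = c i • P) :
    prod4 s T * P = (c .north * c .east * c .south * c .west) • P := by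
  simp only [prod4, mul_assoc, h, mul_smul_comm, smul_smul]
  congr 1
  ring

theorem prod4_mul_of_semiconj {A : QL q} {s : Side → Site} {T : Side → Site → QL q} {c : Side → ℂ}
    (h : ∀ i, A * T i (s i) = c i • (T i (s i) * A)) :
    A * prod4 s T = (c .north * c .east * c .south * c .west) • (prod4 s T * A) := by
  have h1 : ∀ i (B : QL q), A * (T i (s i) * B) = c i • (T i (s i) * (A * B)) := fun i B => by
    rw [← mul_assoc, h, smul_mul_assoc, mul_assoc]
  simp only [prod4, mul_assoc, h1, h, mul_smul_comm, smul_smul]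

/-- The stabilizer of a star or a plaquette. -/
def stab (t : Bool) (x y : ℤ) : QL q := prod4 (cellEdge t x y) fun _ => pauli t

theorem pauli_commute_stab (t : Bool) (e : Site) (x y : ℤ) :
    Commute (pauli t e : QL q) (stab t x y) := commute_prod4 fun _ => pauli_commute t e _

theorem siteProj_commute_stab (o : Option (Fin (q + 1))) (e : Site) (t : Bool) (x y : ℤ) :
    Commute (siteProj o e : QL q) (stab t x y) :=
  commute_prod4 fun _ => siteProj_commute_pauli o t e _

theorem stab_commute_sectorProj (s : Sector q) (Λ : Finset Site) (t : Bool) (x y : ℤ) :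
    Commute (stab t x y) (sectorProj s Λ) :=
  commute_sectorProj fun _ _ => (siteProj_commute_stab _ _ _ _ _).symm

theorem star_stab (t : Bool) (x y : ℤ) : star (stab t x y : QL q) = stab t x y := by
  have hs : ∀ i, IsSelfAdjoint (pauli t (cellEdge t x y i) : QL q) := fun i => star_pauli t _
  have hc : ∀ i j, Commute (pauli t (cellEdge t x y i) : QL q) (pauli t (cellEdge t x y j)) :=
    fun i j => pauli_commute t _ _
  have h1 := ((hs .north).commute_iff (hs .east)).1 (hc _ _)
  have h2 := (h1.commute_iff (hs .south)).1 ((hc _ _).mul_left (hc _ _))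
  exact (h2.commute_iff (hs .west)).1 (((hc _ _).mul_left (hc _ _)).mul_left (hc _ _))

theorem stab_mul_self (t : Bool) (x y : ℤ) :
    (stab t x y : QL q) * stab t x y = prod4 (cellEdge t x y) fun _ => tcProj := by
  have hc : ∀ i j, Commute (pauli t (cellEdge t x y i) : QL q) (pauli t (cellEdge t x y j)) :=
    fun i j => pauli_commute t _ _
  simp only [stab, prod4]
  rw [Commute.mul_mul_mul_comm (((hc _ _).mul_left (hc _ _)).mul_left (hc _ _)).symm,
    Commute.mul_mul_mul_comm ((hc _ _).mul_left (hc _ _)).symm,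
    Commute.mul_mul_mul_comm (hc _ _).symm]
  simp only [pauli_mul_self]

theorem cellEdge_injective (t : Bool) (x y : ℤ) : Function.Injective (cellEdge t x y) := by
  intro i j h
  cases t <;> cases i <;> cases j <;>
    simp [cellEdge, starEdge, plaqEdge, hEdge, vEdge] at h ⊢ <;> omega

theorem pauli_not_mul_stab_aux (t : Bool) (e : Site) (x y : ℤ) (i : Side) :
    (pauli (!t) e : QL q) * pauli t (cellEdge t x y i) =
      (if cellEdge t x y i = e then (-1 : ℂ) else 1) •
        (pauli t (cellEdge t x y i) * pauli (!t) e) := by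
  split_ifs with h
  · subst h
    rw [pauli_not_mul_pauli, neg_one_smul]
  · rw [one_smul]
    exact (pauli_commute_of_ne (Ne.symm h) _ _).eq

theorem pauli_not_mul_stab (t : Bool) (e : Site) (x y : ℤ) :
    (pauli (!t) e : QL q) * stab t x y =
      ((if cellEdge t x y .north = e then (-1 : ℂ) else 1) *
        (if cellEdge t x y .east = e then (-1 : ℂ) else 1) *
        (if cellEdge t x y .south = e then (-1 : ℂ) else 1) *
        (if cellEdge t x y .west = e then (-1 : ℂ) else 1)) •
        (stab t x y * pauli (!t) e) :=
  prod4_mul_of_semiconj (c := fun i => if cellEdge t x y i = e then (-1 : ℂ) else 1)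
    fun i => pauli_not_mul_stab_aux t e x y i

/-- The four edges of a cell are distinct, so exactly one of the four factors contributes a sign. -/
theorem pauli_not_mul_stab_of_mem (t : Bool) (x y : ℤ) (i : Side) :
    (pauli (!t) (cellEdge t x y i) : QL q) * stab t x y =
      -(stab t x y * pauli (!t) (cellEdge t x y i)) := by
  have h := fun j (hj : j ≠ i) => (cellEdge_injective t x y).ne hj
  rw [pauli_not_mul_stab]
  cases i <;> simp [h]

theorem pauli_not_commute_stab (t : Bool) (e : Site) (x y : ℤ)
    (h : ∀ i, cellEdge t x y i ≠ e) : Commute (pauli (!t) e : QL q) (stab t x y) := by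
  rw [Commute, SemiconjBy, pauli_not_mul_stab]
  simp [h]

/-- A star and a plaquette share either no edge or two, so the signs of the anticommuting Paulis
multiply to one. -/
theorem stab_commute_stab (t t' : Bool) (x y x' y' : ℤ) :
    Commute (stab t x y : QL q) (stab t' x' y') := by
  by_cases ht : t = t'
  · subst ht
    exact commute_prod4 fun i => (pauli_commute_stab t _ x y).symm
  · obtain rfl : t' = !t := by cases t <;> cases t' <;> simp_all
    have h := prod4_mul_of_semiconj (q := q) (A := stab t x y) (s := cellEdge (!t) x' y')
      (T := fun _ => pauli (!t)) (c := fun j =>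
        ((if cellEdge t x y .north = cellEdge (!t) x' y' j then (-1 : ℂ) else 1) *
        (if cellEdge t x y .east = cellEdge (!t) x' y' j then (-1 : ℂ) else 1) *
        (if cellEdge t x y .south = cellEdge (!t) x' y' j then (-1 : ℂ) else 1) *
        (if cellEdge t x y .west = cellEdge (!t) x' y' j then (-1 : ℂ) else 1))) ?_
    · refine h.trans ((congrArg (· • _) ?_).trans (one_smul ℂ _))
      cases t <;>
        simp only [cellEdge, Bool.not_true, Bool.not_false, starEdge, plaqEdge, hEdge, vEdge,
          Prod.mk.injEq, reduceCtorEq, false_and, true_and, if_false, one_mul, mul_one]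
      all_goals
        split_ifs <;> first | (exfalso; omega) | norm_num
    · intro j
      rw [pauli_not_mul_stab, smul_smul]
      split_ifs <;> simp

end Stabilizers

/-! ### Completely positive local maps -/

section Kraus

variable {q : ℕ}

/-- The map `X ↦ K† X K`. -/
def conjMap (K : QL q) : QL q →ₗ[ℂ] QL q where
  toFun X := star K * X * K
  map_add' X Y := by rw [mul_add, add_mul]
  map_smul' c X := by rw [mul_smul_comm, smul_mul_assoc, RingHom.id_apply]

theorem conjMap_apply (K X : QL q) : conjMap K X = star K * X * K := rfl

/-- The completely positive maps `X ↦ ∑ K† X K` with `K ∈ B_Λ`. -/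
def IsKraus (Λ : Finset Site) (T : QL q →ₗ[ℂ] QL q) : Prop :=
  ∃ (ι : Type) (_ : Fintype ι) (K : ι → QL q), (∀ i, IsLocal Λ (K i)) ∧ T = ∑ i, conjMap (K i)

theorem isKraus_conjMap {Λ : Finset Site} {K : QL q} (hK : IsLocal Λ K) :
    IsKraus Λ (conjMap K) :=
  ⟨Unit, inferInstance, fun _ => K, fun _ => hK, by simp⟩

theorem isKraus_id (Λ : Finset Site) : IsKraus Λ (LinearMap.id : QL q →ₗ[ℂ] QL q) := by
  convert isKraus_conjMap (isLocal_one (q := q) Λ)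
  ext X
  simp [conjMap_apply]

theorem IsKraus.comp {Λ : Finset Site} {T T' : QL q →ₗ[ℂ] QL q} (hT : IsKraus Λ T)
    (hT' : IsKraus Λ T') : IsKraus Λ (T ∘ₗ T') := by
  obtain ⟨ι, _, K, hK, rfl⟩ := hT
  obtain ⟨κ, _, L, hL, rfl⟩ := hT'
  refine ⟨ι × κ, inferInstance, fun i => L i.2 * K i.1, fun i => (hL _).mul (hK _), ?_⟩
  refine LinearMap.ext fun X => ?_
  simp only [LinearMap.comp_apply, LinearMap.sum_apply, conjMap_apply, Fintype.sum_prod_type,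
    star_mul, Finset.mul_sum, Finset.sum_mul, mul_assoc]

theorem IsKraus.add {Λ : Finset Site} {T T' : QL q →ₗ[ℂ] QL q} (hT : IsKraus Λ T)
    (hT' : IsKraus Λ T') : IsKraus Λ (T + T') := by
  obtain ⟨ι, _, K, hK, rfl⟩ := hT
  obtain ⟨κ, _, L, hL, rfl⟩ := hT'
  exact ⟨ι ⊕ κ, inferInstance, Sum.elim K L, by rintro (i | i); exacts [hK i, hL i],
    by simp [Fintype.sum_sum_type]⟩

theorem IsKraus.smul {Λ : Finset Site} {T : QL q →ₗ[ℂ] QL q} (hT : IsKraus Λ T) {r : ℝ}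
    (hr : 0 ≤ r) : IsKraus Λ ((r : ℂ) • T) := by
  obtain ⟨ι, _, K, hK, rfl⟩ := hT
  refine ⟨ι, inferInstance, fun i => ((Real.sqrt r : ℝ) : ℂ) • K i, fun i => (hK i).smul _, ?_⟩
  refine LinearMap.ext fun X => ?_
  simp only [LinearMap.smul_apply, LinearMap.sum_apply, conjMap_apply, Finset.smul_sum, star_smul,
    smul_mul_assoc, mul_smul_comm, smul_smul]
  refine Finset.sum_congr rfl fun i _ => ?_
  congr 1
  simp only [Complex.star_def, Complex.conj_ofReal]
  rw [← Complex.ofReal_mul, Real.mul_self_sqrt hr]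

theorem isKraus_sum {κ : Type*} {Λ : Finset Site} (s : Finset κ) (T : κ → QL q →ₗ[ℂ] QL q)
    (h : ∀ i ∈ s, IsKraus Λ (T i)) : IsKraus Λ (∑ i ∈ s, T i) := by
  classical
  induction s using Finset.induction_on with
  | empty => exact ⟨Empty, inferInstance, Empty.elim, fun i => i.elim, by simp⟩
  | insert i s hi ih =>
    rw [Finset.sum_insert hi]
    exact (h i (by simp)).add (ih fun j hj => h j (by simp [hj]))

theorem IsKraus.map_star_mul_self_nonneg {Λ : Finset Site} {T : QL q →ₗ[ℂ] QL q}
    (hT : IsKraus Λ T) (ω : State q) (A : QL q) : 0 ≤ ω.toLin (T (star A * A)) := by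
  obtain ⟨ι, _, K, hK, rfl⟩ := hT
  rw [LinearMap.sum_apply, map_sum]
  refine Finset.sum_nonneg fun i _ => ?_
  have := ω.nonneg (A * K i)
  rwa [star_mul, mul_assoc, ← mul_assoc (star A), ← mul_assoc] at this

/-- Ground states do not gain energy under completely positive local maps. -/
theorem IsKraus.ground {Λ : Finset Site} {T : QL q →ₗ[ℂ] QL q} (hT : IsKraus Λ T)
    {Φ : Interaction → QL q} {ω : State q} (hω : IsGroundState Φ ω) :
    0 ≤ ω.toLin (T (restrict Φ (bar Λ)) - T 1 * restrict Φ (bar Λ)) := by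
  obtain ⟨ι, _, K, hK, rfl⟩ := hT
  rw [LinearMap.sum_apply, LinearMap.sum_apply, Finset.sum_mul, ← Finset.sum_sub_distrib, map_sum]
  refine Finset.sum_nonneg fun i _ => ?_
  have := hω Λ (K i) (hK i)
  rwa [mul_sub, ← mul_assoc, ← mul_assoc, ← mul_one (star (K i)), mul_assoc (star (K i)) 1,
    one_mul] at this

/-- `T (Y X) = T(Y) X` for all `Y`. -/
def Modular (T : QL q →ₗ[ℂ] QL q) (X : QL q) : Prop := ∀ Y, T (Y * X) = T Y * X

/-- Modularity at an interaction turns `T X` into `T 1 * X`; such interactions drop out of the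
inequality `IsKraus.ground`. -/
theorem modular_conjMap {K X : QL q} (h : Commute K X) : Modular (conjMap K) X := fun Y => by
  rw [conjMap_apply, conjMap_apply, mul_assoc, mul_assoc, ← h.eq, mul_assoc, mul_assoc]

theorem modular_id (X : QL q) : Modular (LinearMap.id : QL q →ₗ[ℂ] QL q) X := fun _ => rfl

theorem Modular.comp {T T' : QL q →ₗ[ℂ] QL q} {X : QL q} (h : Modular T X) (h' : Modular T' X) :
    Modular (T ∘ₗ T') X := fun Y => by
  rw [LinearMap.comp_apply, LinearMap.comp_apply, h', h]

theorem Modular.add {T T' : QL q →ₗ[ℂ] QL q} {X : QL q} (h : Modular T X) (h' : Modular T' X) :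
    Modular (T + T') X := fun Y => by
  rw [LinearMap.add_apply, LinearMap.add_apply, h', h, add_mul]

theorem Modular.smul {T : QL q →ₗ[ℂ] QL q} {X : QL q} (h : Modular T X) (c : ℂ) :
    Modular (c • T) X := fun Y => by
  rw [LinearMap.smul_apply, LinearMap.smul_apply, h, smul_mul_assoc]

theorem modular_sum {κ : Type*} {X : QL q} (s : Finset κ) (T : κ → QL q →ₗ[ℂ] QL q)
    (h : ∀ i ∈ s, Modular (T i) X) : Modular (∑ i ∈ s, T i) X := fun Y => by
  rw [LinearMap.sum_apply, LinearMap.sum_apply, Finset.sum_mul]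
  exact Finset.sum_congr rfl fun i hi => h i hi Y

end Kraus

/-! ### Correcting a stabilizer -/

section Correction

variable {q : ℕ}

/-- An involution `A` and a self-adjoint unitary `Z` that anticommutes with it, both in the corner
of the projector `p`. -/
structure IsCorrection (p A Z : QL q) : Prop where
  star_p : star p = p
  star_A : star A = A
  star_Z : star Z = Z
  pp : p * p = p
  pA : p * A = A
  Ap : A * p = A
  AA : A * A = p
  pZ : p * Z = Z
  Zp : Z * p = Z
  ZZ : Z * Z = p
  ZA : Z * A = -(A * Z)

/-- Measure `A`, and apply `Z` if the outcome is `-1` (in the Heisenberg picture). -/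
def correct (p A Z : QL q) : QL q →ₗ[ℂ] QL q :=
  (((1 / 4 : ℝ) : ℂ)) • (conjMap (p + A) + conjMap (Z * (p - A)))

theorem isKraus_correct {Λ : Finset Site} {p A Z : QL q} (hp : IsLocal Λ p) (hA : IsLocal Λ A)
    (hZ : IsLocal Λ Z) : IsKraus Λ (correct p A Z) :=
  ((isKraus_conjMap (hp.add hA)).add (isKraus_conjMap (hZ.mul (hp.sub hA)))).smul (by norm_num)

theorem modular_correct {p A Z X : QL q} (hp : Commute p X) (hA : Commute A X)
    (hZ : Commute Z X) : Modular (correct p A Z) X :=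
  ((modular_conjMap (hp.add_left hA)).add
    (modular_conjMap (hZ.mul_left (hp.sub_left hA)))).smul _

/-- The observable factors out of both branches, which leaves `(p + A) / 2 + (p - A) / 2 = p`. -/
theorem IsCorrection.correct_of_commute {p A Z Y : QL q} (h : IsCorrection p A Z)
    (hA : Commute Y A) (hZ : Commute Y Z) (hp : p * Y = Y) (hp' : Y * p = Y) :
    correct p A Z Y = Y := by
  have hYp : Commute Y p := hp'.trans hp.symm
  have h1 : (p + A) * (p + A) = (2 : ℂ) • (p + A) := by
    rw [mul_add, add_mul, add_mul, h.pp, h.Ap, h.pA, h.AA, two_smul]; abel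
  have h2 : (p - A) * Z * (Z * (p - A)) = (2 : ℂ) • (p - A) := by
    rw [mul_assoc, ← mul_assoc Z, h.ZZ, mul_sub, mul_sub, sub_mul, sub_mul, h.pp, h.Ap, h.pA, h.pp,
      h.pA, h.AA, two_smul]; abel
  have e1 : conjMap (p + A) Y = Y * ((p + A) * (p + A)) := by
    rw [conjMap_apply, star_add, h.star_p, h.star_A, ← (hYp.add_right hA).eq, mul_assoc]
  have e2 : conjMap (Z * (p - A)) Y = Y * ((p - A) * Z * (Z * (p - A))) := by
    rw [conjMap_apply, star_mul, star_sub, h.star_p, h.star_A, h.star_Z,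
      ← ((hYp.sub_right hA).mul_right hZ).eq, mul_assoc]
  rw [correct, LinearMap.smul_apply, LinearMap.add_apply, e1, e2, h1, h2, ← mul_add, ← smul_add,
    add_add_sub_cancel, ← two_smul ℂ p, mul_smul_comm, mul_smul_comm, hp', smul_smul, smul_smul]
  norm_num

/-- The branch with outcome `+1` is kept, and in the other one `Z` turns `-1` into `+1`; afterwards
`A` has the value `1` on the corner. -/
theorem IsCorrection.correct_self {p A Z : QL q} (h : IsCorrection p A Z) :
    correct p A Z A = p := by
  have e1 : conjMap (p + A) A = (2 : ℂ) • (p + A) := by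
    rw [conjMap_apply, star_add, h.star_p, h.star_A, add_mul, h.pA, h.AA, mul_add, add_mul,
      add_mul, h.Ap, h.AA, h.pp, h.pA, two_smul]; abel
  have e0 : Z * A * Z = -A := by rw [h.ZA, neg_mul, mul_assoc, h.ZZ, h.Ap]
  have e2 : conjMap (Z * (p - A)) A = (2 : ℂ) • (p - A) := by
    rw [conjMap_apply, star_mul, star_sub, h.star_p, h.star_A, h.star_Z,
      show (p - A) * Z * A * (Z * (p - A)) = (p - A) * (Z * A * Z) * (p - A) by
        simp only [mul_assoc], e0, mul_neg, sub_mul, h.pA, h.AA, neg_sub, mul_sub, sub_mul,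
      sub_mul, h.pp, h.Ap, h.pA, h.AA, two_smul]; abel
  rw [correct, LinearMap.smul_apply, LinearMap.add_apply, e1, e2, ← smul_add,
    add_add_sub_cancel, ← two_smul ℂ p, smul_smul, smul_smul]
  norm_num

/-- Successive corrections, the head of the list being the first one. -/
def correctList (p : QL q) (L : List (QL q × QL q)) : QL q →ₗ[ℂ] QL q :=
  L.foldr (fun c T => correct p c.1 c.2 ∘ₗ T) LinearMap.id

theorem isKraus_correctList {Λ : Finset Site} {p : QL q} {L : List (QL q × QL q)}
    (hp : IsLocal Λ p) (hL : ∀ c ∈ L, IsLocal Λ c.1 ∧ IsLocal Λ c.2) :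
    IsKraus Λ (correctList p L) := by
  induction L with
  | nil => exact isKraus_id Λ
  | cons c L ih =>
    exact (isKraus_correct hp (hL c (by simp)).1 (hL c (by simp)).2).comp
      (ih fun d hd => hL d (by simp [hd]))

theorem modular_correctList {p X : QL q} {L : List (QL q × QL q)} (hp : Commute p X)
    (hL : ∀ c ∈ L, Commute c.1 X ∧ Commute c.2 X) : Modular (correctList p L) X := by
  induction L with
  | nil => exact modular_id X
  | cons c L ih =>
    exact (modular_correct hp (hL c (by simp)).1 (hL c (by simp)).2).comp
      (ih fun d hd => hL d (by simp [hd]))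

theorem correctList_of_commute {p Y : QL q} {L : List (QL q × QL q)}
    (hL : ∀ c ∈ L, IsCorrection p c.1 c.2) (hY : ∀ c ∈ L, Commute Y c.1 ∧ Commute Y c.2)
    (hp : p * Y = Y) (hp' : Y * p = Y) : correctList p L Y = Y := by
  induction L with
  | nil => rfl
  | cons c L ih =>
    change correct p c.1 c.2 (correctList p L Y) = Y
    rw [ih (fun d hd => hL d (by simp [hd])) fun d hd => hY d (by simp [hd])]
    exact (hL c (by simp)).correct_of_commute (hY c (by simp)).1 (hY c (by simp)).2 hp hp'

theorem correctList_p {p : QL q} {L : List (QL q × QL q)} (hpp : p * p = p)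
    (hL : ∀ c ∈ L, IsCorrection p c.1 c.2) : correctList p L p = p :=
  correctList_of_commute hL (fun c hc => ⟨(hL c hc).pA.trans (hL c hc).Ap.symm,
    (hL c hc).pZ.trans (hL c hc).Zp.symm⟩) hpp hpp

/-- Every involution of the list is corrected, if no later correction affects it. -/
theorem correctList_of_mem {p : QL q} {L : List (QL q × QL q)} (hpp : p * p = p)
    (hL : ∀ c ∈ L, IsCorrection p c.1 c.2)
    (hA : ∀ c ∈ L, ∀ d ∈ L, Commute c.1 d.1)
    (hZ : L.Pairwise fun c d => Commute c.1 d.2) {c : QL q × QL q} (hc : c ∈ L) :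
    correctList p L c.1 = p := by
  induction L with
  | nil => simp at hc
  | cons d L ih =>
    have hd : IsCorrection p d.1 d.2 := hL d (by simp)
    change correct p d.1 d.2 (correctList p L c.1) = p
    rw [List.pairwise_cons] at hZ
    -- The head is untouched by the rest of the list and set to `p` by its own correction. For a
    -- member of the tail, the head only meets the result `p`, which it fixes.
    rcases List.mem_cons.1 hc with rfl | hc'
    · rw [correctList_of_commute (fun e he => hL e (by simp [he])) (fun e he =>
        ⟨hA _ (by simp) e (by simp [he]), hZ.1 e he⟩) hd.pA hd.Ap, hd.correct_self]
    · rw [ih (fun e he => hL e (by simp [he])) (fun e he e' he' =>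
        hA e (by simp [he]) e' (by simp [he'])) hZ.2 hc']
      exact hd.correct_of_commute (hd.pA.trans hd.Ap.symm) (hd.pZ.trans hd.Zp.symm) hpp hpp

end Correction

/-! ### Filling classical spins with Toric Code states -/

section Fill

variable {q : ℕ}

/-- Replace the colour `c` of the spin `e` by the maximally mixed Toric Code state. -/
def fillSite (e : Site) (c : Fin (q + 1)) : QL q →ₗ[ℂ] QL q :=
  ((1 / 2 : ℝ) : ℂ) • ∑ k : Fin 2, conjMap (mu e (.inl k) (.inr c))

theorem isKraus_fillSite {Λ : Finset Site} {e : Site} (he : e ∈ Λ) (c : Fin (q + 1)) :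
    IsKraus Λ (fillSite e c) :=
  (isKraus_sum _ _ fun _ _ => isKraus_conjMap (isLocal_mu he _ _)).smul (by norm_num)

theorem modular_fillSite {e : Site} {c : Fin (q + 1)} {X : QL q}
    (h : ∀ a b, Commute (mu e a b) X) : Modular (fillSite e c) X :=
  (modular_sum _ _ fun _ _ => modular_conjMap (h _ _)).smul _

theorem fillSite_tcProj_mul {e : Site} {c : Fin (q + 1)} {Y : QL q}
    (hY : ∀ a b, Commute (mu e a b) Y) :
    fillSite e c (siteProj none e * Y) = siteProj (some c) e * Y := by
  have h : ∀ k : Fin 2, conjMap (mu e (.inl k) (.inr c)) (tcProj e * Y) =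
      mu e (.inr c) (.inr c) * Y := fun k => by
    rw [conjMap_apply, star_mu, ← mul_assoc, inl_mul_tcProj, mul_assoc, ← (hY _ _).eq, ← mul_assoc,
      mu_mul_mu_same]
  simp only [siteProj, fillSite, LinearMap.smul_apply, LinearMap.sum_apply, h, Finset.sum_const,
    Finset.card_univ, Fintype.card_fin]
  rw [← Nat.cast_smul_eq_nsmul ℂ, smul_smul]
  norm_num

theorem eq_zero_of_eq_neg {X : QL q} (h : X = -X) : X = 0 := by
  have h2 : (2 : ℂ) • X = 0 := by
    rw [two_smul]
    nth_rewrite 2 [h]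
    exact add_neg_cancel X
  rw [← one_smul ℂ X, ← inv_mul_cancel₀ (two_ne_zero (α := ℂ)), mul_smul, h2, smul_zero]

/-- Filling with the maximally mixed state amounts to a partial trace over the spin, and an operator
that anticommutes with a Pauli there has partial trace zero. For `σᶻ` both diagonal entries vanish,
for `σˣ` they cancel each other. -/
theorem fillSite_of_anticommute {e : Site} {c : Fin (q + 1)} {Y : QL q} (t : Bool)
    (h : pauli t e * Y = -(Y * pauli t e)) : fillSite e c Y = 0 := by
  rw [fillSite, LinearMap.smul_apply, LinearMap.sum_apply, Fin.sum_univ_two]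
  simp only [conjMap_apply, star_mu]
  have hsum : mu e (.inr c) (.inl 0) * Y * mu e (.inl 0) (.inr c) +
      mu e (.inr c) (.inl 1) * Y * mu e (.inl 1) (.inr c) = 0 := by
    cases t
    · have a0 : (mu e (.inr c) (.inl 0) : QL q) * sigmaZ e = mu e (.inr c) (.inl 0) := by
        simp [sigmaZ, mul_sub, mu_mul_mu]
      have a1 : (mu e (.inr c) (.inl 1) : QL q) * sigmaZ e = -mu e (.inr c) (.inl 1) := by
        simp [sigmaZ, mul_sub, mu_mul_mu]
      have b0 : (sigmaZ e : QL q) * mu e (.inl 0) (.inr c) = mu e (.inl 0) (.inr c) := by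
        simp [sigmaZ, sub_mul, mu_mul_mu]
      have b1 : (sigmaZ e : QL q) * mu e (.inl 1) (.inr c) = -mu e (.inl 1) (.inr c) := by
        simp [sigmaZ, sub_mul, mu_mul_mu]
      have h' : sigmaZ e * Y = -(Y * sigmaZ e) := h
      have c0 : mu e (.inr c) (.inl 0) * Y * mu e (.inl 0) (.inr c) =
          -(mu e (.inr c) (.inl 0) * Y * mu e (.inl 0) (.inr c)) := by
        conv_lhs => rw [← a0, mul_assoc _ (sigmaZ e), h', mul_neg, neg_mul, ← mul_assoc, mul_assoc,
          b0]
      have c1 : mu e (.inr c) (.inl 1) * Y * mu e (.inl 1) (.inr c) =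
          -(mu e (.inr c) (.inl 1) * Y * mu e (.inl 1) (.inr c)) := by
        conv_lhs => rw [← neg_neg (mu e (.inr c) (.inl 1)), ← a1, neg_mul, mul_assoc _ (sigmaZ e),
          h', mul_neg, neg_neg, ← mul_assoc, mul_assoc, b1, mul_neg]
      rw [eq_zero_of_eq_neg c0, eq_zero_of_eq_neg c1, add_zero]
    · have a0 : (mu e (.inr c) (.inl 0) : QL q) = mu e (.inr c) (.inl 1) * sigmaX e := by
        simp [sigmaX, mul_add, mu_mul_mu]
      have b1 : (sigmaX e : QL q) * mu e (.inl 0) (.inr c) = mu e (.inl 1) (.inr c) := by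
        simp [sigmaX, add_mul, mu_mul_mu]
      have h' : sigmaX e * Y = -(Y * sigmaX e) := h
      rw [a0, mul_assoc _ (sigmaX e), h', mul_neg, neg_mul, ← mul_assoc, mul_assoc, b1,
        neg_add_cancel]
  rw [hsum, smul_zero]

/-- Fill all spins of the list. -/
def fillList (s : Site → Fin (q + 1)) (L : List Site) : QL q →ₗ[ℂ] QL q :=
  L.foldr (fun e T => fillSite e (s e) ∘ₗ T) LinearMap.id

theorem isKraus_fillList {Λ : Finset Site} (s : Site → Fin (q + 1)) {L : List Site}
    (hL : ∀ e ∈ L, e ∈ Λ) : IsKraus Λ (fillList s L) := by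
  induction L with
  | nil => exact isKraus_id Λ
  | cons e L ih =>
    exact (isKraus_fillSite (hL e (by simp)) _).comp (ih fun d hd => hL d (by simp [hd]))

theorem modular_fillList {s : Site → Fin (q + 1)} {X : QL q} {L : List Site}
    (hL : ∀ e ∈ L, ∀ a b, Commute (mu e a b) X) : Modular (fillList s L) X := by
  induction L with
  | nil => exact modular_id X
  | cons e L ih =>
    exact (modular_fillSite (hL e (by simp))).comp (ih fun d hd => hL d (by simp [hd]))

/-- Together with `modular_fillList` this carries a Pauli of the head spin through the filling of
the other spins, so that anticommutation survives in `fillList_of_anticommute`. -/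
theorem left_modular_fillList {s : Site → Fin (q + 1)} {X : QL q} {L : List Site}
    (hL : ∀ e ∈ L, ∀ a b, Commute (mu e a b) X) (Y : QL q) :
    fillList s L (X * Y) = X * fillList s L Y := by
  induction L with
  | nil => rfl
  | cons e L ih =>
    change fillSite e (s e) (fillList s L (X * Y)) = X * fillSite e (s e) (fillList s L Y)
    rw [ih fun d hd => hL d (by simp [hd])]
    simp only [fillSite, LinearMap.smul_apply, LinearMap.sum_apply, mul_smul_comm, Finset.mul_sum,
      conjMap_apply, star_mu, ← mul_assoc, (hL e (by simp) _ _).eq]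

theorem fillList_of_anticommute {c : Site → Fin (q + 1)} {L : List Site} (hL : L.Nodup)
    {e : Site} (he : e ∈ L) {Y : QL q} (t : Bool) (h : pauli t e * Y = -(Y * pauli t e)) :
    fillList c L Y = 0 := by
  induction L with
  | nil => simp at he
  | cons d L ih =>
    rw [List.nodup_cons] at hL
    change fillSite d (c d) (fillList c L Y) = 0
    rcases List.mem_cons.1 he with rfl | he'
    · refine fillSite_of_anticommute t ?_
      have hc : ∀ d ∈ L, ∀ a b, Commute (mu d a b : QL q) (pauli t e) := fun d hd a b =>
        commute_of_ne (ne_of_mem_of_not_mem hd hL.1) (isLocal_mu (by simp) a b)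
          (isLocal_pauli t (by simp))
      rw [← left_modular_fillList hc, h, map_neg, modular_fillList hc]
    · rw [ih hL.2 he', map_zero]

theorem fillList_sectorProj {c : Site → Fin (q + 1)} {L : List Site} (hL : L.Nodup)
    {Λ : Finset Site} (hΛ : ∀ e ∈ L, e ∈ Λ) (s : Sector q) (hs : ∀ e ∈ L, s e = some (c e)) :
    fillList c L (sectorProj (fun e => if e ∈ L then none else s e) Λ) = sectorProj s Λ := by
  induction L generalizing s with
  | nil => simp [fillList]
  | cons e L ih =>
    rw [List.nodup_cons] at hL
    -- The tail is applied to the sector whose head spin is already in the Toric Code subspace; the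
    -- head then restores its colour.
    have key := ih hL.2 (fun d hd => hΛ d (by simp [hd])) (Function.update s e none)
      (fun d hd => by
        rw [Function.update_of_ne (ne_of_mem_of_not_mem hd hL.1)]; exact hs d (by simp [hd]))
    have hfun : (fun d => if d ∈ L then none else Function.update s e none d) =
        fun d => if d ∈ e :: L then none else s d := by
      funext d
      by_cases hd : d = e
      · subst hd; simp
      · simp [hd]
    rw [hfun] at key
    change fillSite e (c e) (fillList c L _) = _
    have he : e ∈ Λ := hΛ e (by simp)
    rw [key, sectorProj_update s he, fillSite_tcProj_mul, ← sectorProj_update s he,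
      ← hs e (by simp), Function.update_eq_self]
    intro a b
    exact (isLocal_mu (Finset.mem_singleton_self e) a b).commute
      (Finset.disjoint_singleton_left.2 (Finset.notMem_erase e Λ)) (isLocal_sectorProj s _)

end Fill

/-! ### Energies of sectors -/

section Energies

variable {q : ℕ}

/-- The weights of the star tiles (`true`) and of the plaquette tiles (`false`). -/
def cellWeight (ρ : Rows q) : Bool → ℕ → ℕ → ℕ → ℕ → ℝ
  | true => ρ.starWeight
  | false => ρ.tileWeight

/-- The colour of a classical spin. -/
def colour (s : Sector q) (e : Site) : ℕ := ((s e).getD 0 : Fin (q + 1))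

/-- The weight of a cell in a sector that is classical on the cell. -/
def sectorWeight (ρ : Rows q) (s : Sector q) (t : Bool) (x y : ℤ) : ℝ :=
  cellWeight ρ t (colour s (cellEdge t x y .north)) (colour s (cellEdge t x y .east))
    (colour s (cellEdge t x y .south)) (colour s (cellEdge t x y .west))

/-- All spins of a cell are classical. -/
def IsClassical (s : Sector q) (t : Bool) (x y : ℤ) : Prop := ∀ i, s (cellEdge t x y i) ≠ none

/-- All spins of a cell are in the Toric Code subspace. -/
def IsToric (s : Sector q) (t : Bool) (x y : ℤ) : Prop := ∀ i, s (cellEdge t x y i) = none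

open Classical in
/-- The energy of the tiling Hamiltonian at a cell. -/
def cellEnergy (ρ : Rows q) (s : Sector q) (t : Bool) (x y : ℤ) : ℝ :=
  if IsClassical s t x y then 1 - sectorWeight ρ s t x y else 0

open Classical in
/-- Whether two spins are in different subspaces. -/
def cut (s : Sector q) (e e' : Site) : ℝ := if s e = none ↔ s e' = none then 0 else 1

/-- The kind of interaction of a cell. -/
def cellKind : Bool → Kind
  | true => .star
  | false => .plaquette

/-- The classical energy of an interaction in a sector. -/
def energy (ρ : Rows q) (C : ℝ) (s : Sector q) : Interaction → ℝ
  | (.star, x, y) => cellEnergy ρ s true x y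
  | (.plaquette, x, y) => cellEnergy ρ s false x y
  | (.pairNE, x, y) => C * cut s (starEdge x y .north) (starEdge x y .east)
  | (.pairNW, x, y) => C * cut s (starEdge x y .north) (starEdge x y .west)
  | (.pairSW, x, y) => C * cut s (starEdge x y .south) (starEdge x y .west)
  | (.pairSE, x, y) => C * cut s (starEdge x y .south) (starEdge x y .east)

theorem energy_cell (ρ : Rows q) (C : ℝ) (s : Sector q) (t : Bool) (x y : ℤ) :
    energy ρ C s (cellKind t, x, y) = cellEnergy ρ s t x y := by cases t <;> rfl

theorem interaction_cell (ρ : Rows q) (J ε C : ℝ) (t : Bool) (x y : ℤ) :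
    interaction ρ J ε C (cellKind t, x, y) =
      ((ε : ℂ) • prod4 (cellEdge t x y) (fun _ e => tcProj e) - (J : ℂ) • stab t x y) +
        tilingTerm (cellEdge t x y) (cellWeight ρ t) := by cases t <;> rfl

theorem mem_supp_cell {t : Bool} {x y : ℤ} {e : Site} :
    e ∈ supp (cellKind t, x, y) ↔ ∃ i, cellEdge t x y i = e := by
  constructor
  · intro h
    cases t <;> simp only [cellKind, supp, Finset.mem_insert, Finset.mem_singleton] at h <;>
      rcases h with rfl | rfl | rfl | rfl
    exacts [⟨.north, rfl⟩, ⟨.east, rfl⟩, ⟨.south, rfl⟩, ⟨.west, rfl⟩, ⟨.north, rfl⟩, ⟨.east, rfl⟩,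
      ⟨.south, rfl⟩, ⟨.west, rfl⟩]
  · rintro ⟨i, rfl⟩
    cases t <;> cases i <;> simp [cellKind, supp, cellEdge]

theorem prod4_mul_eq_zero {P : QL q} {e : Side → Site} {T : Side → Site → QL q}
    (h : ∀ i, Commute (T i (e i)) P) (i : Side) (hi : T i (e i) * P = 0) : prod4 e T * P = 0 := by
  simp only [prod4]
  cases i
  · rw [mul_assoc, (h _).eq, ← mul_assoc, mul_assoc _ _ P, (h _).eq, ← mul_assoc, mul_assoc _ _ P,
      (h _).eq, ← mul_assoc, hi, zero_mul, zero_mul, zero_mul]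
  · rw [mul_assoc, (h _).eq, ← mul_assoc, mul_assoc _ _ P, (h _).eq, ← mul_assoc, mul_assoc _ _ P,
      hi, mul_zero, zero_mul, zero_mul]
  · rw [mul_assoc, (h _).eq, ← mul_assoc, mul_assoc _ _ P, hi, mul_zero, zero_mul]
  · rw [mul_assoc, hi, mul_zero]

theorem stab_mul_sectorProj_eq_zero {s : Sector q} {Λ : Finset Site} {t : Bool} {x y : ℤ}
    (hΛ : ∀ i, cellEdge t x y i ∈ Λ) (h : ¬IsToric s t x y) :
    stab t x y * sectorProj s Λ = 0 := by
  obtain ⟨i, hi⟩ := not_forall.1 h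
  exact prod4_mul_eq_zero (fun j => pauli_commute_sectorProj s Λ t _) i
    (pauli_mul_sectorProj s (hΛ i) t hi)

-- The projector diagonalises everything except the stabilizer of a wholly toric cell: a classical
-- cell is assigned its tile weight, and a cell with spins of both kinds is assigned nothing.
open Classical in
theorem interaction_cell_mul_sectorProj (ρ : Rows q) (J ε C : ℝ) (s : Sector q) {Λ : Finset Site}
    {t : Bool} {x y : ℤ} (hΛ : ∀ i, cellEdge t x y i ∈ Λ) :
    interaction ρ J ε C (cellKind t, x, y) * sectorProj s Λ =
      (cellEnergy ρ s t x y : ℂ) • sectorProj s Λ +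
        if IsToric s t x y then (ε : ℂ) • sectorProj s Λ - (J : ℂ) • (stab t x y * sectorProj s Λ)
        else 0 := by
  have htc : prod4 (cellEdge t x y) (fun _ e => tcProj e) * sectorProj s Λ =
      (if IsToric s t x y then (1 : ℂ) else 0) • sectorProj s Λ := by
    rw [prod4_mul_of_smul fun i => tcProj_mul_sectorProj s (hΛ i)]
    congr 1
    by_cases h : IsToric s t x y
    · simp [h, h .north, h .east, h .south, h .west]
    · obtain ⟨i, hi⟩ := not_forall.1 h
      cases i <;> simp [h, hi]
  have hcl : prod4 (cellEdge t x y) (fun _ e => clProj e) * sectorProj s Λ =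
      (if IsClassical s t x y then (1 : ℂ) else 0) • sectorProj s Λ := by
    rw [prod4_mul_of_smul fun i => clProj_mul_sectorProj s (hΛ i)]
    congr 1
    by_cases h : IsClassical s t x y
    · simp [h, h .north, h .east, h .south, h .west]
    · obtain ⟨i, hi⟩ := not_forall.1 h
      cases i <;> simp [h, not_not.1 hi]
  have htile : tilingTerm (cellEdge t x y) (cellWeight ρ t) * sectorProj s Λ =
      (cellEnergy ρ s t x y : ℂ) • sectorProj s Λ := by
    have hw := fun w : Fin (q + 1) × Fin (q + 1) × Fin (q + 1) × Fin (q + 1) =>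
      prod4_mul_of_smul (P := sectorProj s Λ) (s := cellEdge t x y) (T := fun
          | .north, e => mu e (.inr w.1) (.inr w.1)
          | .east, e => mu e (.inr w.2.1) (.inr w.2.1)
          | .south, e => mu e (.inr w.2.2.1) (.inr w.2.2.1)
          | .west, e => mu e (.inr w.2.2.2) (.inr w.2.2.2)) (c := fun
          | .north => if s (cellEdge t x y .north) = some w.1 then (1 : ℂ) else 0
          | .east => if s (cellEdge t x y .east) = some w.2.1 then (1 : ℂ) else 0
          | .south => if s (cellEdge t x y .south) = some w.2.2.1 then (1 : ℂ) else 0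
          | .west => if s (cellEdge t x y .west) = some w.2.2.2 then (1 : ℂ) else 0)
        (by rintro (_ | _ | _ | _) <;> exact mu_mul_sectorProj s (hΛ _) _)
    rw [tilingTerm, sub_mul, hcl, Finset.sum_mul]
    refine (congrArg _ (Finset.sum_congr rfl fun w _ =>
      (smul_mul_assoc _ _ _).trans (congrArg _ (hw w)))).trans ?_
    simp only [smul_smul]
    rw [← Finset.sum_smul, ← sub_smul]
    congr 1
    by_cases h : IsClassical s t x y
    · have hc : ∀ i, ∃ c, s (cellEdge t x y i) = some c := fun i => Option.ne_none_iff_exists'.1 (h i)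
      obtain ⟨n, hn⟩ := hc .north
      obtain ⟨e, he⟩ := hc .east
      obtain ⟨u, hu⟩ := hc .south
      obtain ⟨w, hw⟩ := hc .west
      rw [Finset.sum_eq_single (n, e, u, w)]
      · simp [cellEnergy, h, sectorWeight, colour, hn, he, hu, hw]
      · rintro ⟨n', e', u', w'⟩ - hne
        simp only [hn, he, hu, hw, Option.some.injEq]
        by_contra hzero
        apply hne
        simp only [mul_ite, mul_one, mul_zero] at hzero
        split_ifs at hzero <;> simp_all
      · simp
    · obtain ⟨i, hi⟩ := not_forall.1 h
      rw [not_not] at hi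
      rw [Finset.sum_eq_zero, cellEnergy, if_neg h, if_neg h]
      · simp
      · rintro w -
        cases i <;> simp [hi]
  rw [interaction_cell, add_mul, htile, sub_mul, smul_mul_assoc, smul_mul_assoc, htc, add_comm]
  congr 1
  split_ifs with h
  · simp
  · simp [stab_mul_sectorProj_eq_zero hΛ h]

theorem isingTerm_mul_sectorProj (C : ℝ) (s : Sector q) {Λ : Finset Site} {e e' : Site}
    (he : e ∈ Λ) (he' : e' ∈ Λ) :
    isingTerm C e e' * sectorProj s Λ = ((C * cut s e e' : ℝ) : ℂ) • sectorProj s Λ := by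
  simp only [isingTerm, smul_mul_assoc, add_mul, mul_assoc, tcProj_mul_sectorProj s he,
    tcProj_mul_sectorProj s he', clProj_mul_sectorProj s he, clProj_mul_sectorProj s he',
    mul_smul_comm, smul_smul, ← add_smul, cut]
  congr 1
  by_cases h : s e = none <;> by_cases h' : s e' = none <;> simp [h, h']

theorem isLocal_interaction (ρ : Rows q) (J ε C : ℝ) (X : Interaction) :
    IsLocal (supp X) (interaction ρ J ε C X) := by
  have hcell : ∀ t x y, IsLocal (supp (cellKind t, x, y))
      (interaction ρ J ε C (cellKind t, x, y)) := by
    intro t x y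
    have hm : ∀ i, cellEdge t x y i ∈ supp (cellKind t, x, y) := fun i => mem_supp_cell.2 ⟨i, rfl⟩
    rw [interaction_cell]
    refine (((isLocal_prod4 fun i => isLocal_tcProj (hm i)).smul _).sub
      ((isLocal_prod4 fun i => isLocal_pauli t (hm i)).smul _)).add
      ((isLocal_prod4 fun i => isLocal_clProj (hm i)).sub
        (isLocal_sum _ _ fun w _ => (isLocal_prod4 ?_).smul _))
    rintro (_ | _ | _ | _) <;> exact isLocal_mu (hm _) _ _
  have hpair : ∀ {Λ : Finset Site} {e e' : Site}, e ∈ Λ → e' ∈ Λ →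
      IsLocal Λ (isingTerm C e e' : QL q) := fun he he' =>
    (((isLocal_tcProj he).mul (isLocal_clProj he')).add
      ((isLocal_clProj he).mul (isLocal_tcProj he'))).smul _
  obtain ⟨k, x, y⟩ := X
  cases k
  · exact hcell true x y
  · exact hcell false x y
  all_goals exact hpair (by simp [supp]) (by simp [supp])

/-- An operator that commutes with all one-spin projectors and with all stabilizers commutes with
the interactions. -/
theorem commute_interaction {A : QL q} (hA : ∀ o e, Commute A (siteProj o e))
    (hs : ∀ t x y, Commute A (stab t x y)) (ρ : Rows q) (J ε C : ℝ) (X : Interaction) :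
    Commute A (interaction ρ J ε C X) := by
  have htc : ∀ e, Commute A (tcProj e) := hA none
  have hcl : ∀ e, Commute A (clProj e) := fun e => by
    rw [clProj_eq]; exact (Commute.one_right _).sub_right (htc e)
  have hcell : ∀ t x y, Commute A (interaction ρ J ε C (cellKind t, x, y)) := by
    intro t x y
    rw [interaction_cell]
    refine (((commute_prod4 fun i => htc _).smul_right _).sub_right
      ((hs t x y).smul_right _)).add_right ((commute_prod4 fun i => hcl _).sub_right
        (Commute.sum_right _ _ _ fun w _ => (commute_prod4 ?_).smul_right _))
    rintro (_ | _ | _ | _) <;> exact hA (some _) _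
  have hpair : ∀ e e' : Site, Commute A (isingTerm C e e' : QL q) := fun e e' =>
    (((htc e).mul_right (hcl e')).add_right ((hcl e).mul_right (htc e'))).smul_right _
  obtain ⟨k, x, y⟩ := X
  cases k
  · exact hcell true x y
  · exact hcell false x y
  all_goals exact hpair _ _

theorem sectorProj_commute_interaction (s : Sector q) (Λ : Finset Site) (ρ : Rows q) (J ε C : ℝ)
    (X : Interaction) : Commute (sectorProj s Λ) (interaction ρ J ε C X) :=
  commute_interaction (fun o e => (siteProj_commute_sectorProj s Λ o e).symm)
    (fun t x y => (stab_commute_sectorProj s Λ t x y).symm) ρ J ε C X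

theorem stab_commute_interaction (t : Bool) (x y : ℤ) (ρ : Rows q) (J ε C : ℝ)
    (X : Interaction) : Commute (stab t x y) (interaction ρ J ε C X) :=
  commute_interaction (fun o e => (siteProj_commute_stab o e t x y).symm)
    (fun t' x' y' => stab_commute_stab t t' x y x' y') ρ J ε C X

end Energies

/-! ### Replacing classical spins by a Toric Code state -/

section Channel

variable {q : ℕ}

/-- The sector after the spins in `D` have been moved to the Toric Code subspace. -/
def vacate (s : Sector q) (D : Finset Site) : Sector q := fun e => if e ∈ D then none else s e

/-- The cell whose eastern (`true`) or western (`false`) edge is `e`. -/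
def sideCell : Bool → Site → Bool × ℤ × ℤ
  | true, (b, x, y) => (!b, if b then x - 1 else x, y)
  | false, (b, x, y) => (!b, if b then x else x + 1, y)

/-- East or west. -/
def horSide : Bool → Side
  | true => .east
  | false => .west

theorem cellEdge_sideCell (d : Bool) (e : Site) :
    cellEdge (sideCell d e).1 (sideCell d e).2.1 (sideCell d e).2.2 (horSide d) = e := by
  obtain ⟨b, x, y⟩ := e
  cases d <;> cases b <;> simp [sideCell, horSide, cellEdge, starEdge, plaqEdge, hEdge, vEdge]

theorem sideCell_cellEdge (d t : Bool) (x y : ℤ) :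
    sideCell d (cellEdge t x y (horSide d)) = (t, x, y) := by
  cases d <;> cases t <;> simp [sideCell, horSide, cellEdge, starEdge, plaqEdge, hEdge, vEdge]

/-- The eastern and western edges of a cell are those whose direction is that of the strings. -/
theorem cellEdge_eq_of_parity {t : Bool} {x y : ℤ} {i : Side} {e : Site}
    (h : cellEdge t x y i = e) (he : (!e.1) = t) :
    i = .east ∨ i = .west := by
  subst h
  cases t <;> cases i <;> simp [cellEdge, starEdge, plaqEdge, hEdge, vEdge] at he ⊢

/-- The order in which the stabilizers are corrected. -/
def sweepKey (d : Bool) (e : Site) : ℤ := if d then e.2.1 else -e.2.1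

/-- Among the edges parallel to `e`, the cell attached to `e` contains only `e` and a neighbour with
a strictly smaller key. Hence no Pauli applied later in the sweep touches this cell. -/
theorem cellEdge_sideCell_ne {d : Bool} {e e' : Site} (hne : e ≠ e')
    (hle : sweepKey d e ≤ sweepKey d e') (ht : e.1 = e'.1) (i : Side) :
    cellEdge (sideCell d e).1 (sideCell d e).2.1 (sideCell d e).2.2 i ≠ e' := by
  intro h
  have hi := cellEdge_eq_of_parity h (by rw [← ht]; cases d <;> rfl)
  obtain ⟨b, x, y⟩ := e
  obtain ⟨b', x', y'⟩ := e'
  obtain rfl : b = b' := ht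
  rcases hi with rfl | rfl <;> cases d <;> cases b <;>
    simp [sideCell, cellEdge, starEdge, plaqEdge, hEdge, vEdge, sweepKey] at h hne hle <;> omega

/-- Paulis square to the Toric Code projector, which is absorbed by a sector that is toric on the
cell; the Pauli of the other type on any one edge flips the stabilizer. -/
theorem isCorrection_stab {s : Sector q} {Λ : Finset Site} {t : Bool} {x y : ℤ}
    (hΛ : ∀ i, cellEdge t x y i ∈ Λ) (hs : IsToric s t x y) (i : Side) :
    IsCorrection (sectorProj s Λ) (stab t x y * sectorProj s Λ)
      (pauli (!t) (cellEdge t x y i) * sectorProj s Λ) := by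
  have hpp := sectorProj_mul_self s Λ
  have hA := (stab_commute_sectorProj s Λ t x y).eq
  have hZ := (pauli_commute_sectorProj s Λ (!t) (cellEdge t x y i)).eq
  refine ⟨star_sectorProj s Λ, ?_, ?_, hpp, ?_, ?_, ?_, ?_, ?_, ?_, ?_⟩
  · rw [star_mul, star_sectorProj, star_stab, hA]
  · rw [star_mul, star_sectorProj, star_pauli, hZ]
  · rw [hA, ← mul_assoc, hpp]
  · rw [mul_assoc, hpp]
  · rw [mul_assoc, ← mul_assoc (sectorProj s Λ), ← hA, mul_assoc (stab t x y), hpp, ← mul_assoc,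
      stab_mul_self, prod4_mul_of_smul fun j => tcProj_mul_sectorProj s (hΛ j)]
    simp [hs _]
  · rw [hZ, ← mul_assoc, hpp]
  · rw [mul_assoc, hpp]
  · rw [mul_assoc, ← mul_assoc (sectorProj s Λ), ← hZ, mul_assoc (pauli _ _) (sectorProj s Λ), hpp,
      ← mul_assoc, pauli_mul_self, tcProj_mul_sectorProj s (hΛ i), if_pos (hs i), one_smul]
  · rw [mul_assoc, ← mul_assoc (sectorProj s Λ), ← hA, mul_assoc (stab t x y), hpp, ← mul_assoc,
      pauli_not_mul_stab_of_mem, neg_mul, mul_assoc, hZ, mul_assoc (stab t x y),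
      ← mul_assoc (sectorProj s Λ), hpp]

/-- There is a completely positive local map that replaces the classical spins of `D` by Toric
Code spins in such a way that the stabilizer of a new Toric Code cell is satisfied if its
eastern (western) edge is in `D`, and has expectation zero if neither edge is. -/
theorem exists_channel (s : Sector q) {D Λ : Finset Site} (hD : ∀ e ∈ D, s e ≠ none)
    (hΛ : ∀ X ∈ meeting D, supp X ⊆ Λ) (ρ : Rows q) (J ε C : ℝ) (d : Bool) :
    ∃ T : QL q →ₗ[ℂ] QL q, IsKraus Λ T ∧
      (∀ Y, T (sectorProj (vacate s D) Λ * Y * sectorProj (vacate s D) Λ) = T Y) ∧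
      T (sectorProj (vacate s D) Λ) = sectorProj s Λ ∧
      (∀ X ∉ meeting D, Modular T (interaction ρ J ε C X)) ∧
      (∀ t x y, IsToric (vacate s D) t x y → cellEdge t x y (horSide d) ∈ D →
        T (stab t x y) = sectorProj s Λ) ∧
      (∀ t x y, IsToric (vacate s D) t x y → (cellKind t, x, y) ∈ meeting D →
        cellEdge t x y .east ∉ D → cellEdge t x y .west ∉ D → T (stab t x y) = 0) := by
  classical
  set p := sectorProj (vacate s D) Λ with hp
  have hpp : p * p = p := sectorProj_mul_self _ _
  have hDΛ : ∀ t x y, (∃ i, cellEdge t x y i ∈ D) → ∀ i, cellEdge t x y i ∈ Λ := by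
    rintro t x y ⟨i, hi⟩ j
    exact hΛ _ (mem_meeting.2 ⟨_, hi, mem_supp_cell.2 ⟨i, rfl⟩⟩) (mem_supp_cell.2 ⟨j, rfl⟩)
  have hmem : ∀ e ∈ D, e ∈ Λ := fun e he => by
    have := hDΛ _ _ _ ⟨horSide d, (cellEdge_sideCell d e).symm ▸ he⟩ (horSide d)
    rwa [cellEdge_sideCell] at this
  -- The stabilizer attached to `e` is repaired by the Pauli at `e` with which it anticommutes. This
  -- Pauli also flips the cell on the other side of `e`, which is why the order of the sites
  -- matters.
  let cor : Site → QL q × QL q := fun e =>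
    (stab (sideCell d e).1 (sideCell d e).2.1 (sideCell d e).2.2 * p,
      pauli (!(sideCell d e).1) e * p)
  -- Edges whose cell stays partly classical are left out: its stabilizer vanishes on the new
  -- sector.
  let sites : List Site := ((D.filter fun e =>
    IsToric (vacate s D) (sideCell d e).1 (sideCell d e).2.1 (sideCell d e).2.2).toList).mergeSort
      fun e e' => decide (sweepKey d e ≤ sweepKey d e')
  have hsites : ∀ e, e ∈ sites ↔ e ∈ D ∧
      IsToric (vacate s D) (sideCell d e).1 (sideCell d e).2.1 (sideCell d e).2.2 := by
    intro e
    rw [List.mem_mergeSort, Finset.mem_toList, Finset.mem_filter]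
  have hpair : sites.Pairwise fun e e' => e ≠ e' ∧ sweepKey d e ≤ sweepKey d e' := by
    refine List.Pairwise.and ?_ ?_
    · exact (List.mergeSort_perm _ _).nodup_iff.2 (Finset.nodup_toList _)
    · have := List.pairwise_mergeSort (le := fun e e' => decide (sweepKey d e ≤ sweepKey d e'))
        (fun a b c h h' => by simp only [decide_eq_true_eq] at *; exact h.trans h')
        (fun a b => by simpa using le_total _ _) ((D.filter fun e =>
    IsToric (vacate s D) (sideCell d e).1 (sideCell d e).2.1 (sideCell d e).2.2).toList)
      simpa using this
  let L := sites.map cor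
  have hcor : ∀ c ∈ L, IsCorrection p c.1 c.2 := by
    intro c hc
    obtain ⟨e, he, rfl⟩ := List.mem_map.1 hc
    have he' := (hsites e).1 he
    have := isCorrection_stab (hDΛ _ _ _ ⟨horSide d, (cellEdge_sideCell d e).symm ▸ he'.1⟩) he'.2
      (horSide d)
    rwa [cellEdge_sideCell] at this
  have hstab_stab : ∀ t x y t' x' y', Commute (stab t x y * p) (stab t' x' y' * p) :=
    fun t x y t' x' y' =>
    have h := stab_commute_sectorProj (vacate s D) Λ
    (((stab_commute_stab t t' x y x' y').mul_right (h t x y)).mul_left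
      ((h t' x' y').symm.mul_right (Commute.refl p)))
  -- The correcting Pauli at `e` has the type `e.1`, so it commutes with all stabilizers of that
  -- type, and only cells of the other type through `e` matter.
  have hstab_pauli : ∀ t x y (e : Site), (t = !e.1 → ∀ i, cellEdge t x y i ≠ e) →
      Commute (stab t x y * p) (pauli (!(sideCell d e).1) e * p) := by
    intro t x y e h
    have hc : Commute (stab t x y : QL q) (pauli (!(sideCell d e).1) e) := by
      have h1 : (sideCell d e).1 = !e.1 := by cases d <;> rfl
      rw [h1]
      by_cases ht : t = !e.1
      · rw [← ht]
        exact (pauli_not_commute_stab t e x y (h ht)).symm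
      · have : t = !!e.1 := by cases t <;> cases h' : e.1 <;> simp_all
        rw [← this]
        exact (pauli_commute_stab t e x y).symm
    have h1 := stab_commute_sectorProj (vacate s D) Λ t x y
    have h2 := pauli_commute_sectorProj (vacate s D) Λ (!(sideCell d e).1) e
    exact (hc.mul_right h1).mul_left (h2.symm.mul_right (Commute.refl p))
  have hcc : ∀ c ∈ L, ∀ c' ∈ L, Commute c.1 c'.1 := by
    intro c hc c' hc'
    obtain ⟨e, he, rfl⟩ := List.mem_map.1 hc
    obtain ⟨e', he', rfl⟩ := List.mem_map.1 hc'
    exact hstab_stab _ _ _ _ _ _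
  have hcz : L.Pairwise fun c c' => Commute c.1 c'.2 := by
    refine List.pairwise_map.2 (hpair.imp fun {e e'} h => ?_)
    refine hstab_pauli _ _ _ _ fun ht i => cellEdge_sideCell_ne h.1 h.2 ?_ i
    have h1 : (sideCell d e).1 = !e.1 := by cases d <;> rfl
    rw [h1] at ht
    simpa using ht
  have hpl : IsLocal Λ p := isLocal_sectorProj _ _
  let colourOf : Site → Fin (q + 1) := fun e => (s e).getD 0
  have hfill : fillList colourOf D.toList p = sectorProj s Λ := by
    have := fillList_sectorProj (c := colourOf) D.nodup_toList (Λ := Λ)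
      (fun e he => hmem e (Finset.mem_toList.1 he)) s (fun e he => by
        obtain ⟨c, hc⟩ := Option.ne_none_iff_exists'.1 (hD e (Finset.mem_toList.1 he))
        simp [colourOf, hc])
    simp only [Finset.mem_toList] at this
    exact this
  have hAp : ∀ t x y, p * stab t x y * p = stab t x y * p := fun t x y => by
    rw [hp, ← (stab_commute_sectorProj (vacate s D) Λ t x y).eq, ← hp, mul_assoc, hpp]
  -- On states these maps act from left to right: the colours are filled, then the stabilizers are
  -- corrected, then the result is projected to the new sector.
  refine ⟨fillList colourOf D.toList ∘ₗ correctList p L ∘ₗ conjMap p, ?_, ?_, ?_, ?_, ?_, ?_⟩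
  · refine (isKraus_fillList _ fun e he => hmem e (Finset.mem_toList.1 he)).comp
      ((isKraus_correctList hpl ?_).comp (isKraus_conjMap hpl))
    intro c hc
    obtain ⟨e, he, rfl⟩ := List.mem_map.1 hc
    have he' := (hsites e).1 he
    have hcell := hDΛ _ _ _ ⟨horSide d, (cellEdge_sideCell d e).symm ▸ he'.1⟩
    exact ⟨(isLocal_prod4 fun i => isLocal_pauli _ (hcell i)).mul hpl,
      (isLocal_pauli _ (hmem e he'.1)).mul hpl⟩
  · intro Y
    simp only [LinearMap.comp_apply, conjMap_apply]
    congr 2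
    rw [hp, star_sectorProj, ← hp,
      show p * (p * Y * p) * p = (p * p) * Y * (p * p) by simp only [mul_assoc], hpp]
  · simp only [LinearMap.comp_apply, conjMap_apply]
    rw [hp, star_sectorProj, ← hp, hpp, hpp, correctList_p hpp hcor, hfill]
  · intro X hX
    have hdisj : ∀ e ∈ D, e ∉ supp X := fun e he h => hX (mem_meeting.2 ⟨e, he, h⟩)
    have hsite : ∀ e ∈ D, ∀ A : QL q, IsLocal {e} A → Commute A (interaction ρ J ε C X) :=
      fun e he A hA => hA.commute (Finset.disjoint_singleton_left.2 (hdisj e he))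
        (isLocal_interaction ρ J ε C X)
    have hpX := sectorProj_commute_interaction (vacate s D) Λ ρ J ε C X
    refine (modular_fillList fun e he a b => hsite e (Finset.mem_toList.1 he) _
      (isLocal_mu (by simp) a b)).comp ((modular_correctList hpX ?_).comp (modular_conjMap hpX))
    intro c hc
    obtain ⟨e, he, rfl⟩ := List.mem_map.1 hc
    have he' := (hsites e).1 he
    exact ⟨(stab_commute_interaction _ _ _ ρ J ε C X).mul_left hpX,
      (hsite e he'.1 _ (isLocal_pauli _ (by simp))).mul_left hpX⟩
  · intro t x y hnew hside
    simp only [LinearMap.comp_apply, conjMap_apply]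
    rw [hp, star_sectorProj, ← hp, hAp]
    have hc : cor (cellEdge t x y (horSide d)) ∈ L := by
      refine List.mem_map.2 ⟨_, (hsites _).2 ⟨hside, ?_⟩, rfl⟩
      rw [sideCell_cellEdge]
      exact hnew
    have := correctList_of_mem hpp hcor hcc hcz hc
    simp only [cor, sideCell_cellEdge] at this
    rw [this, hfill]
  -- The correcting Paulis that could flip this stabilizer would sit on its eastern or western edge,
  -- so none affects it. Some other edge of the cell lies in `D` and is filled with the maximally
  -- mixed state, which gives expectation zero.
  · intro t x y hnew hmeet hE hW
    simp only [LinearMap.comp_apply, conjMap_apply]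
    rw [hp, star_sectorProj, ← hp, hAp, correctList_of_commute hcor]
    · obtain ⟨e, he, heX⟩ := mem_meeting.1 hmeet
      obtain ⟨i, rfl⟩ := mem_supp_cell.1 heX
      refine fillList_of_anticommute D.nodup_toList (Finset.mem_toList.2 he) (!t) ?_
      rw [← mul_assoc, pauli_not_mul_stab_of_mem, neg_mul, mul_assoc, mul_assoc,
        (pauli_commute_sectorProj (vacate s D) Λ (!t) _).eq]
    · intro c hc
      obtain ⟨e, he, rfl⟩ := List.mem_map.1 hc
      have he' := (hsites e).1 he
      refine ⟨hstab_stab _ _ _ _ _ _, hstab_pauli _ _ _ _ fun ht i hi => ?_⟩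
      rcases cellEdge_eq_of_parity hi ht.symm with rfl | rfl
      · exact hE (hi ▸ he'.1)
      · exact hW (hi ▸ he'.1)
    · rw [← mul_assoc, hAp]
    · rw [mul_assoc, hpp]

end Channel

/-! ### The energy of a sector before and after its classical spins are filled -/

section Flip

variable {q : ℕ}

open Classical in
/-- An upper bound for the energy, relative to the Toric Code ground state energy, of an
interaction after the spins in `D` have been replaced by Toric Code spins. -/
def fillEnergy (ρ : Rows q) (C : ℝ) (s : Sector q) (D : Finset Site) : Interaction → ℝ
  | (.star, x, y) => if IsToric (vacate s D) true x y then
      (if cellEdge true x y .east ∈ D ∧ cellEdge true x y .west ∈ D then 0 else 1 / 2) else 0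
  | (.plaquette, x, y) => if IsToric (vacate s D) false x y then
      (if cellEdge false x y .east ∈ D ∧ cellEdge false x y .west ∈ D then 0 else 1 / 2) else 0
  | X => energy ρ C (vacate s D) X

open Classical in
theorem fillEnergy_cell (ρ : Rows q) (C : ℝ) (s : Sector q) (D : Finset Site) (t : Bool)
    (x y : ℤ) : fillEnergy ρ C s D (cellKind t, x, y) =
      if IsToric (vacate s D) t x y then
        (if cellEdge t x y .east ∈ D ∧ cellEdge t x y .west ∈ D then 0 else 1 / 2) else 0 := by
  cases t <;> rfl

theorem vacate_eq_none_of_mem {s : Sector q} {D : Finset Site} {e : Site} (h : e ∈ D) :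
    vacate s D e = none := if_pos h

theorem vacate_of_notMem {s : Sector q} {D : Finset Site} {e : Site} (h : e ∉ D) :
    vacate s D e = s e := if_neg h

/-- The real part of a state. -/
def State.re (ω : State q) (A : QL q) : ℝ := (ω.toLin A).re

theorem State.re_add (ω : State q) (A B : QL q) : ω.re (A + B) = ω.re A + ω.re B := by
  simp [State.re]

theorem State.re_sub (ω : State q) (A B : QL q) : ω.re (A - B) = ω.re A - ω.re B := by
  simp [State.re]

theorem State.re_smul (ω : State q) (r : ℝ) (A : QL q) : ω.re ((r : ℂ) • A) = r * ω.re A := by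
  simp [State.re]

theorem State.re_sum {ι : Type*} (ω : State q) (s : Finset ι) (A : ι → QL q) :
    ω.re (∑ i ∈ s, A i) = ∑ i ∈ s, ω.re (A i) := by
  simp [State.re]

theorem sectorProj_re_nonneg (ω : State q) (s : Sector q) (Λ : Finset Site) :
    0 ≤ ω.toLin (sectorProj s Λ) := by
  have := ω.nonneg (sectorProj s Λ)
  rwa [star_sectorProj, sectorProj_mul_self] at this

/-- A pair interaction is a penalty for two spins in different subspaces. -/
theorem pair_mul_sectorProj (ρ : Rows q) (J ε C : ℝ) (s : Sector q) {Λ : Finset Site}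
    {X : Interaction} (hX : X.1 ≠ .star ∧ X.1 ≠ .plaquette) (hΛ : supp X ⊆ Λ) :
    interaction ρ J ε C X * sectorProj s Λ = (energy ρ C s X : ℂ) • sectorProj s Λ := by
  obtain ⟨k, x, y⟩ := X
  cases k
  · exact absurd rfl hX.1
  · exact absurd rfl hX.2
  all_goals
    exact isingTerm_mul_sectorProj C s (hΛ (by simp [supp])) (hΛ (by simp [supp]))

/-- Average over the eastward and the westward sweep, relative to the weight of the sector. A
stabilizer satisfied in both costs `ε - J ≤ 0`; one satisfied in a single sweep costs at most `((ε -
J) + (ε + J)) / 2 = ε ≤ 1/2`; one with expectation zero costs `ε`. A cell that stays partly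
classical costs nothing. -/
theorem flip_energy_le {ω : State q} {s : Sector q} {D Λ : Finset Site} {ρ : Rows q} {J ε C : ℝ}
    (hJ : 0 < J) (hεJ : ε ≤ J) (hε : ε ≤ 1 / 2) {T : Bool → QL q →ₗ[ℂ] QL q} (hT : ∀ d, IsKraus Λ (T d))
    (hTp : ∀ d Y, T d (sectorProj (vacate s D) Λ * Y * sectorProj (vacate s D) Λ) = T d Y)
    (hTone : ∀ d, T d (sectorProj (vacate s D) Λ) = sectorProj s Λ)
    (hside : ∀ d t x y, IsToric (vacate s D) t x y → cellEdge t x y (horSide d) ∈ D →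
        T d (stab t x y) = sectorProj s Λ)
    (hnone : ∀ d t x y, IsToric (vacate s D) t x y → (cellKind t, x, y) ∈ meeting D →
        cellEdge t x y .east ∉ D → cellEdge t x y .west ∉ D → T d (stab t x y) = 0)
    {X : Interaction} (hX : X ∈ meeting D) (hΛ : supp X ⊆ Λ) :
    ω.re (T true (interaction ρ J ε C X)) + ω.re (T false (interaction ρ J ε C X)) ≤
      2 * fillEnergy ρ C s D X * ω.re (sectorProj s Λ) := by
  classical
  set p := sectorProj (vacate s D) Λ with hp
  have hpp : p * p = p := sectorProj_mul_self _ _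
  have hw : 0 ≤ ω.re (sectorProj s Λ) := (Complex.nonneg_iff.1 (sectorProj_re_nonneg ω s Λ)).1
  have hTX : ∀ d Y, Commute p Y → T d Y = T d (Y * p) := fun d Y hY => by
    rw [← hTp d Y, hY.eq, mul_assoc, hpp]
  have hcomm := sectorProj_commute_interaction (vacate s D) Λ ρ J ε C X
  by_cases hk : X.1 ≠ .star ∧ X.1 ≠ .plaquette
  · have h1 : ∀ d, ω.re (T d (interaction ρ J ε C X)) =
        energy ρ C (vacate s D) X * ω.re (sectorProj s Λ) := fun d => by
      rw [hTX d _ hcomm, pair_mul_sectorProj ρ J ε C _ hk hΛ, map_smul, hTone, State.re_smul]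
    have h2 : fillEnergy ρ C s D X = energy ρ C (vacate s D) X := by
      obtain ⟨k, x, y⟩ := X
      cases k
      · exact absurd rfl hk.1
      · exact absurd rfl hk.2
      all_goals rfl
    rw [h1, h1, h2]
    linarith
  · obtain ⟨t, x, y, rfl⟩ : ∃ t x y, X = (cellKind t, x, y) := by
      obtain ⟨k, x, y⟩ := X
      cases k
      · exact ⟨true, x, y, rfl⟩
      · exact ⟨false, x, y, rfl⟩
      all_goals simp at hk
    have hcell : ∀ i, cellEdge t x y i ∈ Λ := fun i => hΛ (mem_supp_cell.2 ⟨i, rfl⟩)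
    have hE0 : cellEnergy ρ (vacate s D) t x y = 0 := by
      refine if_neg fun h => ?_
      obtain ⟨e, he, heX⟩ := mem_meeting.1 hX
      obtain ⟨i, rfl⟩ := mem_supp_cell.1 heX
      exact h i (vacate_eq_none_of_mem he)
    have h1 : ∀ d, T d (interaction ρ J ε C (cellKind t, x, y)) =
        if IsToric (vacate s D) t x y then
          (ε : ℂ) • sectorProj s Λ - (J : ℂ) • T d (stab t x y) else 0 := fun d => by
      rw [hTX d _ hcomm, interaction_cell_mul_sectorProj ρ J ε C _ hcell, hE0, Complex.ofReal_zero,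
        zero_smul, zero_add]
      split_ifs with h
      · rw [map_sub, map_smul, map_smul, hTone,
          ← hTX d _ (stab_commute_sectorProj (vacate s D) Λ t x y).symm]
      · rw [map_zero]
    rw [h1, h1, fillEnergy_cell]
    by_cases htor : IsToric (vacate s D) t x y
    swap
    · simp [htor, State.re]
    simp only [if_pos htor, State.re_sub, State.re_smul]
    set w := ω.re (sectorProj s Λ)
    -- Positivity of `p` plus the stabilizer cut to `p` bounds its expectation below by that of
    -- `-p`.
    have hlow : ∀ d, -w ≤ ω.re (T d (stab t x y)) := fun d => by
      have hcor := isCorrection_stab hcell htor .east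
      have h2 := (hT d).map_star_mul_self_nonneg ω (p + stab t x y * p)
      have hsq : star (p + stab t x y * p) * (p + stab t x y * p) =
          (((2 : ℝ)) : ℂ) • (p + stab t x y * p) := by
        rw [star_add, hcor.star_p, hcor.star_A, mul_add, add_mul, add_mul, hcor.pp, hcor.Ap,
          hcor.pA, hcor.AA, Complex.ofReal_ofNat, two_smul]
        abel
      rw [hsq, map_smul, map_add, hTone,
        ← hTX d _ (stab_commute_sectorProj (vacate s D) Λ t x y).symm] at h2
      have h3 := (Complex.nonneg_iff.1 h2).1
      have h4 : 0 ≤ 2 * (w + ω.re (T d (stab t x y))) := by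
        rw [← State.re_add, ← State.re_smul]
        exact h3
      linarith
    have hmem : ∀ d, cellEdge t x y (horSide d) ∈ D → ω.re (T d (stab t x y)) = w := fun d h => by
      rw [hside d t x y htor h]
    have e1 := hlow true
    have e2 := hlow false
    by_cases hE : cellEdge t x y .east ∈ D <;> by_cases hW : cellEdge t x y .west ∈ D
    · simp only [hE, hW, and_self, if_true]
      rw [hmem true hE, hmem false hW]
      nlinarith
    · simp only [hE, hW, and_false, if_false]
      rw [hmem true hE]
      nlinarith
    · simp only [hE, hW, false_and, if_false]
      rw [hmem false hW]
      nlinarith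
    · simp only [hE, hW, false_and, if_false]
      have hz : ∀ d, ω.re (T d (stab t x y)) = 0 := fun d => by
        rw [hnone d t x y htor hX hE hW]
        simp [State.re]
      rw [hz, hz]
      nlinarith

/-- In a ground state, sectors whose energy can be lowered by moving spins to the Toric Code
subspace do not occur. -/
theorem sector_null {ω : State q} {s : Sector q} {D Λ : Finset Site}
    (hD : ∀ e ∈ D, s e ≠ none) (hΛ : ∀ X ∈ meeting D, supp X ⊆ Λ) {ρ : Rows q} {J ε C : ℝ}
    (hJ : 0 < J) (hεJ : ε ≤ J) (hε : ε ≤ 1 / 2)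
    (hω : IsGroundState (interaction ρ J ε C) ω)
    (hgain : 0 < ∑ X ∈ meeting D, (energy ρ C s X - fillEnergy ρ C s D X)) :
    ω.toLin (sectorProj s Λ) = 0 := by
  choose T hT hTp hTone hTmod hside hnone using exists_channel s hD hΛ ρ J ε C
  have hpp := sectorProj_mul_self (vacate s D) Λ
  have hnn := Complex.nonneg_iff.1 (sectorProj_re_nonneg ω s Λ)
  set w := ω.re (sectorProj s Λ) with hwdef
  have hw : 0 ≤ w := hnn.1
  have hone : ∀ d, T d 1 = sectorProj s Λ := fun d => by
    rw [← hTp d 1, mul_one, hpp, hTone]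
  have hsub : meeting D ⊆ inside (bar Λ) := fun X hX =>
    mem_inside.2 ((hΛ X hX).trans Finset.subset_union_left)
  -- An interaction that meets `D` involves a classical spin of `s`, so no stabilizer survives and
  -- it acts as a number.
  have hE : ∀ X ∈ meeting D, sectorProj s Λ * interaction ρ J ε C X =
      (energy ρ C s X : ℂ) • sectorProj s Λ := by
    intro X hX
    rw [(sectorProj_commute_interaction s Λ ρ J ε C X).eq]
    by_cases hk : X.1 ≠ .star ∧ X.1 ≠ .plaquette
    · exact pair_mul_sectorProj ρ J ε C _ hk (hΛ X hX)
    · obtain ⟨t, x, y, rfl⟩ : ∃ t x y, X = (cellKind t, x, y) := by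
        obtain ⟨k, x, y⟩ := X
        cases k
        · exact ⟨true, x, y, rfl⟩
        · exact ⟨false, x, y, rfl⟩
        all_goals simp at hk
      rw [interaction_cell_mul_sectorProj ρ J ε C _
        (fun i => hΛ _ hX (mem_supp_cell.2 ⟨i, rfl⟩)), if_neg, add_zero, energy_cell]
      intro h
      obtain ⟨e, he, heX⟩ := mem_meeting.1 hX
      obtain ⟨i, rfl⟩ := mem_supp_cell.1 heX
      exact hD _ he (h i)
  -- Terms that do not meet `D` cancel by modularity.
  have hdiff : ∀ d, T d (restrict (interaction ρ J ε C) (bar Λ)) -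
      T d 1 * restrict (interaction ρ J ε C) (bar Λ) =
      ∑ X ∈ meeting D, (T d (interaction ρ J ε C X) - (energy ρ C s X : ℂ) • sectorProj s Λ) := by
    intro d
    rw [restrict, map_sum, Finset.mul_sum, ← Finset.sum_sub_distrib,
      ← Finset.sum_subset hsub]
    · exact Finset.sum_congr rfl fun X hX => by rw [hone, hE X hX]
    · intro X _ hX
      have := hTmod d X hX 1
      rw [one_mul] at this
      rw [this, sub_self]
  have hpos : ∀ d, 0 ≤ ∑ X ∈ meeting D,
      (ω.re (T d (interaction ρ J ε C X)) - energy ρ C s X * w) := by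
    intro d
    have h1 := (hT d).ground hω
    rw [hdiff] at h1
    have h2 : 0 ≤ ω.re _ := (Complex.nonneg_iff.1 h1).1
    rw [State.re_sum] at h2
    simpa only [State.re_sub, State.re_smul] using h2
  have hle : ∀ X ∈ meeting D,
      (ω.re (T true (interaction ρ J ε C X)) - energy ρ C s X * w) +
        (ω.re (T false (interaction ρ J ε C X)) - energy ρ C s X * w) ≤
      -2 * w * (energy ρ C s X - fillEnergy ρ C s D X) := by
    intro X hX
    have := flip_energy_le (ω := ω) (ρ := ρ) (C := C) hJ hεJ hε hT hTp hTone hside hnone hX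
      (hΛ X hX)
    linarith
  have htot := (add_nonneg (hpos true) (hpos false))
  rw [← Finset.sum_add_distrib] at htot
  have := htot.trans (Finset.sum_le_sum hle)
  rw [← Finset.mul_sum] at this
  -- The inequality reads `0 ≤ -2 * w * gain`, with `0 ≤ w` and a positive gain.
  have hw0 : w = 0 := by nlinarith
  exact Complex.ext hw0 hnn.2.symm

end Flip

/-! ### Large blocks of the prime period tiling have a defect -/

namespace Rows

variable {q : ℕ} (ρ : Rows q)

theorem hi_succ (i : ℕ) : ρ.hi (i + 1) = ρ.hi i + ρ.m (i + 1) :=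
  Finset.sum_Icc_succ_top (by omega) _

theorem hi_mono {i k : ℕ} (h : i ≤ k) : ρ.hi i ≤ ρ.hi k :=
  Finset.sum_le_sum_of_subset (Finset.Icc_subset_Icc_right h)

theorem hi_eq {i : ℕ} (h : 1 ≤ i) : ρ.hi i = ρ.hi (i - 1) + ρ.m i := by
  obtain ⟨k, rfl⟩ : ∃ k, i = k + 1 := ⟨i - 1, by omega⟩
  exact ρ.hi_succ k

/-- The labels of the rows occupy consecutive disjoint intervals, since `hi` is monotone. -/
theorem label_inj {i i' j j' : ℕ} (hi : 1 ≤ i) (hi' : 1 ≤ i') (hj : 1 ≤ j) (hj' : 1 ≤ j')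
    (hm : j ≤ ρ.m i) (hm' : j' ≤ ρ.m i') (h : ρ.label i j = ρ.label i' j') : i = i' ∧ j = j' := by
  have e1 := ρ.hi_eq hi
  have e2 := ρ.hi_eq hi'
  simp only [label] at h
  rcases lt_trichotomy i i' with hlt | rfl | hlt
  · have := ρ.hi_mono (show i ≤ i' - 1 by omega)
    omega
  · exact ⟨rfl, by omega⟩
  · have := ρ.hi_mono (show i' ≤ i - 1 by omega)
    omega

/-- The length of the period of a row. -/
def period (i : ℕ) : ℕ := ∑ j ∈ Finset.Icc 1 (ρ.m i), ρ.r i j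

/-- The total length of the first sub-periods of a row. -/
def partialPeriod (i j : ℕ) : ℕ := ∑ k ∈ Finset.Icc 1 j, ρ.r i k

theorem partialPeriod_eq (i : ℕ) {j : ℕ} (h : 1 ≤ j) :
    ρ.partialPeriod i j = ρ.partialPeriod i (j - 1) + ρ.r i j := by
  obtain ⟨k, rfl⟩ : ∃ k, j = k + 1 := ⟨j - 1, by omega⟩
  exact Finset.sum_Icc_succ_top (by omega) _

theorem period_pos {i : ℕ} (h1 : 1 ≤ i) (hf : i ≤ ρ.f) : 0 < ρ.period i := by
  have hm := ρ.one_le_m i h1 hf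
  refine (ρ.one_le_r i 1 h1 hf le_rfl hm).trans ?_
  exact Finset.single_le_sum (f := ρ.r i) (fun _ _ => Nat.zero_le _)
    (Finset.mem_Icc.2 ⟨le_rfl, hm⟩)

/-- The tile is part of the tile set. -/
def Tile (N E S W : ℕ) : Prop := 0 < ρ.tileWeight N E S W

/-- The star is allowed and not penalised. -/
def GoodStar (N E S W : ℕ) : Prop := 0 < ρ.starWeight N E S W

variable {ρ}

theorem Tile.cases {N E S W : ℕ} (h : ρ.Tile N E S W) :
    (N = 0 ∧ E = 0 ∧ S = 0 ∧ W = 0) ∨ ρ.RowTile N E S W ∨ ρ.MarkTile N E S W ∨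
      EdgeTile N E S W := by
  rw [Tile, tileWeight] at h
  split_ifs at h with h1 h2
  · exact Or.inl h1
  · exact Or.inr h2
  · exact absurd h (lt_irrefl _)

/-- Penalties only lower the weight, so positivity needs the `1` of an allowed star. -/
theorem GoodStar.allowed {N E S W : ℕ} (h : ρ.GoodStar N E S W) : ρ.AllowedStar N E W := by
  rw [GoodStar, starWeight] at h
  by_contra hn
  rw [if_neg hn] at h
  split_ifs at h <;> linarith

/-- The weight starts from at most `1`, and either penalty brings it down to `0` or less. -/
theorem GoodStar.not_penalised {N E S W : ℕ} (h : ρ.GoodStar N E S W) {i : ℕ} (h1 : 1 ≤ i)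
    (hf : i < ρ.f) : ¬ρ.PenalisedStar i N E S W := by
  intro hp
  rw [GoodStar, starWeight] at h
  rcases (show i + 1 < ρ.f ∨ i = ρ.f - 1 by omega) with hi | rfl
  · rw [if_pos (show ∃ i, 1 ≤ i ∧ i + 1 < ρ.f ∧ ρ.PenalisedStar i N E S W from ⟨i, h1, hi, hp⟩)] at h
    split_ifs at h <;> linarith
  · rw [if_pos hp] at h
    split_ifs at h <;> linarith

theorem RowTile.pos {N E S W : ℕ} (h : ρ.RowTile N E S W) : E ≠ 0 ∧ S ≠ 0 ∧ W ≠ 0 := by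
  obtain ⟨i, j, h1, hf, hj, hm, -, -, rfl, hW, hr, rfl⟩ := h
  simp only [label]
  split_ifs <;> omega

theorem MarkTile.pos {N E S W : ℕ} (h : ρ.MarkTile N E S W) : E ≠ 0 ∧ S ≠ 0 ∧ W ≠ 0 := by
  have hq := ρ.three_le_q
  obtain ⟨i, h1, hf, ⟨-, rfl, rfl, rfl⟩ | ⟨-, rfl, rfl, rfl⟩⟩ := h
  · have hm := ρ.one_le_m i (by omega) (by omega)
    have hr := ρ.one_le_r i _ (by omega) (by omega) hm le_rfl
    have := ρ.hi_eq (show 1 ≤ i by omega)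
    omega
  · simp only [lo]
    omega

/-- Next to the left of a tile with a black left edge there would be a black tile, and the star
between the two is not allowed. -/
theorem Tile.row_or_mark {N E S W N' S' W' Ns : ℕ} (h : ρ.Tile N E S W)
    (h' : ρ.Tile N' W S' W') (hs : ρ.AllowedStar Ns S S') :
    ρ.RowTile N E S W ∨ ρ.MarkTile N E S W := by
  have hq := ρ.three_le_q
  suffices hW : W ≠ 0 by
    rcases h.cases with ⟨-, -, -, rfl⟩ | h | h | ⟨-, -, -, rfl⟩ | ⟨-, -, -, rfl⟩
    · exact absurd rfl hW
    · exact Or.inl h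
    · exact Or.inr h
    · exact absurd rfl hW
    · exact absurd rfl hW
  rintro rfl
  -- A black left edge forces a black lower edge. The tile on the left, having a black right edge,
  -- is all black, and the star between the two would be black on both horizontal sides.
  have hS : S = 0 := by
    rcases h.cases with ⟨-, -, rfl, -⟩ | h | h | ⟨-, -, rfl, -⟩ | ⟨-, -, rfl, -⟩
    · rfl
    · exact absurd rfl h.pos.2.2
    · exact absurd rfl h.pos.2.2
    · rfl
    · rfl
  have hS' : S' = 0 := by
    rcases h'.cases with ⟨-, -, rfl, -⟩ | h | h | ⟨-, h, -, -⟩ | ⟨-, h, -, -⟩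
    · rfl
    · exact absurd rfl h.pos.1
    · exact absurd rfl h.pos.1
    · omega
    · omega
  subst hS hS'
  rcases hs with ⟨i, j, -, -, hj, -, h, -⟩ | ⟨i, h1, hf, -, h, -⟩ | ⟨-, h⟩ | ⟨h, -⟩
  · simp only [label] at h; omega
  · have := ρ.hi_eq (show 1 ≤ i by omega)
    have := ρ.one_le_m i (by omega) (by omega)
    omega
  · exact h rfl
  · exact h rfl

variable (ρ)

/-- In row `i`, a tile with lower edge `S` and left edge `W` is at the position `φ` of the
period. -/
def Phase (i S W φ : ℕ) : Prop :=
  ∃ j c, 1 ≤ j ∧ j ≤ ρ.m i ∧ 1 ≤ c ∧ c ≤ ρ.r i j ∧ S = ρ.label i j ∧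
    (W = c ∨ (1 < i ∧ i < ρ.f ∧ W = q ∧ j = 1 ∧ c = 1)) ∧ φ = ρ.partialPeriod i (j - 1) + (c - 1)

/-- The row `i` starts a period with the vertical edge `N`, between the horizontal edges `W` and
`E`. -/
def Starts (i N E W : ℕ) : Prop :=
  W = ρ.hi i ∧ E = ρ.lo i ∧ (N = 1 ∨ (1 < i ∧ i < ρ.f ∧ N = q))

variable {ρ}

theorem exists_phase {N E S W : ℕ} (h : ρ.RowTile N E S W ∨ ρ.MarkTile N E S W) :
    ∃ i φ, 1 ≤ i ∧ i ≤ ρ.f ∧ ρ.Phase i S W φ := by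
  rcases h with ⟨i, j, h1, hf, hj, hm, -, -, hS, hW, hr, -⟩ |
    ⟨i, h1, hf, ⟨-, -, hS, hW⟩ | ⟨-, -, hS, hW⟩⟩
  · exact ⟨i, _, h1, hf, j, W, hj, hm, hW, hr, hS, Or.inl rfl, rfl⟩
  · have hm := ρ.one_le_m i (by omega) (by omega)
    refine ⟨i, _, by omega, by omega, ρ.m i, W, hm, le_rfl, ?_, hW.le, ?_, Or.inl rfl, rfl⟩
    · rw [hW]; exact ρ.one_le_r i _ (by omega) (by omega) hm le_rfl
    · rw [hS, label, ρ.hi_eq (by omega)]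
  -- This tile has `q` in the place of the counter `1`, so it sits at phase `0`.
  · have hm := ρ.one_le_m i (by omega) (by omega)
    exact ⟨i, _, by omega, by omega, 1, 1, le_rfl, hm, le_rfl,
      ρ.one_le_r i 1 (by omega) (by omega) le_rfl hm, hS, Or.inr ⟨h1, hf, hW, rfl, rfl⟩, rfl⟩

theorem hi_eq_label {i : ℕ} (h : 1 ≤ i) : ρ.hi i = ρ.label i (ρ.m i) := ρ.hi_eq h

/-- The upper edge of a tile is labelled by the row above. -/
theorem above_row {i N E S W φ W' φ' i' : ℕ} (h1 : 1 ≤ i) (h1' : 1 ≤ i')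
    (h : ρ.RowTile N E S W ∨ ρ.MarkTile N E S W) (hi : ρ.Phase i S W φ)
    (hi' : ρ.Phase i' N W' φ') : i' = ρ.above i := by
  have hf2 := ρ.two_le_f
  obtain ⟨j, c, hj, hm, -, -, rfl, -⟩ := hi
  have hrange : ρ.lo (ρ.above i) ≤ N ∧ N ≤ ρ.hi (ρ.above i) := by
    rcases h with ⟨i0, j0, h10, hf0, hj0, hm0, hlo, hhi, hS, -⟩ | ⟨i0, h10, hf0, hcase⟩
    · obtain ⟨rfl, -⟩ := ρ.label_inj h1 h10 hj hj0 hm hm0 hS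
      exact ⟨hlo, hhi⟩
    · have hm0 := ρ.one_le_m i0 (by omega) (by omega)
      have hm1 := ρ.one_le_m (i0 - 1) (by omega) (by omega)
      have e1 := ρ.hi_eq (show 1 ≤ i0 - 1 by omega)
      obtain rfl : i = i0 := by
        rcases hcase with ⟨-, -, hS, -⟩ | ⟨-, -, hS, -⟩
        · rw [hi_eq_label (by omega)] at hS
          exact (ρ.label_inj h1 (by omega) hj hm0 hm le_rfl hS).1
        · exact (ρ.label_inj h1 (by omega) hj le_rfl hm hm0 hS).1
      have ha : ρ.above i = i - 1 := if_neg (by omega)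
      rw [ha]
      simp only [lo] at hcase ⊢
      rcases hcase with ⟨rfl, -⟩ | ⟨rfl, -⟩ <;> omega
  obtain ⟨j', c', hj', hm', -, -, rfl, -⟩ := hi'
  have ha : 1 ≤ ρ.above i := by simp only [above]; split_ifs <;> omega
  have e1 := ρ.hi_eq ha
  have e2 := ρ.hi_eq h1'
  simp only [lo, label] at hrange
  rcases lt_trichotomy i' (ρ.above i) with hlt | heq | hlt
  · have := ρ.hi_mono (show i' ≤ ρ.above i - 1 by omega)
    omega
  · exact heq
  · have := ρ.hi_mono (show ρ.above i ≤ i' - 1 by omega)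
    omega

/-- From one tile to the next one, the position in the period advances by one. -/
theorem Phase.advance {i N E S W φ S' : ℕ} (h1 : 1 ≤ i) (hf : i ≤ ρ.f)
    (h : ρ.RowTile N E S W ∨ ρ.MarkTile N E S W) (hi : ρ.Phase i S W φ)
    (hs : ρ.AllowedStar E S' S) (hS' : S' ≠ 0) :
    ρ.Phase i S' E (φ + 1) ∨ (φ + 1 = ρ.period i ∧ ρ.Phase i S' E 0 ∧ ρ.Starts i E S' S) := by
  have hq := ρ.three_le_q
  obtain ⟨j, c, hj, hm, hc, hr, rfl, hW, rfl⟩ := hi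
  have hmi := ρ.one_le_m i h1 hf
  have hr1 := ρ.one_le_r i 1 h1 hf le_rfl hmi
  -- What the star at the lower right corner of the tile permits: keep the label, move on to the
  -- next one, or return to the first with a marker.
  have hstar : (2 ≤ E ∧ E ≤ ρ.r i j ∧ S' = ρ.label i j) ∨
      (E = 1 ∧ S' = if j = ρ.m i then ρ.lo i else ρ.label i j + 1) ∨
      (1 < i ∧ i < ρ.f ∧ E = q ∧ j = ρ.m i ∧ S' = ρ.lo i) := by
    rcases hs with ⟨i0, j0, h10, hf0, hj0, hm0, hS, hs⟩ | ⟨i0, h10, hf0, hE, hS, hS0⟩ | ⟨h0, -⟩ |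
      ⟨-, h0⟩
    · obtain ⟨rfl, rfl⟩ := ρ.label_inj h1 h10 hj hj0 hm hm0 hS
      exact hs.imp id Or.inl
    · have hm0 := ρ.one_le_m i0 (by omega) (by omega)
      rw [hi_eq_label (by omega)] at hS
      obtain ⟨rfl, rfl⟩ := ρ.label_inj h1 (by omega) hj hm0 hm le_rfl hS
      exact Or.inr (Or.inr ⟨h10, hf0, hE, rfl, hS0⟩)
    · simp only [label] at h0; omega
    · exact absurd h0 hS'
  have htile : (W = c ∧ E = if c = ρ.r i j then 1 else c + 1) ∨
      (1 < i ∧ i < ρ.f ∧ j = ρ.m i ∧ c = ρ.r i j ∧ E = q) ∨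
      (1 < i ∧ i < ρ.f ∧ j = 1 ∧ c = 1 ∧ E = 2) := by
    rcases h with ⟨i0, j0, h10, hf0, hj0, hm0, -, -, hS, hW1, hWr, hE⟩ | ⟨i0, h10, hf0, hcase⟩
    · obtain ⟨rfl, rfl⟩ := ρ.label_inj h1 h10 hj hj0 hm hm0 hS
      rcases hW with rfl | ⟨hi1, hif, hWq, -⟩
      · exact Or.inl ⟨rfl, hE⟩
      -- In rows with marker tiles all counters stay below `q`, so a left edge `q` cannot be
      -- mistaken for a counter.
      · have := ρ.r_lt i j hi1 hif hj hm
        omega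
    · have hm0 := ρ.one_le_m i0 (by omega) (by omega)
      rcases hcase with ⟨-, hE, hS, hWr⟩ | ⟨-, hE, hS, hWq⟩
      · rw [hi_eq_label (by omega)] at hS
        obtain ⟨rfl, rfl⟩ := ρ.label_inj h1 (by omega) hj hm0 hm le_rfl hS
        rcases hW with rfl | ⟨-, -, hWq, -⟩
        · exact Or.inr (Or.inl ⟨h10, hf0, rfl, hWr, hE⟩)
        · have := ρ.r_lt i _ h10 hf0 hj le_rfl
          omega
      · obtain ⟨rfl, rfl⟩ := ρ.label_inj h1 (by omega) hj le_rfl hm hm0 hS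
        have := ρ.r_lt i 1 h10 hf0 le_rfl hm0
        rcases hW with rfl | ⟨-, -, -, -, hc1⟩
        · omega
        · exact Or.inr (Or.inr ⟨h10, hf0, rfl, hc1, hE⟩)
  -- The last counter of the last sub-period, followed by the first label, completes the period.
  have hstart : ∀ (_ : c = ρ.r i j) (_ : j = ρ.m i) (_ : S' = ρ.lo i)
      (_ : E = 1 ∨ (1 < i ∧ i < ρ.f ∧ E = q)), ρ.partialPeriod i (j - 1) + (c - 1) + 1 =
      ρ.period i ∧ ρ.Phase i S' E 0 ∧ ρ.Starts i E S' (ρ.label i j) := by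
    intro hcr hjm hS0 hE
    have e1 := ρ.partialPeriod_eq i hj
    refine ⟨?_, ⟨1, 1, le_rfl, hmi, le_rfl, hr1, hS0, ?_, ?_⟩, ?_, hS0, hE⟩
    · rw [show ρ.period i = ρ.partialPeriod i j by rw [hjm]; rfl]
      omega
    · rcases hE with rfl | ⟨a, b, rfl⟩
      · exact Or.inl rfl
      · exact Or.inr ⟨a, b, rfl, rfl, rfl⟩
    · simp [partialPeriod]
    · rw [hi_eq_label h1, hjm]
  have hsame : ∀ (_ : c + 1 ≤ ρ.r i j) (_ : E = c + 1) (_ : S' = ρ.label i j),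
      ρ.Phase i S' E (ρ.partialPeriod i (j - 1) + (c - 1) + 1) := by
    intro hcr hE hS0
    exact ⟨j, c + 1, hj, hm, by omega, hcr, hS0, Or.inl hE, by omega⟩
  rcases htile with ⟨-, hE⟩ | ⟨a, b, hjm, hcr, hE⟩ | ⟨a, b, hj1, hc1, hE⟩
  · by_cases hcr : c = ρ.r i j
    · rw [if_pos hcr] at hE
      rcases hstar with ⟨h2, -⟩ | ⟨-, hS0⟩ | ⟨-, -, h2, -⟩
      · omega
      · by_cases hjm : j = ρ.m i
        · rw [if_pos hjm] at hS0
          exact Or.inr (hstart hcr hjm hS0 (Or.inl hE))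
        · rw [if_neg hjm] at hS0
          have e1 := ρ.partialPeriod_eq i hj
          refine Or.inl ⟨j + 1, 1, by omega, by omega, le_rfl,
            ρ.one_le_r i _ h1 hf (by omega) (by omega), ?_, Or.inl hE, ?_⟩
          · rw [hS0]; simp only [label]; omega
          · simp only [Nat.add_sub_cancel]; omega
      · omega
    · rw [if_neg hcr] at hE
      rcases hstar with ⟨h2, -, hS0⟩ | ⟨h2, -⟩ | ⟨a, b, h2, -⟩
      · exact Or.inl (hsame (by omega) hE hS0)
      · omega
      · have := ρ.r_lt i j a b hj hm
        omega
  · have := ρ.r_lt i j a b hj hm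
    rcases hstar with ⟨-, h2, -⟩ | ⟨h2, -⟩ | ⟨-, -, -, -, hS0⟩
    · omega
    · omega
    · exact Or.inr (hstart hcr hjm hS0 (Or.inr ⟨a, b, hE⟩))
  · rcases hstar with ⟨-, h2, hS0⟩ | ⟨h2, -⟩ | ⟨-, -, h2, -⟩
    · exact Or.inl (hsame (by omega) (by omega) hS0)
    · omega
    · omega

/-- The side length of a block that contains a whole period of the tiling. -/
def blockSize (ρ : Rows q) : ℕ := (∏ i ∈ Finset.Icc 1 ρ.f, ρ.period i) + 2 * ρ.f + 3

/-- A row of tiles is in the row `i` throughout, and starts a period at all positions given by the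
phase of its first tile. -/
theorem starts_of_row {n i φ : ℕ} {top hor ver : ℕ → ℕ} (h1 : 1 ≤ i) (hf : i ≤ ρ.f)
    (htile : ∀ x ≤ n, ρ.RowTile (top x) (ver (x + 1)) (hor x) (ver x) ∨
      ρ.MarkTile (top x) (ver (x + 1)) (hor x) (ver x))
    (hstar : ∀ x < n, ρ.AllowedStar (ver (x + 1)) (hor (x + 1)) (hor x))
    (hφ : ρ.Phase i (hor 0) (ver 0) φ) {x : ℕ} (hx : x + 1 ≤ n)
    (hdvd : ρ.period i ∣ φ + (x + 1)) :
    ρ.Starts i (ver (x + 1)) (hor (x + 1)) (hor x) := by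
  have hS : ∀ x ≤ n, hor x ≠ 0 := fun x hx => by
    rcases htile x hx with h | h
    exacts [h.pos.2.1, h.pos.2.1]
  have hlt : ∀ {S W ψ}, ρ.Phase i S W ψ → ψ < ρ.period i := by
    rintro S W ψ ⟨j, c, hj, hm, hc, hr, -, -, rfl⟩
    have e1 := ρ.partialPeriod_eq i hj
    have : ρ.partialPeriod i j ≤ ρ.period i :=
      Finset.sum_le_sum_of_subset (Finset.Icc_subset_Icc_right hm)
    omega
  -- The phase restarts at `0` after each period, so only its residue is tracked.
  have key : ∀ x ≤ n, ∃ ψ, ρ.Phase i (hor x) (ver x) ψ ∧ ψ ≡ φ + x [MOD ρ.period i] := by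
    intro x
    induction x with
    | zero => exact fun _ => ⟨φ, hφ, Nat.ModEq.refl _⟩
    | succ x ih =>
      intro hx
      obtain ⟨ψ, hψ, hmod⟩ := ih (by omega)
      rcases hψ.advance h1 hf (htile x (by omega)) (hstar x (by omega)) (hS _ hx) with h | ⟨h, h0, -⟩
      · exact ⟨_, h, hmod.add_right 1⟩
      · refine ⟨0, h0, ?_⟩
        have h2 := hmod.add_right 1
        rw [h] at h2
        exact ((Nat.modEq_zero_iff_dvd.2 dvd_rfl).symm.trans h2)
  obtain ⟨ψ, hψ, hmod⟩ := key x (by omega)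
  rcases hψ.advance h1 hf (htile x (by omega)) (hstar x (by omega)) (hS _ hx) with h | ⟨-, -, h⟩
  -- Without a restart the next phase would be a positive multiple of the period and yet smaller
  -- than the period.
  · have h2 := hmod.add_right 1
    have h3 : ρ.period i ∣ ψ + 1 := (h2.dvd_iff dvd_rfl).2 hdvd
    have := Nat.le_of_dvd (by omega) h3
    have := hlt h
    omega
  · exact h

/-- There is no column in which all rows, one on top of the other, start a period without a
penalty. -/
theorem not_all_start {ver : ℕ → ℕ}
    (h : ∀ i, 1 ≤ i → i ≤ ρ.f → ∃ E W, ρ.Starts i (ver i) E W ∧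
      (i < ρ.f → ρ.GoodStar (ver i) E (ver (i + 1)) W)) : False := by
  have hf := ρ.two_le_f
  have hq := ρ.three_le_q
  -- The top row has no marker and begins with `1`. A `1` in the next row would complete a penalised
  -- star, so that row must begin with `q`, and so on downwards; the last row has no marker either,
  -- a contradiction.
  have key : ∀ i, 1 ≤ i → i ≤ ρ.f → ver i = if i = 1 then 1 else q := by
    intro i h1
    induction i, h1 using Nat.le_induction with
    | base =>
      intro _
      obtain ⟨E, W, ⟨-, -, h | ⟨h, -⟩⟩, -⟩ := h 1 le_rfl (by omega)
      · rw [h, if_pos rfl]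
      · omega
    | succ i hi ih =>
      intro hif
      obtain ⟨E, W, ⟨hW, hE, -⟩, hgood⟩ := h i hi (by omega)
      have hne : ver (i + 1) ≠ 1 := fun h1 =>
        (hgood (by omega)).not_penalised hi (by omega) ⟨ih (by omega), hE, h1, hW⟩
      obtain ⟨E', W', ⟨-, -, h' | ⟨-, -, h'⟩⟩, -⟩ := h (i + 1) (by omega) hif
      · exact absurd h' hne
      · rw [h', if_neg (by omega)]
  have hlast := key ρ.f (by omega) le_rfl
  obtain ⟨E, W, ⟨-, -, h' | ⟨-, h', -⟩⟩, -⟩ := h ρ.f (by omega) le_rfl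
  · rw [if_neg (by omega)] at hlast
    omega
  · omega

/-- There is no defect-free large block. Here `hor x y` and `ver x y` are the colours of the
horizontal and of the vertical edge that begin at `(x, y)`. -/
theorem no_perfect_block {hor ver : ℕ → ℕ → ℕ}
    (htile : ∀ x y, x ≤ ρ.blockSize → y ≤ ρ.blockSize →
      ρ.Tile (hor x (y + 1)) (ver (x + 1) y) (hor x y) (ver x y))
    (hstar : ∀ x y, x ≤ ρ.blockSize → y ≤ ρ.blockSize →
      ρ.GoodStar (ver (x + 1) (y + 1)) (hor (x + 1) (y + 1)) (ver (x + 1) y) (hor x (y + 1))) :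
    False := by
  have hf := ρ.two_le_f
  set n := ρ.blockSize with hn
  have hn' : n = (∏ i ∈ Finset.Icc 1 ρ.f, ρ.period i) + 2 * ρ.f + 3 := hn
  -- Coordinates start at `1`, since excluding black requires the tile on the left and the star at
  -- the lower left corner.
  have hnormal : ∀ x y, x + 1 ≤ n → y + 1 ≤ n →
      ρ.RowTile (hor (x + 1) (y + 2)) (ver (x + 2) (y + 1)) (hor (x + 1) (y + 1))
        (ver (x + 1) (y + 1)) ∨
      ρ.MarkTile (hor (x + 1) (y + 2)) (ver (x + 2) (y + 1)) (hor (x + 1) (y + 1))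
        (ver (x + 1) (y + 1)) := fun x y hx hy =>
    (htile (x + 1) (y + 1) hx hy).row_or_mark (htile x (y + 1) (by omega) hy)
      (hstar x y (by omega) (by omega)).allowed
  have hphase : ∀ y, ∃ i φ, y + 1 ≤ n → 1 ≤ i ∧ i ≤ ρ.f ∧
      ρ.Phase i (hor 1 (y + 1)) (ver 1 (y + 1)) φ := by
    intro y
    by_cases hy : y + 1 ≤ n
    · obtain ⟨i, φ, h⟩ := exists_phase (hnormal 0 y (by omega) hy)
      exact ⟨i, φ, fun _ => h⟩
    · exact ⟨0, 0, fun h => absurd h hy⟩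
  choose row ph hrow using hphase
  have habove : ∀ y, y + 2 ≤ n → row (y + 1) = ρ.above (row y) := by
    intro y hy
    have h0 := hrow y (by omega)
    have h1 := hrow (y + 1) hy
    exact above_row h0.1 h1.1 (hnormal 0 y (by omega) (by omega)) h0.2.2 h1.2.2
  have hprod : 0 < ∏ i ∈ Finset.Icc 1 ρ.f, ρ.period i := Finset.prod_pos fun i hi =>
    ρ.period_pos (Finset.mem_Icc.1 hi).1 (Finset.mem_Icc.1 hi).2
  have h0 := hrow 0 (by omega)
  have hdown : ∀ y k, y + k + 2 ≤ n → k < row y → row (y + k) = row y - k := by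
    intro y k
    induction k with
    | zero => intros; rfl
    | succ k ih =>
      intro hk hk'
      rw [← add_assoc, habove _ (by omega), ih (by omega) (by omega), above, if_neg (by omega)]
      omega
  -- Going upwards the index falls to `1` and then jumps to `f`; this is the bottom of a complete
  -- stack, within `f` rows of the start.
  have hbottom : row (row 0) = ρ.f := by
    have h2 := hdown 0 (row 0 - 1) (by omega) (by omega)
    have h3 := habove (row 0 - 1) (by omega)
    rw [zero_add] at h2
    rw [h2, show row 0 - 1 + 1 = row 0 by omega, show row 0 - (row 0 - 1) = 1 by omega] at h3
    rw [h3, above, if_pos rfl]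
  have hrows : ∀ i, 1 ≤ i → i ≤ ρ.f → row (row 0 + (ρ.f - i)) = i := by
    intro i h1 hi
    rw [hdown _ _ (by omega) (by omega), hbottom]
    omega
  have hcop : Set.Pairwise (Finset.Icc 1 ρ.f : Set ℕ) (Function.onFun Nat.Coprime ρ.period) := by
    intro i hi k hk hne
    simp only [Finset.coe_Icc, Set.mem_Icc] at hi hk
    rcases lt_or_gt_of_ne hne with h | h
    · exact ρ.coprime i k hi.1 h hk.2
    · exact (ρ.coprime k i hk.1 h hi.2).symm
  have hpne : ∀ i ∈ Finset.Icc 1 ρ.f, ρ.period i ≠ 0 := fun i hi =>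
    (ρ.period_pos (Finset.mem_Icc.1 hi).1 (Finset.mem_Icc.1 hi).2).ne'
  -- Modulo the period this is `-(φ + 1)`, with `φ` the phase of the first tile of row `i`. The
  -- remainder `k` makes `φ + k + 1` divisible by every period.
  let a : ℕ → ℕ := fun i => (ρ.period i - 1) * (ph (row 0 + (ρ.f - i)) + 1)
  let k := Nat.chineseRemainderOfFinset a ρ.period (Finset.Icc 1 ρ.f) hpne hcop
  have hk : k.1 < ∏ i ∈ Finset.Icc 1 ρ.f, ρ.period i :=
    Nat.chineseRemainderOfFinset_lt_prod a ρ.period hpne hcop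
  refine not_all_start (ρ := ρ) (ver := fun i => ver (k.1 + 2) (row 0 + (ρ.f - i) + 1))
    fun i h1 hi => ?_
  refine ⟨hor (k.1 + 2) (row 0 + (ρ.f - i) + 1), hor (k.1 + 1) (row 0 + (ρ.f - i) + 1), ?_, ?_⟩
  · have hy : row 0 + (ρ.f - i) + 1 ≤ n := by omega
    have hph := (hrow _ hy).2.2
    rw [hrows i h1 hi] at hph
    refine starts_of_row (n := n - 1) (hor := fun x => hor (x + 1) (row 0 + (ρ.f - i) + 1))
      (ver := fun x => ver (x + 1) (row 0 + (ρ.f - i) + 1)) h1 hi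
      (fun x hx => hnormal x _ (by omega) hy)
      (fun x hx => (hstar (x + 1) (row 0 + (ρ.f - i)) (by omega) (by omega)).allowed) hph
      (by omega) ?_
    have hmod := k.2 i (Finset.mem_Icc.2 ⟨h1, hi⟩)
    have hpos := ρ.period_pos h1 hi
    have h2 := hmod.add_right (ph (row 0 + (ρ.f - i)) + 1)
    have h3 : a i + (ph (row 0 + (ρ.f - i)) + 1) =
        ρ.period i * (ph (row 0 + (ρ.f - i)) + 1) := by
      obtain ⟨p, hp⟩ : ∃ p, ρ.period i = p + 1 := ⟨ρ.period i - 1, by omega⟩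
      simp only [a, hp, Nat.add_sub_cancel]
      ring
    rw [h3] at h2
    have h4 := (h2.dvd_iff dvd_rfl).2 (dvd_mul_right _ _)
    convert h4 using 1
    simp only [k]
    omega
  · intro hlt
    have := hstar (k.1 + 1) (row 0 + (ρ.f - i)) (by omega) (by omega)
    rw [show row 0 + (ρ.f - (i + 1)) + 1 = row 0 + (ρ.f - i) by omega]
    exact this

end Rows

/-! ### Defects of a sector -/

section Defects

variable {q : ℕ}

/-- A cell is a defect if it is partially classical, or classical with a positive energy. -/
def IsDefect (ρ : Rows q) (s : Sector q) (t : Bool) (x y : ℤ) : Prop :=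
  ¬IsToric s t x y ∧ (IsClassical s t x y → sectorWeight ρ s t x y ≤ 0)

/-- A plaquette all of whose edges are black. -/
def IsBlack (s : Sector q) (x y : ℤ) : Prop := ∀ i, s (plaqEdge x y i) = some 0

/-- A star whose horizontal edges are black. -/
def IsBlackStar (s : Sector q) (x y : ℤ) : Prop :=
  s (starEdge x y .west) = some 0 ∧ s (starEdge x y .east) = some 0

variable {ρ : Rows q} {s : Sector q}

/-- A single classical spin makes a defect-free cell wholly classical; this is how classicality
spreads from cell to cell. -/
theorem isClassical_of_not_isDefect {t : Bool} {x y : ℤ} (h : ¬IsDefect ρ s t x y) (i : Side)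
    (hi : s (cellEdge t x y i) ≠ none) :
    IsClassical s t x y ∧ 0 < sectorWeight ρ s t x y := by
  simp only [IsDefect, not_and, Classical.not_imp, not_le] at h
  exact h fun hT => hi (hT i)

theorem colour_of_some {e : Site} {c : Fin (q + 1)} (h : s e = some c) : colour s e = c := by
  simp [colour, h]

theorem eq_some_zero {e : Site} (h : s e ≠ none) (h0 : colour s e = 0) : s e = some 0 := by
  obtain ⟨c, hc⟩ := Option.ne_none_iff_exists'.1 h
  rw [colour_of_some hc] at h0
  rw [hc, Fin.ext_iff.2 (h0.trans (Fin.val_zero _).symm)]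

/-- To the left of a black plaquette there is a defect or a star with black horizontal edges. -/
theorem IsBlack.left {x y : ℤ} (h : IsBlack s x y) :
    IsDefect ρ s false (x - 1) y ∨ IsBlackStar s x y := by
  have hq := ρ.three_le_q
  by_contra hn
  rw [not_or] at hn
  have hw : s (vEdge x y) = some 0 := h .west
  have hE : cellEdge false (x - 1) y .east = vEdge x y := by simp [cellEdge, plaqEdge]
  obtain ⟨hc, hpos⟩ := isClassical_of_not_isDefect hn.1 .east (by rw [hE, hw]; simp)
  have htile : ρ.Tile _ _ _ _ := hpos
  rw [hE, colour_of_some hw, Fin.val_zero] at htile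
  have hS : colour s (cellEdge false (x - 1) y .south) = 0 := by
    rcases htile.cases with ⟨-, -, h, -⟩ | h | h | ⟨-, h, -, -⟩ | ⟨-, h, -, -⟩
    · exact h
    · exact absurd rfl h.pos.1
    · exact absurd rfl h.pos.1
    · omega
    · omega
  exact hn.2 ⟨eq_some_zero (hc .south) hS, h .south⟩

/-- To the right of a black plaquette there is a defect or a star with black horizontal edges. -/
theorem IsBlack.right {x y : ℤ} (h : IsBlack s x y) :
    IsDefect ρ s false (x + 1) y ∨ IsBlackStar s (x + 1) y := by
  by_contra hn
  rw [not_or] at hn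
  have hw : s (cellEdge false (x + 1) y .west) = some 0 := h .east
  obtain ⟨hc, hpos⟩ := isClassical_of_not_isDefect hn.1 .west (by rw [hw]; simp)
  have htile : ρ.Tile _ _ _ _ := hpos
  rw [colour_of_some hw, Fin.val_zero] at htile
  have hS : colour s (cellEdge false (x + 1) y .south) = 0 := by
    rcases htile.cases with ⟨-, -, h, -⟩ | h | h | ⟨-, -, h, -⟩ | ⟨-, -, h, -⟩
    · exact h
    · exact absurd rfl h.pos.2.2
    · exact absurd rfl h.pos.2.2
    · exact h
    · exact h
  refine hn.2 ⟨?_, eq_some_zero (hc .south) hS⟩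
  have := h .south
  simpa [starEdge, plaqEdge] using this

/-- Labels are at least `1`, and otherwise exactly one horizontal edge may be black, so no allowed
star has two black ones. -/
theorem IsBlackStar.isDefect {x y : ℤ} (h : IsBlackStar s x y) : IsDefect ρ s true x y := by
  refine ⟨fun hT => ?_, fun hc => not_lt.1 fun hpos => ?_⟩
  · have h1 : s (starEdge x y .west) = none := hT .west
    rw [h.1] at h1
    cases h1
  · have hstar : ρ.GoodStar _ _ _ _ := hpos
    have hall := hstar.allowed
    have hW : colour s (cellEdge true x y .west) = 0 := colour_of_some h.1
    have hE : colour s (cellEdge true x y .east) = 0 := colour_of_some h.2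
    rw [hW, hE] at hall
    rcases hall with ⟨i, j, -, -, hj, -, h, -⟩ | ⟨i, h1, hf, -, h, -⟩ | ⟨-, h⟩ | ⟨h, -⟩
    · simp only [Rows.label] at h; omega
    · have := ρ.hi_eq (show 1 ≤ i by omega)
      have := ρ.one_le_m i (by omega) (by omega)
      omega
    · exact h rfl
    · exact h rfl

/-- Every classical spin is close to a defect. -/
theorem exists_defect_near (ρ : Rows q) {e : Site} (he : s e ≠ none) :
    ∃ t x y, IsDefect ρ s t x y ∧ e.2.1 ≤ x ∧ x ≤ e.2.1 + (ρ.blockSize + 1) ∧ e.2.2 ≤ y ∧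
      y ≤ e.2.2 + (ρ.blockSize + 1) := by
  by_contra hn
  push Not at hn
  obtain ⟨b, u, v⟩ := e
  simp only at hn
  set n := ρ.blockSize with hndef
  have hnd : ∀ t (i j : ℕ), i ≤ n + 1 → j ≤ n + 1 → ¬IsDefect ρ s t (u + i) (v + j) := by
    intro t i j hi hj hdef
    have := hn t _ _ hdef (by omega) (by omega) (by omega)
    omega
  -- Classicality passes through shared edges, upwards in the first column and then to the right.
  have hplaq : ∀ i j : ℕ, i ≤ n + 1 → j ≤ n + 1 → IsClassical s false (u + i) (v + j) := by
    intro i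
    induction i with
    | zero =>
      intro j
      induction j with
      | zero =>
        intro hi hj
        cases b
        · exact (isClassical_of_not_isDefect (hnd false 0 0 hi hj) .south
            (by simpa [cellEdge, plaqEdge, hEdge] using he)).1
        · exact (isClassical_of_not_isDefect (hnd false 0 0 hi hj) .west
            (by simpa [cellEdge, plaqEdge, vEdge] using he)).1
      | succ j ih =>
        intro hi hj
        have h1 := ih hi (by omega) .north
        refine (isClassical_of_not_isDefect (hnd false 0 (j + 1) hi hj) .south ?_).1
        simpa [cellEdge, plaqEdge, add_assoc] using h1
    | succ i ih =>
      intro j hi hj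
      have h1 := ih j (by omega) hj .east
      refine (isClassical_of_not_isDefect (hnd false (i + 1) j hi hj) .west ?_).1
      simpa [cellEdge, plaqEdge, add_assoc] using h1
  refine Rows.no_perfect_block (ρ := ρ) (hor := fun i j => colour s (hEdge (u + i) (v + j)))
    (ver := fun i j => colour s (vEdge (u + i) (v + j))) ?_ ?_
  · intro i j hi hj
    have := (isClassical_of_not_isDefect (hnd false i j (by omega) (by omega)) .south
      (hplaq i j (by omega) (by omega) .south)).2
    simpa [sectorWeight, cellWeight, cellEdge, plaqEdge, Rows.Tile, add_assoc] using this
  · intro i j hi hj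
    have h1 := hplaq (i + 1) (j + 1) (by omega) (by omega) .south
    have := (isClassical_of_not_isDefect (hnd true (i + 1) (j + 1) (by omega) (by omega)) .east
      h1).2
    have e1 : (u + (i + 1 : ℕ) : ℤ) - 1 = u + i := by push_cast; ring
    have e2 : (v + (j + 1 : ℕ) : ℤ) - 1 = v + j := by push_cast; ring
    simpa only [sectorWeight, cellWeight, cellEdge, starEdge, Rows.GoodStar, e1, e2] using this

end Defects

/-! ### The energy of a finite classical region -/

section Gain

variable {q : ℕ}

/-- The number of corners of a cell at which the subspace changes. -/
def cellCut (s : Sector q) (t : Bool) (x y : ℤ) : ℝ :=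
  cut s (cellEdge t x y .north) (cellEdge t x y .east) +
    cut s (cellEdge t x y .north) (cellEdge t x y .west) +
    cut s (cellEdge t x y .south) (cellEdge t x y .west) +
    cut s (cellEdge t x y .south) (cellEdge t x y .east)

theorem cut_comm (s : Sector q) (e e' : Site) : cut s e e' = cut s e' e := by
  simp only [cut, iff_comm]

theorem cellCut_nonneg (s : Sector q) (t : Bool) (x y : ℤ) : 0 ≤ cellCut s t x y := by
  have h : ∀ e e', 0 ≤ cut s e e' := fun e e' => by unfold cut; split_ifs <;> norm_num
  have := h (cellEdge t x y .north) (cellEdge t x y .east)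
  have := h (cellEdge t x y .north) (cellEdge t x y .west)
  have := h (cellEdge t x y .south) (cellEdge t x y .west)
  have := h (cellEdge t x y .south) (cellEdge t x y .east)
  unfold cellCut
  linarith

/-- The four corners form a cycle through the edges, and a nonconstant two-valued function on a
cycle changes at least twice. -/
theorem two_le_cellCut {s : Sector q} {t : Bool} {x y : ℤ} (h1 : ¬IsToric s t x y)
    (h2 : ¬IsClassical s t x y) : 2 ≤ cellCut s t x y := by
  obtain ⟨i, hi⟩ := not_forall.1 h1
  obtain ⟨j, hj⟩ := not_forall.1 h2
  unfold cellCut cut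
  by_cases hN : s (cellEdge t x y .north) = none <;> by_cases hE : s (cellEdge t x y .east) = none <;>
  by_cases hS : s (cellEdge t x y .south) = none <;> by_cases hW : s (cellEdge t x y .west) = none <;>
  first
  | (exfalso; cases i <;> contradiction)
  | (exfalso; cases j <;> contradiction)
  | (simp only [hN, hE, hS, hW]; norm_num)

open Classical in
/-- The energy that is gained at a cell when its classical spins are replaced; half of the penalty
at each of its corners is attributed to it. -/
def cellGain (ρ : Rows q) (C : ℝ) (s : Sector q) (t : Bool) (x y : ℤ) : ℝ :=
  (if IsToric s t x y then 0 else cellEnergy ρ s t x y -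
    if s (cellEdge t x y .east) ≠ none ∧ s (cellEdge t x y .west) ≠ none then 0 else 1 / 2) +
    C / 2 * cellCut s t x y

open Classical in
/-- The indicator of a proposition. -/
def ind (p : Prop) : ℝ := if p then 1 else 0

theorem ind_nonneg (p : Prop) : 0 ≤ ind p := by unfold ind; split_ifs <;> norm_num

theorem ind_of {p : Prop} (h : p) : ind p = 1 := if_pos h

theorem ind_of_not {p : Prop} (h : ¬p) : ind p = 0 := if_neg h

theorem ind_le_one (p : Prop) : ind p ≤ 1 := by unfold ind; split_ifs <;> norm_num

variable {ρ : Rows q} {s : Sector q} {C : ℝ}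

/-- Two cut corners at half a penalty each already give `1`; filling loses at most `1/2`, and
nothing if the eastern and western spins are both classical. -/
theorem cellGain_of_mixed (hC : 1 ≤ C) {t : Bool} {x y : ℤ} (h1 : ¬IsToric s t x y)
    (h2 : ¬IsClassical s t x y) :
    1 - (1 / 2) * ind (¬(s (cellEdge t x y .east) ≠ none ∧ s (cellEdge t x y .west) ≠ none)) ≤
      cellGain ρ C s t x y := by
  have := two_le_cellCut h1 h2
  have h3 : 1 ≤ C / 2 * cellCut s t x y := by nlinarith
  unfold cellGain ind cellEnergy
  rw [if_neg h1, if_neg h2]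
  split_ifs <;> first | contradiction | linarith

theorem cellGain_of_classical (hC : 1 ≤ C) {t : Bool} {x y : ℤ} (h : IsClassical s t x y) :
    1 - sectorWeight ρ s t x y ≤ cellGain ρ C s t x y := by
  have h1 : ¬IsToric s t x y := fun h' => h .north (h' .north)
  have := cellCut_nonneg s t x y
  have h3 : 0 ≤ C / 2 * cellCut s t x y := by positivity
  unfold cellGain cellEnergy
  rw [if_neg h1, if_pos h, if_pos ⟨h .east, h .west⟩]
  linarith

theorem cellGain_of_toric (hC : 1 ≤ C) {t : Bool} {x y : ℤ} (h : IsToric s t x y) :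
    0 ≤ cellGain ρ C s t x y := by
  have := cellCut_nonneg s t x y
  unfold cellGain
  rw [if_pos h, zero_add]
  positivity

/-- A black star gains at least `1`, since its two horizontal spins are classical. It can give `1/4`
to each of the two plaquettes above it and still keep `1/4`. Any other defect gains at least `1/2`.
-/
theorem starGain_ge (hC : 1 ≤ C) (x y : ℤ) :
    (1 / 4) * ind (IsDefect ρ s true x y) + (1 / 2) * ind (IsBlackStar s x y) ≤
      cellGain ρ C s true x y := by
  by_cases hb : IsBlackStar s x y
  · rw [ind_of hb, ind_of hb.isDefect]
    by_cases hc : IsClassical s true x y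
    · have := cellGain_of_classical (ρ := ρ) hC hc
      have := (hb.isDefect (ρ := ρ)).2 hc
      linarith
    · have := cellGain_of_mixed (ρ := ρ) hC (hb.isDefect (ρ := ρ)).1 hc
      rw [ind_of_not] at this
      · linarith
      · rw [not_not]
        exact ⟨by rw [show cellEdge true x y .east = starEdge x y .east from rfl, hb.2]; simp,
          by rw [show cellEdge true x y .west = starEdge x y .west from rfl, hb.1]; simp⟩
  · rw [ind_of_not hb]
    by_cases hd : IsDefect ρ s true x y
    · rw [ind_of hd]
      by_cases hc : IsClassical s true x y
      · have := cellGain_of_classical (ρ := ρ) hC hc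
        have := hd.2 hc
        linarith
      · have := cellGain_of_mixed (ρ := ρ) hC hd.1 hc
        have := ind_le_one
          (¬(s (cellEdge true x y .east) ≠ none ∧ s (cellEdge true x y .west) ≠ none))
        linarith
    · rw [ind_of_not hd]
      by_cases ht : IsToric s true x y
      · have := cellGain_of_toric (ρ := ρ) hC ht
        linarith
      · obtain ⟨i, hi⟩ := not_forall.1 ht
        have hc := (isClassical_of_not_isDefect hd i hi).1
        have := cellGain_of_classical (ρ := ρ) hC hc
        have hle : sectorWeight ρ s true x y ≤ 1 := by
          change ρ.starWeight _ _ _ _ ≤ 1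
          unfold Rows.starWeight
          split_ifs <;> norm_num
        linarith

theorem IsBlack.not_isDefect {x y : ℤ} (h : IsBlack s x y) : ¬IsDefect ρ s false x y := by
  intro hd
  have hc : IsClassical s false x y := fun i => by
    rw [show cellEdge false x y i = plaqEdge x y i from rfl, h i]; simp
  have hw : sectorWeight ρ s false x y = 3 / 2 := by
    have h0 : ∀ i, colour s (cellEdge false x y i) = 0 := fun i => colour_of_some (h i)
    simp [sectorWeight, cellWeight, Rows.tileWeight, h0]
  have := hd.2 hc
  linarith

/-- Every defect gains at least `1/2`: `1/4` to keep and `1/4` for one black horizontal neighbour.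
Between two black neighbours its eastern and western spins are classical, the gain is at least `1`,
and it can pay both. A black plaquette itself may lose its bonus `1/2`. -/
theorem plaqGain_ge (hC : 1 ≤ C) (x y : ℤ) :
    (1 / 4) * ind (IsDefect ρ s false x y) + (1 / 4) * (ind (IsDefect ρ s false x y) *
      ind (IsBlack s (x + 1) y)) + (1 / 4) * (ind (IsDefect ρ s false x y) *
      ind (IsBlack s (x - 1) y)) - (1 / 2) * ind (IsBlack s x y) ≤
      cellGain ρ C s false x y := by
  have b1 := ind_le_one (IsBlack s (x + 1) y)
  have b2 := ind_le_one (IsBlack s (x - 1) y)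
  by_cases hd : IsDefect ρ s false x y
  · rw [ind_of hd, ind_of_not fun h : IsBlack s x y => h.not_isDefect hd]
    by_cases hc : IsClassical s false x y
    · have := cellGain_of_classical (ρ := ρ) hC hc
      have := hd.2 hc
      linarith
    · have := cellGain_of_mixed (ρ := ρ) hC hd.1 hc
      by_cases h1 : IsBlack s (x + 1) y
      · by_cases h2 : IsBlack s (x - 1) y
        · rw [ind_of_not] at this
          · linarith
          · rw [not_not]
            have e1 : s (vEdge (x + 1) y) = some 0 := h1 .west
            have e2 : s (vEdge (x - 1 + 1) y) = some 0 := h2 .east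
            rw [sub_add_cancel] at e2
            exact ⟨by rw [show cellEdge false x y .east = vEdge (x + 1) y from rfl, e1]; simp,
              by rw [show cellEdge false x y .west = vEdge x y from rfl, e2]; simp⟩
        · rw [ind_of_not h2]
          have := ind_le_one
            (¬(s (cellEdge false x y .east) ≠ none ∧ s (cellEdge false x y .west) ≠ none))
          linarith
      · rw [ind_of_not h1]
        have := ind_le_one
          (¬(s (cellEdge false x y .east) ≠ none ∧ s (cellEdge false x y .west) ≠ none))
        linarith
  · rw [ind_of_not hd]
    by_cases ht : IsToric s false x y
    · have := cellGain_of_toric (ρ := ρ) hC ht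
      have := ind_nonneg (IsBlack s x y)
      linarith
    · obtain ⟨i, hi⟩ := not_forall.1 ht
      have hc := (isClassical_of_not_isDefect hd i hi).1
      have := cellGain_of_classical (ρ := ρ) hC hc
      have hle : sectorWeight ρ s false x y ≤ 1 + (1 / 2) * ind (IsBlack s x y) := by
        have hb0 := ind_nonneg (IsBlack s x y)
        change ρ.tileWeight _ _ _ _ ≤ _
        unfold Rows.tileWeight
        split_ifs with h1 h2
        · rw [ind_of]
          · norm_num
          · have h0 : ∀ i, colour s (cellEdge false x y i) = 0 := fun i => by
              cases i
              exacts [h1.1, h1.2.1, h1.2.2.1, h1.2.2.2]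
            exact fun i => eq_some_zero (hc i) (h0 i)
        · linarith
        · linarith
      linarith

/-- A black plaquette collects `1/4` on each side, from the defect plaquette or black star supplied
by `IsBlack.left` and `IsBlack.right`. -/
theorem black_le (x y : ℤ) : (1 / 2) * ind (IsBlack s x y) ≤
    (1 / 4) * (ind (IsDefect ρ s false (x - 1) y) * ind (IsBlack s x y)) +
    (1 / 4) * (ind (IsDefect ρ s false (x + 1) y) * ind (IsBlack s x y)) +
    (1 / 4) * ind (IsBlackStar s x y) + (1 / 4) * ind (IsBlackStar s (x + 1) y) := by
  have a1 := ind_nonneg (IsDefect ρ s false (x - 1) y)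
  have a2 := ind_nonneg (IsDefect ρ s false (x + 1) y)
  have a3 := ind_nonneg (IsBlackStar s x y)
  have a4 := ind_nonneg (IsBlackStar s (x + 1) y)
  by_cases hb : IsBlack s x y
  · rw [ind_of hb, mul_one, mul_one]
    have hl : 1 ≤ ind (IsDefect ρ s false (x - 1) y) + ind (IsBlackStar s x y) := by
      rcases hb.left (ρ := ρ) with h | h <;> rw [ind_of h] <;> linarith
    have hr : 1 ≤ ind (IsDefect ρ s false (x + 1) y) + ind (IsBlackStar s (x + 1) y) := by
      rcases hb.right (ρ := ρ) with h | h <;> rw [ind_of h] <;> linarith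
    linarith
  · rw [ind_of_not hb]
    linarith

end Gain

/-! ### A finite classical region has an energy proportional to its size -/

section FiniteGain

variable {q : ℕ}

theorem cut_self_none {s : Sector q} {e e' : Site} (h : s e = none) (h' : s e' = none) :
    cut s e e' = 0 := by simp [cut, h, h']

open Classical in
/-- The contribution of an interaction to the energy gain when all classical spins are replaced. -/
def vacancyGain (ρ : Rows q) (C : ℝ) (s : Sector q) : Interaction → ℝ
  | (.star, x, y) => cellGain ρ C s true x y - C / 2 * cellCut s true x y
  | (.plaquette, x, y) => cellGain ρ C s false x y - C / 2 * cellCut s false x y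
  | X => energy ρ C s X

theorem vacancyGain_cell (ρ : Rows q) (C : ℝ) (s : Sector q) (t : Bool) (x y : ℤ) :
    vacancyGain ρ C s (cellKind t, x, y) = cellGain ρ C s t x y - C / 2 * cellCut s t x y := by
  cases t <;> rfl

variable {s : Sector q} {D : Finset Site}

theorem isToric_vacate (hD : ∀ e, s e ≠ none ↔ e ∈ D) (t : Bool) (x y : ℤ) :
    IsToric (vacate s D) t x y := fun i => by
  by_cases h : cellEdge t x y i ∈ D
  · exact vacate_eq_none_of_mem h
  · rw [vacate_of_notMem h]
    exact not_not.1 fun h' => h ((hD _).1 h')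

/-- Since `D` holds all classical spins, filling removes every pair penalty and makes every cell
toric. -/
theorem energy_sub_fillEnergy (hD : ∀ e, s e ≠ none ↔ e ∈ D) (ρ : Rows q) (C : ℝ)
    {X : Interaction} (hX : X ∈ meeting D) :
    energy ρ C s X - fillEnergy ρ C s D X = vacancyGain ρ C s X := by
  classical
  have hv : ∀ e, vacate s D e = none := fun e => by
    by_cases h : e ∈ D
    · exact vacate_eq_none_of_mem h
    · rw [vacate_of_notMem h]
      exact not_not.1 fun h' => h ((hD _).1 h')
  have hcell : ∀ t x y, (cellKind t, x, y) ∈ meeting D →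
      energy ρ C s (cellKind t, x, y) - fillEnergy ρ C s D (cellKind t, x, y) =
        vacancyGain ρ C s (cellKind t, x, y) := by
    intro t x y hX
    have hT : ¬IsToric s t x y := by
      obtain ⟨e, he, heX⟩ := mem_meeting.1 hX
      obtain ⟨i, rfl⟩ := mem_supp_cell.1 heX
      exact fun h => (hD _).2 he (h i)
    rw [energy_cell, fillEnergy_cell, vacancyGain_cell, cellGain, if_neg hT,
      if_pos (isToric_vacate hD t x y)]
    simp only [hD]
    ring
  obtain ⟨k, x, y⟩ := X
  cases k
  · exact hcell true x y hX
  · exact hcell false x y hX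
  all_goals simp [vacancyGain, fillEnergy, energy, cut_self_none (hv _) (hv _)]

theorem vacancyGain_eq_zero (hD : ∀ e, s e ≠ none ↔ e ∈ D) (ρ : Rows q) (C : ℝ)
    {X : Interaction} (hX : X ∉ meeting D) : vacancyGain ρ C s X = 0 := by
  have hn : ∀ e ∈ supp X, s e = none := fun e he => not_not.1 fun h =>
    hX (mem_meeting.2 ⟨e, (hD e).1 h, he⟩)
  have hcell : ∀ t x y, (∀ e ∈ supp (cellKind t, x, y), s e = none) →
      vacancyGain ρ C s (cellKind t, x, y) = 0 := by
    intro t x y h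
    have hT : IsToric s t x y := fun i => h _ (mem_supp_cell.2 ⟨i, rfl⟩)
    rw [vacancyGain_cell, cellGain, if_pos hT]
    ring
  obtain ⟨k, x, y⟩ := X
  cases k
  · exact hcell true x y hn
  · exact hcell false x y hn
  all_goals
    exact (congrArg (C * ·) (cut_self_none (hn _ (by simp [supp])) (hn _ (by simp [supp])))).trans
      (mul_zero C)

/-- A function on the cells of a finite classical region is summable. -/
theorem summable_of_cell (hD : ∀ e, s e ≠ none ↔ e ∈ D) (t : Bool) {g : ℤ → ℤ → ℝ}
    (hg : ∀ x y, g x y ≠ 0 → ¬IsToric s t x y) : Summable fun p : ℤ × ℤ => g p.1 p.2 := by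
  refine summable_of_ne_finset_zero (s := (meeting D).image Prod.snd) ?_
  rintro ⟨x, y⟩ hp
  by_contra h
  obtain ⟨i, hi⟩ := not_forall.1 (hg x y h)
  exact hp (Finset.mem_image.2 ⟨(cellKind t, x, y),
    mem_meeting.2 ⟨_, (hD _).1 hi, mem_supp_cell.2 ⟨i, rfl⟩⟩, rfl⟩)

theorem summable_shift {g : ℤ → ℤ → ℝ} (hg : Summable fun p : ℤ × ℤ => g p.1 p.2) (a b : ℤ) :
    Summable fun p : ℤ × ℤ => g (p.1 + a) (p.2 + b) :=
  ((Equiv.addRight (a, b)).summable_iff (f := fun p : ℤ × ℤ => g p.1 p.2)).2 hg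

theorem tsum_shift (g : ℤ → ℤ → ℝ) (a b : ℤ) :
    ∑' p : ℤ × ℤ, g (p.1 + a) (p.2 + b) = ∑' p : ℤ × ℤ, g p.1 p.2 :=
  (Equiv.addRight (a, b)).tsum_eq fun p : ℤ × ℤ => g p.1 p.2

theorem summable_cut (hD : ∀ e, s e ≠ none ↔ e ∈ D) (t : Bool) (i j : Side) :
    Summable fun p : ℤ × ℤ => cut s (cellEdge t p.1 p.2 i) (cellEdge t p.1 p.2 j) :=
  summable_of_cell hD t fun _ _ h hT => h (cut_self_none (hT i) (hT j))

theorem summable_cellGain (hD : ∀ e, s e ≠ none ↔ e ∈ D) (ρ : Rows q) (C : ℝ) (t : Bool) :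
    Summable fun p : ℤ × ℤ => cellGain ρ C s t p.1 p.2 :=
  summable_of_cell hD t fun x y h hT => h (by
    rw [cellGain, if_pos hT, cellCut, cut_self_none (hT _) (hT _), cut_self_none (hT _) (hT _),
      cut_self_none (hT _) (hT _), cut_self_none (hT _) (hT _)]
    ring)

theorem summable_ind (hD : ∀ e, s e ≠ none ↔ e ∈ D) (t : Bool) {P : ℤ → ℤ → Prop}
    (h : ∀ x y, P x y → ¬IsToric s t x y) : Summable fun p : ℤ × ℤ => ind (P p.1 p.2) :=
  summable_of_cell (g := fun x y => ind (P x y)) hD t fun x y hne =>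
    h x y (by_contra fun hn => hne (ind_of_not hn))

theorem tsum_cellCut (hD : ∀ e, s e ≠ none ↔ e ∈ D) (t : Bool) :
    ∑' p : ℤ × ℤ, cellCut s t p.1 p.2 =
      ∑' p : ℤ × ℤ, cut s (cellEdge t p.1 p.2 .north) (cellEdge t p.1 p.2 .east) +
      ∑' p : ℤ × ℤ, cut s (cellEdge t p.1 p.2 .north) (cellEdge t p.1 p.2 .west) +
      ∑' p : ℤ × ℤ, cut s (cellEdge t p.1 p.2 .south) (cellEdge t p.1 p.2 .west) +
      ∑' p : ℤ × ℤ, cut s (cellEdge t p.1 p.2 .south) (cellEdge t p.1 p.2 .east) := by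
  have h := summable_cut hD t
  simp only [cellCut]
  rw [Summable.tsum_add (((h _ _).add (h _ _)).add (h _ _)) (h _ _),
    Summable.tsum_add ((h _ _).add (h _ _)) (h _ _), Summable.tsum_add (h _ _) (h _ _)]

/-- Each pair of neighbouring spins is a corner of one star and of one plaquette. -/
theorem tsum_cellCut_plaquette (hD : ∀ e, s e ≠ none ↔ e ∈ D) :
    ∑' p : ℤ × ℤ, cellCut s false p.1 p.2 = ∑' p : ℤ × ℤ, cellCut s true p.1 p.2 := by
  rw [tsum_cellCut hD, tsum_cellCut hD]
  have h1 := tsum_shift (fun x y => cut s (starEdge x y .south) (starEdge x y .west)) 1 1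
  have h2 := tsum_shift (fun x y => cut s (starEdge x y .south) (starEdge x y .east)) 0 1
  have h3 := tsum_shift (fun x y => cut s (starEdge x y .north) (starEdge x y .west)) 1 0
  simp only [starEdge, add_sub_cancel_right, add_zero] at h1 h2 h3
  simp only [cellEdge, starEdge, plaqEdge]
  rw [← h1, ← h2, ← h3]
  simp only [cut_comm s (vEdge _ _) (hEdge _ _)]
  ring

/-- Outside `meeting D` the gain vanishes, so the sum extends to the lattice, where translations
show that stars and plaquettes have the same total of cut corners; each takes half of the pair
penalties. -/
theorem sum_gain_eq (hD : ∀ e, s e ≠ none ↔ e ∈ D) (ρ : Rows q) (C : ℝ) :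
    ∑ X ∈ meeting D, (energy ρ C s X - fillEnergy ρ C s D X) =
      ∑' p : ℤ × ℤ, cellGain ρ C s true p.1 p.2 + ∑' p : ℤ × ℤ, cellGain ρ C s false p.1 p.2 := by
  rw [Finset.sum_congr rfl fun X hX => energy_sub_fillEnergy hD ρ C hX,
    ← tsum_eq_sum (L := .unconditional _) fun X hX => vacancyGain_eq_zero hD ρ C hX,
    (summable_of_ne_finset_zero fun X hX => vacancyGain_eq_zero hD ρ C hX).tsum_prod, tsum_fintype]
  have hu : (Finset.univ : Finset Kind) =
    {.star, .plaquette, .pairNE, .pairNW, .pairSW, .pairSE} := rfl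
  have hcut : ∀ t, Summable fun p : ℤ × ℤ => cellCut s t p.1 p.2 := fun t => by
    have h := summable_cut hD t
    exact (((h _ _).add (h _ _)).add (h _ _)).add (h _ _)
  have hcell : ∀ t, ∑' p : ℤ × ℤ, vacancyGain ρ C s (cellKind t, p) =
      ∑' p : ℤ × ℤ, cellGain ρ C s t p.1 p.2 - C / 2 * ∑' p : ℤ × ℤ, cellCut s t p.1 p.2 := by
    intro t
    rw [← tsum_mul_left, ← Summable.tsum_sub (summable_cellGain hD ρ C t) ((hcut t).mul_left _)]
    exact tsum_congr fun p => vacancyGain_cell ρ C s t p.1 p.2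
  have hpair : ∑' p : ℤ × ℤ, vacancyGain ρ C s (.pairNE, p) +
      ∑' p : ℤ × ℤ, vacancyGain ρ C s (.pairNW, p) +
      ∑' p : ℤ × ℤ, vacancyGain ρ C s (.pairSW, p) +
      ∑' p : ℤ × ℤ, vacancyGain ρ C s (.pairSE, p) =
      C * ∑' p : ℤ × ℤ, cellCut s true p.1 p.2 := by
    rw [tsum_cellCut hD, mul_add, mul_add, mul_add, ← tsum_mul_left, ← tsum_mul_left,
      ← tsum_mul_left, ← tsum_mul_left]
    rfl
  have h1 := hcell true
  have h2 := hcell false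
  rw [tsum_cellCut_plaquette hD] at h2
  simp only [cellKind] at h1 h2
  rw [hu, Finset.sum_insert (by decide), Finset.sum_insert (by decide),
    Finset.sum_insert (by decide), Finset.sum_insert (by decide), Finset.sum_insert (by decide),
    Finset.sum_singleton, h1, h2]
  linarith

theorem IsBlack.not_isToric {x y : ℤ} (h : IsBlack s x y) : ¬IsToric s false x y := fun hT => by
  have h1 : s (plaqEdge x y .north) = none := hT .north
  rw [h .north] at h1
  cases h1

theorem IsBlackStar.not_isToric {x y : ℤ} (h : IsBlackStar s x y) : ¬IsToric s true x y :=
  fun hT => by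
    have h1 : s (starEdge x y .west) = none := hT .west
    rw [h.1] at h1
    cases h1

theorem tsum_combination_le {ι : Type*} {a b c d g : ι → ℝ} {a' b' c' d' g' : ℝ}
    (ha : HasSum a a') (hb : HasSum b b') (hc : HasSum c c') (hd : HasSum d d') (hg : HasSum g g')
    (u v w z : ℝ) (h : ∀ p, u * a p + v * b p + w * c p + z * d p ≤ g p) :
    u * a' + v * b' + w * c' + z * d' ≤ g' :=
  hasSum_le h ((((ha.mul_left u).add (hb.mul_left v)).add (hc.mul_left w)).add (hd.mul_left z)) hg

/-- The energy of a finite classical region is bounded below by the number of defects. -/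
theorem defects_le_gain (hD : ∀ e, s e ≠ none ↔ e ∈ D) (ρ : Rows q) {C : ℝ} (hC : 1 ≤ C) :
    (1 / 4) * (∑' p : ℤ × ℤ, ind (IsDefect ρ s true p.1 p.2) +
      ∑' p : ℤ × ℤ, ind (IsDefect ρ s false p.1 p.2)) ≤
      ∑ X ∈ meeting D, (energy ρ C s X - fillEnergy ρ C s D X) := by
  rw [sum_gain_eq hD]
  have sd : ∀ t, Summable fun p : ℤ × ℤ => ind (IsDefect ρ s t p.1 p.2) := fun t =>
    summable_ind hD t fun x y h => h.1
  have sb := summable_ind (s := s) (P := IsBlack s) hD false fun x y h => h.not_isToric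
  have ss := summable_ind (s := s) (P := IsBlackStar s) hD true fun x y h => h.not_isToric
  have sdb : ∀ a, Summable fun p : ℤ × ℤ =>
      ind (IsDefect ρ s false p.1 p.2) * ind (IsBlack s (p.1 + a) p.2) := fun a =>
    summable_of_cell (g := fun x y => ind (IsDefect ρ s false x y) * ind (IsBlack s (x + a) y))
      hD false fun x y hne hT => hne (by
        rw [ind_of_not fun h : IsDefect ρ s false x y => h.1 hT, zero_mul])
  have eb : ∀ a, ∑' p : ℤ × ℤ,
      ind (IsDefect ρ s false (p.1 + a) p.2) * ind (IsBlack s p.1 p.2) = ∑' p : ℤ × ℤ,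
      ind (IsDefect ρ s false p.1 p.2) * ind (IsBlack s (p.1 + -a) p.2) := fun a => by
    have := tsum_shift (fun x y => ind (IsDefect ρ s false x y) * ind (IsBlack s (x + -a) y)) a 0
    simpa only [add_neg_cancel_right, add_zero] using this
  have sbd : ∀ a, Summable fun p : ℤ × ℤ =>
      ind (IsDefect ρ s false (p.1 + a) p.2) * ind (IsBlack s p.1 p.2) := fun a =>
    summable_of_cell (g := fun x y => ind (IsDefect ρ s false (x + a) y) * ind (IsBlack s x y))
      hD false fun x y hne hT => hne (by
        rw [ind_of_not fun h : IsBlack s x y => h.not_isToric hT, mul_zero])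
  have ess : ∑' p : ℤ × ℤ, ind (IsBlackStar s (p.1 + 1) p.2) =
      ∑' p : ℤ × ℤ, ind (IsBlackStar s p.1 p.2) := by
    have := tsum_shift (fun x y => ind (IsBlackStar s x y)) 1 0
    simpa only [add_zero] using this
  have sss : Summable fun p : ℤ × ℤ => ind (IsBlackStar s (p.1 + 1) p.2) := by
    have := summable_shift (g := fun x y => ind (IsBlackStar s x y)) ss 1 0
    simpa only [add_zero] using this
  -- The summands with coefficient `0` only pad the four slots.
  have i1 := tsum_combination_le ((sd true).hasSum) ss.hasSum ss.hasSum ss.hasSum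
    (summable_cellGain hD ρ C true).hasSum (1 / 4) (1 / 2) 0 0 fun p => by
      have := starGain_ge (ρ := ρ) (s := s) hC p.1 p.2
      linarith
  have i2 := tsum_combination_le ((sd false).hasSum) (sdb 1).hasSum (sdb (-1)).hasSum sb.hasSum
    (summable_cellGain hD ρ C false).hasSum (1 / 4) (1 / 4) (1 / 4) (-1 / 2) fun p => by
      have := plaqGain_ge (ρ := ρ) (s := s) hC p.1 p.2
      rw [sub_eq_add_neg p.1] at this
      linarith
  -- Multiplied by `4`, which leaves a bare indicator on the right.
  have i3 := tsum_combination_le sb.hasSum (sbd (-1)).hasSum (sbd 1).hasSum ss.hasSum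
    sss.hasSum (1 / 2 * 4) (-1 / 4 * 4) (-1 / 4 * 4) (-1 / 4 * 4) fun p => by
      have := black_le (ρ := ρ) (s := s) p.1 p.2
      rw [sub_eq_add_neg p.1] at this
      linarith
  -- After reindexing by donors, the amounts paid by defects and black stars match those received by
  -- black plaquettes.
  rw [ess, eb, eb, neg_neg] at i3
  linarith

/-- A finite classical region has an energy proportional to the number of its spins. -/
theorem card_le_gain (hD : ∀ e, s e ≠ none ↔ e ∈ D) (ρ : Rows q) {C : ℝ} (hC : 1 ≤ C) :
    (D.card : ℝ) ≤ 8 * ((ρ.blockSize : ℝ) + 2) ^ 2 *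
      ∑ X ∈ meeting D, (energy ρ C s X - fillEnergy ρ C s D X) := by
  set n := ρ.blockSize with hn
  set B := Finset.range (n + 2) ×ˢ Finset.range (n + 2) with hB
  have sd : ∀ t, Summable fun p : ℤ × ℤ => ind (IsDefect ρ s t p.1 p.2) := fun t =>
    summable_ind hD t fun x y h => h.1
  set S : Bool → ℝ := fun t => ∑' p : ℤ × ℤ, ind (IsDefect ρ s t p.1 p.2) with hS
  have hone : ∀ e ∈ D, (1 : ℝ) ≤ ∑ ij ∈ B, ∑ t : Bool,
      ind (IsDefect ρ s t (e.2.1 + ij.1) (e.2.2 + ij.2)) := by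
    intro e he
    obtain ⟨t, x, y, hdef, h1, h2, h3, h4⟩ := exists_defect_near ρ ((hD e).2 he)
    have hmem : ((x - e.2.1).toNat, (y - e.2.2).toNat) ∈ B := by
      rw [hB, Finset.mem_product, Finset.mem_range, Finset.mem_range]
      constructor <;> dsimp only <;> omega
    refine le_trans ?_ (Finset.single_le_sum
      (fun ij _ => Finset.sum_nonneg fun t _ => ind_nonneg _) hmem)
    refine le_trans ?_ (Finset.single_le_sum (fun t _ => ind_nonneg _) (Finset.mem_univ t))
    dsimp only
    rw [Int.toNat_of_nonneg (by omega), Int.toNat_of_nonneg (by omega), add_sub_cancel,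
      add_sub_cancel, ind_of hdef]
  -- The factor `2` counts the horizontal and the vertical spin with the same coordinates; with the
  -- `1/4` of `defects_le_gain` it makes the constant `8`.
  have hcol : ∀ (ij : ℕ × ℕ) t, ∑ e ∈ D, ind (IsDefect ρ s t (e.2.1 + ij.1) (e.2.2 + ij.2)) ≤
      2 * S t := by
    intro ij t
    have hsum := summable_shift (g := fun x y => ind (IsDefect ρ s t x y)) (sd t) ij.1 ij.2
    have hle : ∑ p ∈ D.image Prod.snd, ind (IsDefect ρ s t (p.1 + ij.1) (p.2 + ij.2)) ≤ S t := by
      refine (hsum.sum_le_tsum _ fun p _ => ind_nonneg _).trans_eq ?_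
      exact tsum_shift (fun x y => ind (IsDefect ρ s t x y)) ij.1 ij.2
    calc _ ≤ ∑ e ∈ (Finset.univ : Finset Bool) ×ˢ D.image Prod.snd,
          ind (IsDefect ρ s t (e.2.1 + ij.1) (e.2.2 + ij.2)) := by
          refine Finset.sum_le_sum_of_subset_of_nonneg (fun e he => ?_) fun _ _ _ => ind_nonneg _
          exact Finset.mem_product.2 ⟨Finset.mem_univ _, Finset.mem_image_of_mem _ he⟩
      _ = 2 * ∑ p ∈ D.image Prod.snd, ind (IsDefect ρ s t (p.1 + ij.1) (p.2 + ij.2)) := by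
          rw [Finset.sum_product, Fintype.sum_bool]
          ring
      _ ≤ _ := by linarith
  have hmain : (D.card : ℝ) ≤ (n + 2) ^ 2 * (2 * (S true + S false)) := by
    calc (D.card : ℝ) = ∑ e ∈ D, (1 : ℝ) := by simp
      _ ≤ ∑ e ∈ D, ∑ ij ∈ B, ∑ t : Bool,
          ind (IsDefect ρ s t (e.2.1 + ij.1) (e.2.2 + ij.2)) := Finset.sum_le_sum hone
      _ = ∑ ij ∈ B, ∑ t : Bool, ∑ e ∈ D,
          ind (IsDefect ρ s t (e.2.1 + ij.1) (e.2.2 + ij.2)) := by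
          rw [Finset.sum_comm]
          exact Finset.sum_congr rfl fun ij _ => Finset.sum_comm
      _ ≤ ∑ ij ∈ B, ∑ t : Bool, 2 * S t :=
          Finset.sum_le_sum fun ij _ => Finset.sum_le_sum fun t _ => hcol ij t
      _ = _ := by
          rw [Finset.sum_const, hB, Finset.card_product, Finset.card_range, Fintype.sum_bool,
            nsmul_eq_mul]
          push_cast
          ring
  have hdef := defects_le_gain hD ρ hC
  have hpos : (0 : ℝ) ≤ ((n : ℝ) + 2) ^ 2 := by positivity
  have := mul_le_mul_of_nonneg_left hdef hpos
  change ((n : ℝ) + 2) ^ 2 * (1 / 4 * (S true + S false)) ≤ _ at this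
  linarith

end FiniteGain

/-! ### Boxes of spins -/

section Boxes

/-- The spins in a square around the spin `e₀`. -/
def box (e₀ : Site) (k : ℕ) : Finset Site :=
  Finset.univ ×ˢ (Finset.Icc (e₀.2.1 - k) (e₀.2.1 + k) ×ˢ Finset.Icc (e₀.2.2 - k) (e₀.2.2 + k))

theorem mem_box {e₀ e : Site} {k : ℕ} : e ∈ box e₀ k ↔
    (e₀.2.1 - k ≤ e.2.1 ∧ e.2.1 ≤ e₀.2.1 + k) ∧ e₀.2.2 - k ≤ e.2.2 ∧ e.2.2 ≤ e₀.2.2 + k := by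
  simp only [box, Finset.mem_product, Finset.mem_univ, Finset.mem_Icc, true_and]

theorem card_box (e₀ : Site) (k : ℕ) : (box e₀ k).card = 2 * (2 * k + 1) ^ 2 := by
  have h : ∀ a : ℤ, (a + k + 1 - (a - k)).toNat = 2 * k + 1 := fun a => by omega
  rw [box, Finset.card_product, Finset.card_product, Int.card_Icc, Int.card_Icc, h, h]
  simp only [Finset.card_univ, Fintype.card_bool]
  ring

theorem box_mono {e₀ : Site} {k l : ℕ} (h : k ≤ l) : box e₀ k ⊆ box e₀ l := fun e he => by
  rw [mem_box] at he ⊢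
  omega

theorem near_of_mem_supp {X : Interaction} {e e' : Site} (h : e ∈ supp X) (h' : e' ∈ supp X) :
    e'.2.1 ≤ e.2.1 + 1 ∧ e'.2.2 ≤ e.2.2 + 1 := by
  obtain ⟨k, x, y⟩ := X
  obtain ⟨b, u, v⟩ := e
  obtain ⟨b', u', v'⟩ := e'
  cases k <;>
    simp only [supp, plaqEdge, starEdge, hEdge, vEdge, Finset.mem_insert, Finset.mem_singleton,
      Prod.mk.injEq] at h h' <;> dsimp only <;> omega

theorem mem_box_succ {e₀ e e' : Site} {k : ℕ} {X : Interaction} (h : e ∈ supp X)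
    (h' : e' ∈ supp X) (he : e ∈ box e₀ k) : e' ∈ box e₀ (k + 1) := by
  have h1 := near_of_mem_supp h h'
  have h2 := near_of_mem_supp h' h
  rw [mem_box] at he ⊢
  push_cast
  omega

/-- Six kinds of interaction at nine positions around each spin. -/
theorem card_meeting_le (R : Finset Site) : (meeting R).card ≤ 54 * R.card := by
  refine (Finset.card_le_card (Finset.filter_subset _ _)).trans ?_
  refine (Finset.card_biUnion_le_card_mul R _ 54 fun e _ => ?_).trans_eq (mul_comm _ _)
  have h : ∀ a : ℤ, (a + 1 + 1 - (a - 1)).toNat = 3 := fun a => by omega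
  rw [Finset.card_product, Finset.card_product, Int.card_Icc, Int.card_Icc, h, h]
  exact le_of_eq rfl

end Boxes

/-! ### Growth of classical regions whose energy cannot be lowered -/

section Growth

variable {q : ℕ} {ρ : Rows q} {C : ℝ}

theorem cut_nonneg (s : Sector q) (e e' : Site) : 0 ≤ cut s e e' := by
  unfold cut; split_ifs <;> norm_num

theorem cut_le_one (s : Sector q) (e e' : Site) : cut s e e' ≤ 1 := by
  unfold cut; split_ifs <;> norm_num

theorem cut_congr {s s' : Sector q} {e e' : Site} (h : s e = s' e) (h' : s e' = s' e') :
    cut s e e' = cut s' e e' := by rw [cut, cut, h, h']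

theorem exists_cell (X : Interaction) :
    (∃ t x y, X = (cellKind t, x, y)) ∨ (X.1 ≠ .star ∧ X.1 ≠ .plaquette) := by
  obtain ⟨k, x, y⟩ := X
  cases k
  · exact Or.inl ⟨true, x, y, rfl⟩
  · exact Or.inl ⟨false, x, y, rfl⟩
  all_goals simp

theorem sectorWeight_le (s : Sector q) (t : Bool) (x y : ℤ) : sectorWeight ρ s t x y ≤ 3 / 2 := by
  cases t
  · change ρ.tileWeight _ _ _ _ ≤ _
    unfold Rows.tileWeight
    split_ifs <;> norm_num
  · change ρ.starWeight _ _ _ _ ≤ _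
    unfold Rows.starWeight
    split_ifs <;> norm_num

theorem neg_half_le_energy (hC : 0 ≤ C) (s : Sector q) (X : Interaction) :
    -(1 / 2) ≤ energy ρ C s X := by
  have hp : ∀ e e', -(1 / 2) ≤ C * cut s e e' := fun e e' => by
    have := mul_nonneg hC (cut_nonneg s e e')
    linarith
  have hc : ∀ t x y, -(1 / 2) ≤ cellEnergy ρ s t x y := fun t x y => by
    have := sectorWeight_le (ρ := ρ) s t x y
    unfold cellEnergy
    split_ifs <;> linarith
  obtain ⟨k, x, y⟩ := X
  cases k
  exacts [hc _ _ _, hc _ _ _, hp _ _, hp _ _, hp _ _, hp _ _]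

theorem energy_le_of_none (hC : 0 ≤ C) {s : Sector q} {X : Interaction} {e : Site}
    (he : e ∈ supp X) (hs : s e = none) : energy ρ C s X ≤ C := by
  have hp : ∀ e e', C * cut s e e' ≤ C := fun e e' =>
    mul_le_of_le_one_right hC (cut_le_one s e e')
  rcases exists_cell X with ⟨t, x, y, rfl⟩ | h
  · obtain ⟨i, rfl⟩ := mem_supp_cell.1 he
    rw [energy_cell, cellEnergy, if_neg fun h => h i hs]
    exact hC
  · obtain ⟨k, x, y⟩ := X
    cases k
    · exact absurd rfl h.1
    · exact absurd rfl h.2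
    exacts [hp _ _, hp _ _, hp _ _, hp _ _]

theorem fillEnergy_nonneg (hC : 0 ≤ C) (s : Sector q) (D : Finset Site) (X : Interaction) :
    0 ≤ fillEnergy ρ C s D X := by
  rcases exists_cell X with ⟨t, x, y, rfl⟩ | h
  · rw [fillEnergy_cell]
    split_ifs <;> norm_num
  · obtain ⟨k, x, y⟩ := X
    cases k
    · exact absurd rfl h.1
    · exact absurd rfl h.2
    all_goals exact mul_nonneg hC (cut_nonneg _ _ _)

theorem fillEnergy_le (hC : 1 ≤ C) (s : Sector q) (D : Finset Site) (X : Interaction) :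
    fillEnergy ρ C s D X ≤ C := by
  rcases exists_cell X with ⟨t, x, y, rfl⟩ | h
  · rw [fillEnergy_cell]
    split_ifs <;> linarith
  · obtain ⟨k, x, y⟩ := X
    cases k
    · exact absurd rfl h.1
    · exact absurd rfl h.2
    all_goals exact mul_le_of_le_one_right (by linarith) (cut_le_one _ _ _)

theorem energy_congr {s s' : Sector q} {X : Interaction} (h : ∀ e ∈ supp X, s e = s' e) :
    energy ρ C s X = energy ρ C s' X := by
  rcases exists_cell X with ⟨t, x, y, rfl⟩ | hk
  · have hi : ∀ i, s (cellEdge t x y i) = s' (cellEdge t x y i) := fun i =>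
      h _ (mem_supp_cell.2 ⟨i, rfl⟩)
    have hcl : IsClassical s t x y ↔ IsClassical s' t x y := forall_congr' fun i => by rw [hi]
    simp only [energy_cell, cellEnergy, sectorWeight, colour, hi]
    by_cases h' : IsClassical s' t x y
    · rw [if_pos h', if_pos (hcl.2 h')]
    · rw [if_neg h', if_neg fun h => h' (hcl.1 h)]
  · obtain ⟨k, x, y⟩ := X
    cases k
    · exact absurd rfl hk.1
    · exact absurd rfl hk.2
    all_goals
      exact congrArg (C * ·) (cut_congr (h _ (by simp [supp])) (h _ (by simp [supp])))

theorem fillEnergy_congr {s s' : Sector q} {D : Finset Site} {X : Interaction}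
    (h : ∀ e ∈ supp X, s e = s' e) : fillEnergy ρ C s D X = fillEnergy ρ C s' D X := by
  have hv : ∀ e ∈ supp X, vacate s D e = vacate s' D e := fun e he => by
    simp only [vacate, h e he]
  rcases exists_cell X with ⟨t, x, y, rfl⟩ | hk
  · have hi : ∀ i, vacate s D (cellEdge t x y i) = vacate s' D (cellEdge t x y i) := fun i =>
      hv _ (mem_supp_cell.2 ⟨i, rfl⟩)
    have ht : IsToric (vacate s D) t x y ↔ IsToric (vacate s' D) t x y :=
      forall_congr' fun i => by rw [hi]
    simp only [fillEnergy_cell]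
    by_cases h' : IsToric (vacate s' D) t x y
    · rw [if_pos h', if_pos (ht.2 h')]
    · rw [if_neg h', if_neg fun h => h' (ht.1 h)]
  · obtain ⟨k, x, y⟩ := X
    cases k
    · exact absurd rfl hk.1
    · exact absurd rfl hk.2
    all_goals
      exact congrArg (C * ·) (cut_congr (hv _ (by simp [supp])) (hv _ (by simp [supp])))

open Classical in
/-- The classical spins in a box. -/
def classicalIn (s : Sector q) (e₀ : Site) (k : ℕ) : Finset Site :=
  (box e₀ k).filter fun e => s e ≠ none

theorem mem_classicalIn {s : Sector q} {e₀ e : Site} {k : ℕ} :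
    e ∈ classicalIn s e₀ k ↔ e ∈ box e₀ k ∧ s e ≠ none := by
  simp only [classicalIn, Finset.mem_filter]

theorem classicalIn_mono (s : Sector q) (e₀ : Site) {k l : ℕ} (h : k ≤ l) :
    classicalIn s e₀ k ⊆ classicalIn s e₀ l := fun e he => by
  rw [mem_classicalIn] at he ⊢
  exact ⟨box_mono h he.1, he.2⟩

/-- The energy of the classical spins in a box is bounded by their number, up to a boundary
term. -/
theorem card_classicalIn_le (s : Sector q) (e₀ : Site) (k : ℕ) (hC : 1 ≤ C) :
    ((classicalIn s e₀ (k + 1)).card : ℝ) ≤ 8 * ((ρ.blockSize : ℝ) + 2) ^ 2 *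
      (∑ X ∈ meeting (classicalIn s e₀ (k + 1)),
        (energy ρ C s X - fillEnergy ρ C s (classicalIn s e₀ (k + 1)) X) +
      162 * C * ((classicalIn s e₀ (k + 1)).card - (classicalIn s e₀ k).card)) := by
  classical
  set D := classicalIn s e₀ (k + 1) with hDdef
  -- Outside the box the sector is emptied, so that `card_le_gain` applies.
  set s' : Sector q := fun e => if e ∈ box e₀ (k + 1) then s e else none with hs'
  have hD : ∀ e, s' e ≠ none ↔ e ∈ D := fun e => by
    rw [hDdef, mem_classicalIn]
    simp only [hs']
    split_ifs with h <;> simp [h]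
  have hin : ∀ e ∈ box e₀ (k + 1), s e = s' e := fun e he => (if_pos he).symm
  refine (card_le_gain hD ρ hC).trans (mul_le_mul_of_nonneg_left ?_ (by positivity))
  set M := (meeting D).filter fun X => ¬supp X ⊆ box e₀ (k + 1) with hM
  -- Only interactions that leave the box are affected, each by at most `C + 1/2 + C ≤ 3 * C`.
  have hterm : ∀ X ∈ meeting D, energy ρ C s' X - fillEnergy ρ C s' D X ≤
      (energy ρ C s X - fillEnergy ρ C s D X) +
        if ¬supp X ⊆ box e₀ (k + 1) then 3 * C else 0 := by
    intro X hX
    by_cases h : supp X ⊆ box e₀ (k + 1)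
    swap
    · rw [if_pos h]
      obtain ⟨e, he, hout⟩ := Finset.not_subset.1 h
      have h0 : s' e = none := if_neg hout
      have h1 := energy_le_of_none (ρ := ρ) (show 0 ≤ C by linarith) he h0
      have h2 := fillEnergy_nonneg (ρ := ρ) (show 0 ≤ C by linarith) s' D X
      have h3 := neg_half_le_energy (ρ := ρ) (show 0 ≤ C by linarith) s X
      have h4 := fillEnergy_le (ρ := ρ) hC s D X
      linarith
    · rw [energy_congr fun e he => hin e (h he), fillEnergy_congr fun e he => hin e (h he),
        if_neg (not_not.2 h), add_zero]
  refine (Finset.sum_le_sum hterm).trans ?_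
  rw [Finset.sum_add_distrib]
  refine add_le_add_right ?_ _
  rw [← Finset.sum_filter, Finset.sum_const, nsmul_eq_mul]
  -- An interaction that leaves the larger box cannot touch the smaller one, so it meets a newly
  -- added classical spin. The constant is `162 = 54 * 3`.
  have hsub : M ⊆ meeting (D \ classicalIn s e₀ k) := by
    intro X hX
    rw [hM, Finset.mem_filter] at hX
    obtain ⟨e, he, heX⟩ := mem_meeting.1 hX.1
    obtain ⟨e', he', hout⟩ := Finset.not_subset.1 hX.2
    refine mem_meeting.2 ⟨e, Finset.mem_sdiff.2 ⟨he, fun h => hout ?_⟩, heX⟩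
    exact mem_box_succ heX he' (mem_classicalIn.1 h).1
  have hcard := (Finset.card_le_card hsub).trans (card_meeting_le _)
  rw [Finset.card_sdiff_of_subset (classicalIn_mono s e₀ (Nat.le_succ k))] at hcard
  have hle := Finset.card_le_card (classicalIn_mono s e₀ (Nat.le_succ k))
  have hcard' : (M.card : ℝ) ≤ 54 * ((D.card : ℝ) - (classicalIn s e₀ k).card) := by
    have : (M.card : ℝ) ≤ ((54 * (D.card - (classicalIn s e₀ k).card) : ℕ) : ℝ) := by
      exact_mod_cast hcard
    rwa [Nat.cast_mul, Nat.cast_sub hle, Nat.cast_ofNat] at this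
  nlinarith

/-- Within a distance that does not depend on the sector there is a set of classical spins, the
removal of which lowers the energy. -/
theorem exists_gain (ρ : Rows q) (hC : 1 ≤ C) : ∃ K : ℕ, ∀ (s : Sector q) (e₀ : Site),
    s e₀ ≠ none → ∃ k ≤ K, 0 < ∑ X ∈ meeting (classicalIn s e₀ k),
      (energy ρ C s X - fillEnergy ρ C s (classicalIn s e₀ k) X) := by
  set κ : ℝ := 8 * ((ρ.blockSize : ℝ) + 2) ^ 2 * (162 * C) with hκ
  have hκ1 : 1 < κ := by
    have h0 : (0 : ℝ) ≤ ρ.blockSize := Nat.cast_nonneg _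
    have h1 : (4 : ℝ) ≤ ((ρ.blockSize : ℝ) + 2) ^ 2 := by nlinarith
    nlinarith
  set r : ℝ := 1 - 1 / κ with hr
  have hinv : 0 < 1 / κ ∧ 1 / κ < 1 :=
    ⟨by positivity, by rw [div_lt_one (by linarith)]; exact hκ1⟩
  have hr0 : 0 ≤ r := by linarith [hinv.2]
  have hr1 : r < 1 := by linarith [hinv.1]
  -- A box of radius `k ≥ 1` has at most `18 * k ^ 2` spins, which cannot keep up with growth by the
  -- factor `1 / r`; the resulting `K` depends on `κ` only.
  have hlim : Filter.Tendsto (fun k : ℕ => 18 * ((k : ℝ) ^ 2 * r ^ k)) Filter.atTop (𝓝 0) := by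
    simpa using (tendsto_pow_const_mul_const_pow_of_abs_lt_one 2
      (by rwa [abs_of_nonneg hr0])).const_mul (18 : ℝ)
  obtain ⟨K, hK1, hK⟩ := ((hlim.eventually (gt_mem_nhds one_pos)).and
    (Filter.eventually_ge_atTop 1)).exists
  refine ⟨K, fun s e₀ h₀ => ?_⟩
  by_contra hno
  push Not at hno
  set n : ℕ → ℝ := fun k => (classicalIn s e₀ k).card with hn
  -- With no gain at radius `k + 1`, only the boundary term bounds the number of classical spins, so
  -- a fixed fraction of them is new.
  have hstep : ∀ k, k + 1 ≤ K → n k ≤ r * n (k + 1) := by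
    intro k hk
    have h1 := card_classicalIn_le (ρ := ρ) s e₀ k hC
    have h2 := mul_le_mul_of_nonneg_left (hno (k + 1) hk)
      (show 0 ≤ 8 * ((ρ.blockSize : ℝ) + 2) ^ 2 by positivity)
    have h3 : n (k + 1) ≤ κ * (n (k + 1) - n k) := by
      rw [hκ]
      change n (k + 1) ≤ _ at h1
      rw [mul_add] at h1
      refine h1.trans ?_
      rw [mul_zero] at h2
      have : 8 * ((ρ.blockSize : ℝ) + 2) ^ 2 * (162 * C * (n (k + 1) - n k)) =
        8 * ((ρ.blockSize : ℝ) + 2) ^ 2 * (162 * C) * (n (k + 1) - n k) := by ring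
      change _ + 8 * ((ρ.blockSize : ℝ) + 2) ^ 2 * (162 * C * (n (k + 1) - n k)) ≤ _
      linarith
    have h4 : 1 / κ * n (k + 1) ≤ n (k + 1) - n k := by
      rw [one_div, inv_mul_le_iff₀ (by linarith)]
      exact h3
    rw [hr]
    linarith
  have hgrow : ∀ k ≤ K, 1 ≤ r ^ k * n k := by
    intro k
    induction k with
    | zero =>
      intro _
      rw [pow_zero, one_mul]
      have h1 : 1 ≤ (classicalIn s e₀ 0).card :=
        Finset.card_pos.2 ⟨e₀, mem_classicalIn.2 ⟨mem_box.2 (by simp), h₀⟩⟩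
      exact Nat.one_le_cast.2 h1
    | succ k ih =>
      intro hk
      have h1 := mul_le_mul_of_nonneg_left (hstep k hk) (pow_nonneg hr0 k)
      rw [pow_succ, mul_assoc]
      exact (ih (by omega)).trans h1
  have hbound : n K ≤ 18 * (K : ℝ) ^ 2 := by
    have h1 : (classicalIn s e₀ K).card ≤ 2 * (2 * K + 1) ^ 2 :=
      (Finset.card_le_card (Finset.filter_subset _ _)).trans_eq (card_box e₀ K)
    have h2 : 2 * (2 * K + 1) ^ 2 ≤ 18 * K ^ 2 := by nlinarith
    have h3 : ((classicalIn s e₀ K).card : ℝ) ≤ ((18 * K ^ 2 : ℕ) : ℝ) :=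
      Nat.cast_le.2 (h1.trans h2)
    rwa [Nat.cast_mul, Nat.cast_pow, Nat.cast_ofNat] at h3
  have h1 := hgrow K le_rfl
  have h2 := mul_le_mul_of_nonneg_left hbound (pow_nonneg hr0 K)
  linarith

end Growth

/-! ### Ground states are supported in the Toric Code subspace -/

section Support

variable {q : ℕ}

/-- The Cauchy–Schwarz inequality for null vectors of a state. -/
theorem State.mul_null {ω : State q} {Q : QL q} (h : ω.toLin (star Q * Q) = 0) (Y : QL q) :
    ω.toLin (Y * Q) = 0 := by
  have hpos : ∀ c : ℂ, 0 ≤ ω.toLin (Y * star Y) + c * ω.toLin (Y * Q) +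
      star c * ω.toLin (star Q * star Y) := fun c => by
    have h1 := ω.nonneg (star Y + c • Q)
    have h2 : star (star Y + c • Q) * (star Y + c • Q) =
        Y * star Y + c • (Y * Q) + star c • (star Q * star Y) +
          (star c * c) • (star Q * Q) := by
      rw [star_add, star_star, star_smul, add_mul, mul_add, mul_add, mul_smul_comm,
        smul_mul_assoc, smul_mul_assoc, mul_smul_comm, smul_smul, add_assoc, add_assoc, add_assoc]
    rwa [h2, map_add, map_add, map_add, map_smul, map_smul, map_smul, h, smul_zero, add_zero,
      smul_eq_mul, smul_eq_mul] at h1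
  set A := ω.toLin (Y * star Y) with hA
  set z := ω.toLin (Y * Q) with hz
  set w := ω.toLin (star Q * star Y) with hw
  by_contra hne
  -- The multipliers `0`, `1` and `I` show that the two mixed terms are conjugate.
  have h0 := Complex.nonneg_iff.1 (hpos 0)
  have h1 := Complex.nonneg_iff.1 (hpos 1)
  have hI := Complex.nonneg_iff.1 (hpos Complex.I)
  simp at h0 h1 hI
  have hconj : w = star z := Complex.ext (by simp; linarith) (by simp; linarith)
  -- This multiplier makes each mixed term `-(A.re + 1)`, so the total real part is negative.
  have hc := (Complex.nonneg_iff.1 (hpos (-((A.re + 1 : ℝ) : ℂ) / z))).1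
  rw [hconj, ← star_mul', div_mul_cancel₀ _ hne] at hc
  simp at hc
  linarith

/-- Summing over the possible sectors of a spin. -/
theorem sectorProj_eq_sum (s : Sector q) {Λ : Finset Site} {e : Site} (he : e ∉ Λ) :
    sectorProj s Λ = ∑ o, sectorProj (Function.update s e o) (insert e Λ) := by
  have h1 : ∀ o, sectorProj (Function.update s e o) (insert e Λ) = siteProj o e * sectorProj s Λ :=
    fun o => by
      rw [sectorProj_update s (Finset.mem_insert_self e Λ), Finset.erase_insert he]
  have h2 : ∑ o : Option (Fin (q + 1)), (siteProj o e : QL q) = 1 := by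
    rw [Fintype.sum_option]
    exact tcProj_add_clProj e
  rw [Finset.sum_congr rfl fun o _ => h1 o, ← Finset.sum_mul, h2, one_mul]

/-- A sector projector is the sum of its refinements; the spins of `T` are added one at a time, and
`e₀` keeps its value. -/
theorem null_of_union {ω : State q} {e₀ : Site} (T : Finset Site) : ∀ Λ : Finset Site, e₀ ∈ Λ →
    (∀ s : Sector q, s e₀ ≠ none → ω.toLin (sectorProj s (Λ ∪ T)) = 0) →
    ∀ s : Sector q, s e₀ ≠ none → ω.toLin (sectorProj s Λ) = 0 := by
  induction T using Finset.induction_on with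
  | empty =>
    intro Λ _ h
    rwa [Finset.union_empty] at h
  | insert e T _ ih =>
    intro Λ h₀ h s hs
    by_cases he : e ∈ Λ
    · refine ih Λ h₀ (fun s hs => ?_) s hs
      have := h s hs
      rwa [Finset.union_insert, Finset.insert_eq_of_mem (Finset.mem_union_left T he)] at this
    · rw [sectorProj_eq_sum s he, map_sum]
      refine Finset.sum_eq_zero fun o _ => ih (insert e Λ) (Finset.mem_insert_of_mem h₀) ?_ _ ?_
      · rw [Finset.insert_union, ← Finset.union_insert]
        exact h
      · rwa [Function.update_of_ne]
        rintro rfl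
        exact he h₀

variable {ρ : Rows q} {J ε C : ℝ} {ω : State q}

/-- The radius in `exists_gain` is uniform, so one box serves all sectors that are classical at
`e₀`. Each is null by `sector_null`, and their sum is the classical projector at `e₀`. -/
theorem clProj_null (hJ : 0 < J) (hεJ : ε ≤ J) (hε : ε ≤ 1 / 2) (hC : 1 ≤ C)
    (hω : IsGroundState (interaction ρ J ε C) ω) (e₀ : Site) : ω.toLin (clProj e₀) = 0 := by
  obtain ⟨K, hK⟩ := exists_gain ρ hC
  have hnull : ∀ s : Sector q, s e₀ ≠ none → ω.toLin (sectorProj s (box e₀ (K + 1))) = 0 := by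
    intro s hs
    obtain ⟨k, hk, hgain⟩ := hK s e₀ hs
    refine sector_null (fun e he => (mem_classicalIn.1 he).2) (fun X hX e' he' => ?_) hJ hεJ hε hω
      hgain
    obtain ⟨e, he, heX⟩ := mem_meeting.1 hX
    exact mem_box_succ heX he' (box_mono hk (mem_classicalIn.1 he).1)
  have h1 := null_of_union (box e₀ (K + 1)) {e₀} (Finset.mem_singleton_self e₀) (fun s hs => by
    rw [Finset.union_eq_right.2 (Finset.singleton_subset_iff.2 (mem_box.2 (by
      constructor <;> constructor <;> omega)))]
    exact hnull s hs)
  rw [clProj, map_sum]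
  refine Finset.sum_eq_zero fun c _ => ?_
  have h2 := h1 (fun _ => some c) (by simp)
  rwa [← insert_empty_eq, sectorProj_insert _ (Finset.notMem_empty _), sectorProj_empty,
    mul_one] at h2

/-- Every ground state is fully supported in the Toric Code subspace. -/
theorem isFullyTC_of_isGroundState (hJ : 0 < J) (hεJ : ε ≤ J) (hε : ε ≤ 1 / 2) (hC : 1 ≤ C)
    (hω : IsGroundState (interaction ρ J ε C) ω) : IsFullyTC ω := by
  intro Λ
  have hY : ∀ e Y, ω.toLin (Y * clProj e) = 0 := fun e Y => by
    refine State.mul_null ?_ Y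
    have h1 : star (clProj e : QL q) * clProj e = clProj e := by
      rw [clProj_eq, star_sub, star_one, star_tcProj, sub_mul, mul_sub, mul_sub, tcProj_mul_self,
        one_mul, one_mul, mul_one, sub_self, sub_zero]
    rw [h1]
    exact clProj_null hJ hεJ hε hC hω e
  rw [tcRegion_eq_sectorProj]
  induction Λ using Finset.induction_on with
  | empty => rw [sectorProj_empty, sub_self, map_zero]
  | insert e Λ he ih =>
    have h1 : (1 : QL q) - sectorProj (fun _ => none) (insert e Λ) =
        (1 - sectorProj (fun _ => none) Λ) + sectorProj (fun _ => none) Λ * clProj e := by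
      rw [sectorProj_insert _ he, (siteProj_commute_sectorProj _ Λ _ e).eq, clProj_eq, mul_sub,
        mul_one]
      simp only [siteProj]
      abel
    rw [h1, map_add, ih, hY, add_zero]

end Support

/-! ### Gibbs states on finite-dimensional subspaces -/

section Spectral

variable {E : Type*} [NormedAddCommGroup E] [InnerProductSpace ℂ E]

theorem exp_apply_of_eigenvector [CompleteSpace E] {T : E →L[ℂ] E} {c : ℂ} {v : E} (h : T v = c • v) :
    NormedSpace.exp T v = Complex.exp c • v := by
  have hpow : ∀ n : ℕ, (T ^ n) v = c ^ n • v := fun n => by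
    induction n with
    | zero => simp
    | succ n ih =>
      rw [pow_succ, mul_apply_eq_comp, h, map_smul, ih, smul_smul, pow_succ, mul_comm]
  have h1 := (NormedSpace.exp_series_hasSum_exp' (𝕂 := ℂ) T).mapL (ContinuousLinearMap.apply ℂ E v)
  have h2 := (NormedSpace.exp_series_hasSum_exp' (𝕂 := ℂ) c).smul_const v
  rw [← Complex.exp_eq_exp_ℂ] at h2
  refine h1.unique (h2.congr_fun ?_)
  intro n
  simp [hpow, smul_smul]

variable {V : Submodule ℂ E}

theorem sum_inner_eq_trace [FiniteDimensional ℂ V] {ι : Type*} [Fintype ι]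
    (e : OrthonormalBasis ι ℂ V) (T : E →L[ℂ] E) :
    ∑ i, inner ℂ (e i : E) (T (e i)) = LinearMap.trace ℂ V
      (V.orthogonalProjectionOnto.toLinearMap ∘ₗ T.toLinearMap ∘ₗ V.subtype) := by
  rw [LinearMap.trace_eq_sum_inner _ e]
  refine Finset.sum_congr rfl fun i _ => ?_
  exact (Submodule.inner_orthogonalProjectionOnto_eq_of_mem_left (e i) (T (e i))).symm

/-- The trace of the compression to `V` does not depend on the orthonormal basis. -/
theorem sum_inner_basis [FiniteDimensional ℂ V] {ι κ : Type*} [Fintype ι] [Fintype κ]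
    (e : OrthonormalBasis ι ℂ V) (f : OrthonormalBasis κ ℂ V) (T : E →L[ℂ] E) :
    ∑ i, inner ℂ (e i : E) (T (e i)) = ∑ i, inner ℂ (f i : E) (T (f i)) := by
  rw [sum_inner_eq_trace, sum_inner_eq_trace]

theorem sum_inner_mul_inner_of_mem {ι : Type*} [Fintype ι] (f : OrthonormalBasis ι ℂ V) {u v : E}
    (hu : u ∈ V) (hv : v ∈ V) : ∑ j, inner ℂ u (f j : E) * inner ℂ (f j : E) v = inner ℂ u v :=
  f.sum_inner_mul_inner ⟨u, hu⟩ ⟨v, hv⟩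

theorem inner_mul_inner_eq_normSq (x y : E) :
    inner ℂ x y * inner ℂ y x = ((‖inner ℂ y x‖ ^ 2 : ℝ) : ℂ) := by
  rw [← inner_conj_symm, Complex.conj_mul', Complex.ofReal_pow]

/-- The eigenvectors of a self-adjoint operator on an invariant subspace. -/
theorem exists_eigenbasis [FiniteDimensional ℂ V] [CompleteSpace E] {K : E →L[ℂ] E}
    (hK : IsSelfAdjoint K) (hV : ∀ v ∈ V, K v ∈ V) :
    ∃ (n : ℕ) (f : OrthonormalBasis (Fin n) ℂ V) (l : Fin n → ℝ),
      ∀ i, K (f i) = (l i : ℂ) • (f i : E) := by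
  have hsym : (K.toLinearMap.restrict hV).IsSymmetric := fun x y => by
    have := ContinuousLinearMap.isSelfAdjoint_iff_isSymmetric.1 hK x y
    exact this
  refine ⟨_, hsym.eigenvectorBasis rfl, hsym.eigenvalues rfl, fun i => ?_⟩
  exact congrArg Subtype.val (hsym.apply_eigenvectorBasis rfl i)

/-- The Gibbs weights of a self-adjoint operator: the energy that is exchanged by an operator is
bounded below by the difference of its two quadratic forms. -/
theorem trace_exp_commutator [FiniteDimensional ℂ V] [CompleteSpace E] {ι : Type*} [Fintype ι]
    (e : OrthonormalBasis ι ℂ V) {K A : E →L[ℂ] E} (hK : IsSelfAdjoint K) (hKV : ∀ v ∈ V, K v ∈ V) (hAV : ∀ v ∈ V, A v ∈ V)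
    (hAV' : ∀ v ∈ V, star A v ∈ V) (β : ℝ) :
    0 ≤ ∑ i, inner ℂ (e i : E) (NormedSpace.exp (-(β : ℂ) • K) (e i)) ∧
    ∑ i, inner ℂ (e i : E) ((NormedSpace.exp (-(β : ℂ) • K) * (star A * A - A * star A)) (e i)) ≤
      β * ∑ i, inner ℂ (e i : E)
        ((NormedSpace.exp (-(β : ℂ) • K) * (star A * (K * A - A * K))) (e i)) := by
  obtain ⟨n, f, l, hf⟩ := exists_eigenbasis hK hKV
  set G := NormedSpace.exp (-(β : ℂ) • K) with hG
  set w : Fin n → ℝ := fun i => Real.exp (-β * l i) with hw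
  have hGf : ∀ i, G (f i) = (w i : ℂ) • (f i : E) := fun i => by
    rw [hG, exp_apply_of_eigenvector (c := ((-β * l i : ℝ) : ℂ)), ← Complex.ofReal_exp]
    rw [smul_apply, hf, smul_smul]
    push_cast
    rfl
  have hGsa : IsSelfAdjoint G := by
    refine IsSelfAdjoint.exp ?_
    rw [IsSelfAdjoint, star_smul, hK.star_eq, star_neg]
    congr 2
    exact Complex.conj_ofReal β
  have hsymG := ContinuousLinearMap.isSelfAdjoint_iff_isSymmetric.1 hGsa
  have hsymK := ContinuousLinearMap.isSelfAdjoint_iff_isSymmetric.1 hK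
  have htr : ∀ T : E →L[ℂ] E, ∑ i, inner ℂ (e i : E) ((G * T) (e i)) =
      ∑ i, (w i : ℂ) * inner ℂ (f i : E) (T (f i)) := fun T => by
    rw [sum_inner_basis e f]
    refine Finset.sum_congr rfl fun i _ => ?_
    have h1 : inner ℂ (G (f i)) (T (f i)) = inner ℂ (f i : E) (G (T (f i))) := hsymG _ _
    rw [mul_apply_eq_comp, ← h1, hGf, inner_smul_left, Complex.conj_ofReal]
  have hfV : ∀ i, (f i : E) ∈ V := fun i => (f i).2
  have hstar : ∀ x y : E, inner ℂ x (star A y) = inner ℂ (A x) y := fun x y =>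
    ContinuousLinearMap.adjoint_inner_right A x y
  have hstar' : ∀ x y : E, inner ℂ (star A x) y = inner ℂ x (A y) := fun x y =>
    ContinuousLinearMap.adjoint_inner_left A y x
  -- The transition weights of `A` between energy levels; both sides become double sums over them.
  set a : Fin n → Fin n → ℝ := fun j i => ‖inner ℂ (f j : E) (A (f i))‖ ^ 2 with ha
  have ha0 : ∀ j i, 0 ≤ a j i := fun j i => by positivity
  have h1 : ∀ i, inner ℂ (f i : E) ((star A * A) (f i)) = ((∑ j, a j i : ℝ) : ℂ) := fun i => by
    rw [mul_apply_eq_comp, hstar,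
      ← sum_inner_mul_inner_of_mem f (hAV _ (hfV i)) (hAV _ (hfV i)), Complex.ofReal_sum]
    exact Finset.sum_congr rfl fun j _ => inner_mul_inner_eq_normSq (A (f i)) (f j : E)
  have h2 : ∀ i, inner ℂ (f i : E) ((A * star A) (f i)) = ((∑ j, a i j : ℝ) : ℂ) := fun i => by
    rw [mul_apply_eq_comp, ← hstar',
      ← sum_inner_mul_inner_of_mem f (hAV' _ (hfV i)) (hAV' _ (hfV i)), Complex.ofReal_sum]
    refine Finset.sum_congr rfl fun j _ => ?_
    rw [hstar, hstar', mul_comm]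
    exact inner_mul_inner_eq_normSq (A (f j)) (f i : E)
  have h3 : ∀ i, inner ℂ (f i : E) ((star A * (K * A - A * K)) (f i)) =
      ((∑ j, (l j - l i) * a j i : ℝ) : ℂ) := fun i => by
    have hkey : inner ℂ (A (f i)) (K (A (f i))) = ((∑ j, l j * a j i : ℝ) : ℂ) := by
      rw [← sum_inner_mul_inner_of_mem f (hAV _ (hfV i)) (hKV _ (hAV _ (hfV i))),
        Complex.ofReal_sum]
      refine Finset.sum_congr rfl fun j _ => ?_
      have h5 : inner ℂ (K (f j)) (A (f i)) = inner ℂ (f j : E) (K (A (f i))) := hsymK _ _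
      rw [← h5, hf, inner_smul_left, Complex.conj_ofReal, mul_left_comm,
        inner_mul_inner_eq_normSq, ← Complex.ofReal_mul]
    have h6 := h1 i
    rw [mul_apply_eq_comp, hstar] at h6
    rw [mul_apply_eq_comp, hstar, sub_apply, inner_sub_right,
      mul_apply_eq_comp, mul_apply_eq_comp, hkey, hf, map_smul, inner_smul_right, h6,
      ← Complex.ofReal_mul, ← Complex.ofReal_sub, Finset.mul_sum, ← Finset.sum_sub_distrib]
    simp only [sub_mul]
  constructor
  · have := htr 1
    simp only [mul_one, one_apply_eq_self] at this
    rw [this]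
    refine Finset.sum_nonneg fun i _ => mul_nonneg ?_ ?_
    · exact Complex.zero_le_real.2 (Real.exp_pos _).le
    · rw [inner_self_eq_norm_sq_to_K]
      exact pow_nonneg (Complex.zero_le_real.2 (norm_nonneg (f i : E))) 2
  · rw [htr, htr]
    have hl : ∀ i, (w i : ℂ) * inner ℂ (f i : E) ((star A * A - A * star A) (f i)) =
        ((w i * (∑ j, a j i - ∑ j, a i j) : ℝ) : ℂ) := fun i => by
      rw [sub_apply, inner_sub_right, h1, h2, ← Complex.ofReal_sub,
        ← Complex.ofReal_mul]
    have hr : ∀ i, (w i : ℂ) * inner ℂ (f i : E) ((star A * (K * A - A * K)) (f i)) =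
        ((w i * ∑ j, (l j - l i) * a j i : ℝ) : ℂ) := fun i => by
      rw [h3, ← Complex.ofReal_mul]
    rw [Finset.sum_congr rfl fun i _ => hl i, Finset.sum_congr rfl fun i _ => hr i,
      ← Complex.ofReal_sum, ← Complex.ofReal_sum, ← Complex.ofReal_mul, Complex.real_le_real]
    have hsplit : ∑ i, w i * (∑ j, a j i - ∑ j, a i j) = ∑ i, ∑ j, (w i - w j) * a j i := by
      simp only [mul_sub, sub_mul, Finset.mul_sum, Finset.sum_sub_distrib]
      congr 1
      exact Finset.sum_comm
    rw [hsplit, Finset.mul_sum]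
    refine Finset.sum_le_sum fun i _ => ?_
    rw [← mul_assoc, Finset.mul_sum]
    refine Finset.sum_le_sum fun j _ => ?_
    rw [← mul_assoc]
    refine mul_le_mul_of_nonneg_right ?_ (ha0 j i)
    -- Term by term, the claim is `1 - exp (-x) ≤ x` for `x = β * (l j - l i)`, whatever its sign.
    have h7 : w j = w i * Real.exp (-β * (l j - l i)) := by
      simp only [hw]
      rw [← Real.exp_add]
      congr 1
      ring
    have h8 := Real.add_one_le_exp (-β * (l j - l i))
    have h9 : 0 < w i := Real.exp_pos _
    rw [h7]
    nlinarith

end Spectral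

/-! ### The Gibbs states of a finite region -/

section Region

variable {q : ℕ}

open Classical in
/-- The basis vector for a configuration of the region, all other spins being black. -/
def regionVec (R : Finset Site) (t : R → Local q) : Hil q := lp.single 2 (extend R t) (1 : ℂ)

open Classical in
theorem regionVec_apply (R : Finset Site) (t : R → Local q) (σ : Config q) :
    regionVec R t σ = if σ = extend R t then 1 else 0 := by
  rw [regionVec, lp.single_apply]
  split_ifs with h
  · subst h
    exact Pi.single_eq_same _ _
  · exact Pi.single_eq_of_ne h _

theorem extend_injective (R : Finset Site) : Function.Injective (extend (q := q) R) := by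
  intro s t h
  funext e
  have := congrFun h e
  simpa [extend] using this

open Classical in
theorem inner_regionVec (R : Finset Site) (t : R → Local q) (f : Hil q) :
    inner ℂ (regionVec R t) f = f (extend R t) := by
  rw [regionVec, lp.inner_single_left]
  simp

theorem orthonormal_regionVec (R : Finset Site) : Orthonormal ℂ (regionVec (q := q) R) := by
  classical
  rw [orthonormal_iff_ite]
  intro s t
  rw [inner_regionVec, regionVec_apply]
  simp only [(extend_injective R).eq_iff]

/-- The Hilbert space of the region. -/
abbrev regionSpace (q : ℕ) (R : Finset Site) : Submodule ℂ (Hil q) :=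
  Submodule.span ℂ (Set.range (regionVec R))

instance finiteDimensional_regionSpace (R : Finset Site) : FiniteDimensional ℂ (regionSpace q R) :=
  FiniteDimensional.span_of_finite ℂ (Set.finite_range _)

theorem regionVec_mem (R : Finset Site) (t : R → Local q) : regionVec R t ∈ regionSpace q R :=
  Submodule.subset_span ⟨t, rfl⟩

open Classical in
/-- The orthonormal basis of the configurations of the region. -/
def regionBasis (q : ℕ) (R : Finset Site) :
    OrthonormalBasis (R → Local q) ℂ (regionSpace q R) :=
  (Module.Basis.span (orthonormal_regionVec R).linearIndependent).toOrthonormalBasis (by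
    rw [orthonormal_iff_ite]
    intro s t
    rw [Submodule.coe_inner, Module.Basis.span_apply, Module.Basis.span_apply]
    exact orthonormal_iff_ite.1 (orthonormal_regionVec R) s t)

theorem regionBasis_apply (R : Finset Site) (t : R → Local q) :
    (regionBasis q R t : Hil q) = regionVec R t := by
  rw [regionBasis, Module.Basis.coe_toOrthonormalBasis, Module.Basis.span_apply]

open Classical in
theorem regionTrace_eq (R : Finset Site) (T : Op q) :
    regionTrace R T = ∑ t, inner ℂ (regionBasis q R t : Hil q) (T (regionBasis q R t)) := by
  rw [regionTrace]
  refine Finset.sum_congr rfl fun t _ => ?_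
  rw [regionBasis_apply, inner_regionVec]
  rfl

open Classical in
theorem siteUnit_regionVec {R : Finset Site} {e : Site} (he : e ∈ R) (a b : Local q)
    (t : R → Local q) : siteUnit e a b (regionVec R t) =
      if t ⟨e, he⟩ = b then regionVec R (Function.update t ⟨e, he⟩ a) else 0 := by
  have hupd : extend R (Function.update t ⟨e, he⟩ a) = Function.update (extend R t) e a := by
    funext x
    by_cases hx : x = e
    · subst hx
      simp [extend, he]
    · rw [Function.update_of_ne hx]
      by_cases hR : x ∈ R
      · have : (⟨x, hR⟩ : R) ≠ ⟨e, he⟩ := fun h => hx (congrArg Subtype.val h)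
        simp [extend, hR, Function.update_of_ne this]
      · simp [extend, hR]
  have hext : extend R t e = t ⟨e, he⟩ := by simp [extend, he]
  refine lp.ext (funext fun σ => ?_)
  rw [siteUnit_apply, regionVec_apply]
  split_ifs with h1 h2 h3 h3
  · rw [regionVec_apply, if_pos]
    rw [hupd, ← h2, Function.update_idem, ← h1, Function.update_eq_self]
  · refine absurd ?_ h3
    rw [← hext, ← h2, Function.update_self]
  · rw [regionVec_apply, if_neg]
    · intro h
      rw [hupd] at h
      apply h2
      rw [h, Function.update_idem, ← h3, ← hext, Function.update_eq_self]
  · rfl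
  · rw [regionVec_apply, if_neg]
    · intro h
      rw [hupd] at h
      apply h1
      rw [h, Function.update_self]
  · rfl

/-- The observables of a region preserve its Hilbert space. -/
theorem mem_regionSpace_of_mem_localAlgebra {R : Finset Site} {T : Op q}
    (hT : T ∈ localAlgebra q R) : ∀ v ∈ regionSpace q R, T v ∈ regionSpace q R := by
  -- The adjoint is carried along for the `star` case of the induction.
  have key : (∀ v ∈ regionSpace q R, T v ∈ regionSpace q R) ∧
      ∀ v ∈ regionSpace q R, star T v ∈ regionSpace q R := by
    induction hT using StarAlgebra.adjoin_induction with
    | mem T hT =>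
      obtain ⟨e, he, a, b, rfl⟩ := hT
      have h : ∀ a b, ∀ v ∈ regionSpace q R, siteUnit e a b v ∈ regionSpace q R := by
        classical
        intro a b v hv
        induction hv using Submodule.span_induction with
        | mem v hv =>
          obtain ⟨t, rfl⟩ := hv
          rw [siteUnit_regionVec he]
          split_ifs
          · exact regionVec_mem R _
          · exact zero_mem _
        | zero => rw [map_zero]; exact zero_mem _
        | add u v _ _ hu hv => rw [map_add]; exact add_mem hu hv
        | smul c v _ hv => rw [map_smul]; exact Submodule.smul_mem _ c hv
      have h1 : star (siteUnit e a b : Op q) = siteUnit e b a := congrArg Subtype.val (star_mu e a b)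
      rw [h1]
      exact ⟨h a b, h b a⟩
    | algebraMap r =>
      rw [Algebra.algebraMap_eq_smul_one, star_smul, star_one]
      exact ⟨fun v hv => Submodule.smul_mem _ _ hv, fun v hv => Submodule.smul_mem _ _ hv⟩
    | add x y _ _ hx hy =>
      rw [star_add]
      exact ⟨fun v hv => add_mem (hx.1 v hv) (hy.1 v hv),
        fun v hv => add_mem (hx.2 v hv) (hy.2 v hv)⟩
    | mul x y _ _ hx hy =>
      rw [star_mul]
      exact ⟨fun v hv => hx.1 _ (hy.1 v hv), fun v hv => hy.2 _ (hx.2 v hv)⟩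
    | star x _ hx =>
      rw [star_star]
      exact ⟨hx.2, hx.1⟩
  exact key.1

theorem gibbs_commutator {R : Finset Site} (β : ℝ) {K A : QL q} (hK : IsSelfAdjoint K)
    (hKR : IsLocal R K) (hA : IsLocal R A) :
    gibbs R β K (star A * A - A * star A) ≤ β * gibbs R β K (star A * (K * A - A * K)) := by
  classical
  have h := trace_exp_commutator (regionBasis q R) (K := (K : Op q)) (A := (A : Op q))
    (congrArg Subtype.val hK) (mem_regionSpace_of_mem_localAlgebra hKR)
    (mem_regionSpace_of_mem_localAlgebra hA) (mem_regionSpace_of_mem_localAlgebra hA.star) β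
  have h1 : ∀ T : Op q, ∑ t, inner ℂ (regionBasis q R t : Hil q) (T (regionBasis q R t)) =
      regionTrace R T := fun T => by
    rw [regionTrace_eq]
  rw [h1, h1, h1] at h
  unfold gibbs
  rw [← mul_div_assoc]
  -- Nonnegativity of the partition function suffices, as division by zero would give `0` on both
  -- sides.
  have h2 : ∀ {a b c : ℂ}, 0 ≤ c → a ≤ b → a / c ≤ b / c := fun {a b c} hc hab => by
    rw [div_eq_mul_inv, div_eq_mul_inv]
    refine mul_le_mul_of_nonneg_right hab ?_
    obtain ⟨r, hr, rfl⟩ : ∃ r : ℝ, 0 ≤ r ∧ c = r :=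
      ⟨c.re, (Complex.nonneg_iff.1 hc).1, Complex.ext rfl (Complex.nonneg_iff.1 hc).2.symm⟩
    rw [← Complex.ofReal_inv]
    exact Complex.zero_le_real.2 (inv_nonneg.2 hr)
  exact h2 h.1 h.2

end Region

/-! ### Zero temperature limits are ground states -/

section ZeroTemperature

variable {q : ℕ} {Φ : Interaction → QL q}

theorem star_restrict (hΦ : ∀ X, star (Φ X) = Φ X) (R : Finset Site) :
    star (restrict Φ R) = restrict Φ R := by
  rw [restrict, star_sum]
  exact Finset.sum_congr rfl fun X _ => hΦ X

theorem isLocal_restrict (hΦ : ∀ X, IsLocal (supp X) (Φ X)) (R : Finset Site) :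
    IsLocal R (restrict Φ R) :=
  isLocal_sum _ _ fun X hX => (hΦ X).mono (mem_inside.1 hX)

/-- Any further interaction is disjoint from `Λ` and commutes with `A`. -/
theorem restrict_commutator (hΦ : ∀ X, IsLocal (supp X) (Φ X)) {Λ R : Finset Site} {A : QL q}
    (hA : IsLocal Λ A) (hR : bar Λ ⊆ R) : restrict Φ R * A - A * restrict Φ R =
      restrict Φ (bar Λ) * A - A * restrict Φ (bar Λ) := by
  have hsub : inside (bar Λ) ⊆ inside R := fun X hX => mem_inside.2 ((mem_inside.1 hX).trans hR)
  simp only [restrict, Finset.sum_mul, Finset.mul_sum, ← Finset.sum_sub_distrib]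
  refine (Finset.sum_subset hsub fun X _ hX => sub_eq_zero.2 ?_).symm
  refine (IsLocal.commute ?_ (hΦ X) hA).eq
  rw [Finset.disjoint_left]
  intro e he heΛ
  exact hX (mem_inside.2 fun e' he' => mem_bar.2 (Or.inr ⟨X, he', e, heΛ, he⟩))

/-- The boundary terms eventually avoid `Λ`, so the bound for the finite Gibbs states involves only
fixed local observables and passes to the limit. -/
theorem IsEquilibriumState.commutator (hΦ : ∀ X, IsLocal (supp X) (Φ X))
    (hΦs : ∀ X, star (Φ X) = Φ X) {β : ℝ} {ω : State q} (hω : IsEquilibriumState Φ β ω)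
    {Λ : Finset Site} {A : QL q} (hA : IsLocal Λ A) :
    ω.toLin (star A * A - A * star A) ≤
      β * ω.toLin (star A * (restrict Φ (bar Λ) * A - A * restrict Φ (bar Λ))) := by
  obtain ⟨R, W, hR, hex, hW, hWloc, hlim⟩ := hω
  have hΛ : Λ ⊆ bar Λ := Finset.subset_union_left
  have hA' := hA.mono hΛ
  have hH := isLocal_restrict hΦ (bar Λ)
  have l1 := hlim (bar Λ) _ ((hA'.star.mul hA').sub (hA'.mul hA'.star))
  have l2 := hlim (bar Λ) _ (hA'.star.mul ((hH.mul hA').sub (hA'.mul hH)))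
  have hbig : ∀ᶠ n in Filter.atTop, bar Λ ⊆ R n := by
    have : ∀ S : Finset Site, ∀ᶠ n in Filter.atTop, S ⊆ R n := by
      intro S
      induction S using Finset.induction_on with
      | empty => exact Filter.Eventually.of_forall fun n => Finset.empty_subset _
      | insert e S _ ih =>
        obtain ⟨m, hm⟩ := hex e
        filter_upwards [ih, Filter.eventually_ge_atTop m] with n h1 h2
        exact Finset.insert_subset (hR h2 hm) h1
    exact this _
  refine le_of_tendsto_of_tendsto l1 (l2.const_mul (β : ℂ)) ?_
  filter_upwards [hbig, hWloc Λ] with n hn hWn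
  have hcomm : W n * A = A * W n := (IsLocal.commute Finset.sdiff_disjoint hWn hA).eq
  have hK : (restrict Φ (R n) + W n) * A - A * (restrict Φ (R n) + W n) =
      restrict Φ (bar Λ) * A - A * restrict Φ (bar Λ) := by
    rw [← restrict_commutator hΦ hA hn, add_mul, mul_add, hcomm, add_sub_add_right_eq_sub]
  have := gibbs_commutator (R := R n) β (K := restrict Φ (R n) + W n) (A := A)
    (by rw [IsSelfAdjoint, star_add, star_restrict hΦs, (hW n).1.star_eq])
    ((isLocal_restrict hΦ (R n)).add (hW n).2) (hA'.mono hn)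
  rwa [hK] at this

/-- Zero temperature limits of equilibrium states are ground states. -/
theorem IsZeroTemperatureLimit.isGroundState (hΦ : ∀ X, IsLocal (supp X) (Φ X))
    (hΦs : ∀ X, star (Φ X) = Φ X) {ω : State q} (hω : IsZeroTemperatureLimit Φ ω) :
    IsGroundState Φ ω := by
  obtain ⟨β, ψ, hβ, hψ, hlim⟩ := hω
  intro Λ A hA
  have hinv : Filter.Tendsto (fun n => ((β n)⁻¹ : ℂ)) Filter.atTop (𝓝 0) := by
    have h1 := (Complex.continuous_ofReal.tendsto 0).comp (tendsto_inv_atTop_zero.comp hβ)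
    rw [Complex.ofReal_zero] at h1
    exact h1.congr fun n => Complex.ofReal_inv _
  -- Divided by `β n`, the left-hand side of the equilibrium inequality tends to zero.
  have l1 := hinv.mul (hlim (star A * A - A * star A))
  rw [zero_mul] at l1
  refine le_of_tendsto_of_tendsto l1 (hlim _) ?_
  filter_upwards [hβ.eventually_gt_atTop 0] with n hn
  have h1 := (hψ n).commutator hΦ hΦs hA
  have h2 : (0 : ℂ) ≤ ((β n)⁻¹ : ℂ) := by
    rw [← Complex.ofReal_inv]
    exact Complex.zero_le_real.2 (inv_nonneg.2 hn.le)
  have h3 := mul_le_mul_of_nonneg_left h1 h2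
  rwa [inv_mul_cancel_left₀ (Complex.ofReal_ne_zero.2 hn.ne')] at h3

end ZeroTemperature

/-! ### The Toric Code -/

section ToricCode

variable {q : ℕ}

theorem star_prod4 {s : Side → Site} {T : Side → Site → QL q}
    (hs : ∀ i, IsSelfAdjoint (T i (s i))) (hc : ∀ i j, Commute (T i (s i)) (T j (s j))) :
    star (prod4 s T) = prod4 s T := by
  have h1 := ((hs .north).commute_iff (hs .east)).1 (hc _ _)
  have h2 := (h1.commute_iff (hs .south)).1 ((hc _ _).mul_left (hc _ _))
  exact (h2.commute_iff (hs .west)).1 (((hc _ _).mul_left (hc _ _)).mul_left (hc _ _))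

theorem star_clProj (e : Site) : star (clProj e : QL q) = clProj e := by
  rw [clProj_eq, star_sub, star_one, star_tcProj]

theorem clProj_commute_tcProj (e e' : Site) : Commute (clProj e : QL q) (tcProj e') := by
  rw [clProj_eq]
  exact (Commute.one_left _).sub_left (tcProj_commute e e')

theorem clProj_commute (e e' : Site) : Commute (clProj e : QL q) (clProj e') := by
  rw [clProj_eq e']
  exact (Commute.one_right _).sub_right (clProj_commute_tcProj e e')

theorem star_interaction (ρ : Rows q) (J ε C : ℝ) (X : Interaction) :
    star (interaction ρ J ε C X) = interaction ρ J ε C X := by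
  have hreal : ∀ (r : ℝ) (A : QL q), star A = A → star ((r : ℂ) • A) = (r : ℂ) • A :=
    fun r A hA => by
      rw [star_smul, hA]
      congr 1
      exact Complex.conj_ofReal r
  have hcell : ∀ t x y, star (interaction ρ J ε C (cellKind t, x, y)) =
      interaction ρ J ε C (cellKind t, x, y) := by
    intro t x y
    rw [interaction_cell, star_add, star_sub, hreal, hreal _ _ (star_stab t x y)]
    · congr 1
      rw [tilingTerm, star_sub, star_sum]
      congr 1
      · exact star_prod4 (fun i => star_clProj _) fun i j => clProj_commute _ _
      · refine Finset.sum_congr rfl fun w _ => hreal _ _ (star_prod4 ?_ ?_)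
        · rintro (_ | _ | _ | _) <;> exact star_mu _ _ _
        · rintro (_ | _ | _ | _) (_ | _ | _ | _) <;>
            exact siteProj_commute (some _) (some _) _ _
    · exact star_prod4 (fun i => star_tcProj _) fun i j => tcProj_commute _ _
  have hpair : ∀ e e' : Site, star (isingTerm C e e' : QL q) = isingTerm C e e' := by
    intro e e'
    refine hreal _ _ ?_
    rw [star_add, star_mul, star_mul, star_tcProj, star_tcProj, star_clProj, star_clProj,
      (clProj_commute_tcProj e' e).eq, (clProj_commute_tcProj e e').eq]
  obtain ⟨k, x, y⟩ := X
  cases k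
  · exact hcell true x y
  · exact hcell false x y
  all_goals exact hpair _ _

theorem tcInteraction_cell (J ε : ℝ) (t : Bool) (x y : ℤ) : tcInteraction q J ε (cellKind t, x, y) =
    (ε : ℂ) • prod4 (cellEdge t x y) (fun _ e => tcProj e) - (J : ℂ) • stab t x y := by
  cases t <;> rfl

/-- On the Toric Code subspace the Hamiltonian differs from the Toric Code by a constant. -/
theorem interaction_mul_tcRegion (ρ : Rows q) (J ε C : ℝ) {R : Finset Site} {X : Interaction}
    (hX : supp X ⊆ R) : ∃ c : ℂ,
      (interaction ρ J ε C X - tcInteraction q J 0 X) * tcRegion R = c • tcRegion R := by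
  rw [tcRegion_eq_sectorProj]
  rcases exists_cell X with ⟨t, x, y, rfl⟩ | h
  · have hT : IsToric (fun _ => none : Sector q) t x y := fun _ => rfl
    have hE : cellEnergy ρ (fun _ => none) t x y = 0 := if_neg fun h => h .north rfl
    -- The tiling term vanishes here, so only the shift `ε` of the stabilizer term is left.
    refine ⟨ε, ?_⟩
    rw [sub_mul, interaction_cell_mul_sectorProj ρ J ε C _
      (fun i => hX (mem_supp_cell.2 ⟨i, rfl⟩)), if_pos hT, hE, tcInteraction_cell,
      Complex.ofReal_zero, zero_smul, zero_smul, zero_sub, zero_add, neg_mul, smul_mul_assoc,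
      sub_neg_eq_add, sub_add_cancel]
  · refine ⟨0, ?_⟩
    rw [sub_mul, pair_mul_sectorProj ρ J ε C _ h hX]
    obtain ⟨k, x, y⟩ := X
    cases k
    · exact absurd rfl h.1
    · exact absurd rfl h.2
    all_goals simp [energy, cut, tcInteraction]

theorem exists_restrict_mul_tcRegion (ρ : Rows q) (J ε C : ℝ) (R : Finset Site) : ∃ c : ℂ,
    (restrict (interaction ρ J ε C) R - restrict (tcInteraction q J 0) R) * tcRegion R =
      c • tcRegion R := by
  choose! c hc using fun (X : Interaction) (hX : X ∈ inside R) =>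
    interaction_mul_tcRegion ρ J ε C (mem_inside.1 hX)
  refine ⟨∑ X ∈ inside R, c X, ?_⟩
  rw [restrict, restrict, ← Finset.sum_sub_distrib, Finset.sum_mul, Finset.sum_smul]
  exact Finset.sum_congr rfl hc

/-- For spins in `Λ` the compressed observable absorbs the projector on either side; for the others,
locality applies. -/
theorem commute_tcRegion_of_compressed {Λ : Finset Site} {A : QL q} (hA : IsLocal Λ A)
    (h : tcRegion Λ * A * tcRegion Λ = A) (R : Finset Site) : Commute A (tcRegion R) := by
  have hTT : (tcRegion Λ : QL q) * tcRegion Λ = tcRegion Λ :=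
    sectorProj_mul_self (fun _ => none) Λ
  have hl : tcRegion Λ * A = A := by
    nth_rewrite 1 [← h]
    rw [← mul_assoc, ← mul_assoc, hTT, h]
  have hr : A * tcRegion Λ = A := by
    nth_rewrite 1 [← h]
    rw [mul_assoc, hTT, h]
  refine commute_sectorProj (s := fun _ => none) fun e _ => ?_
  by_cases he : e ∈ Λ
  · have h1 : tcProj e * (tcRegion Λ : QL q) = tcRegion Λ :=
      siteProj_mul_sectorProj (fun _ => none) he
    have h2 : (tcRegion Λ : QL q) * tcProj e = tcRegion Λ :=
      (siteProj_commute_sectorProj (fun _ => none) Λ none e).eq.symm.trans h1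
    have h3 : tcProj e * A = A := by rw [← hl, ← mul_assoc, h1]
    have h4 : A * tcProj e = A := by rw [← hr, mul_assoc, h2]
    exact h4.trans h3.symm
  · exact hA.commute (Finset.disjoint_singleton_right.2 he)
      (isLocal_tcProj (Finset.mem_singleton_self e))

/-- The complement `1 - P` is null by Cauchy–Schwarz, and `B` lives on that complement. -/
theorem State.mul_null_of_projection {ω : State q} {P B : QL q} (hP : P * P = P)
    (hPs : star P = P) (hω : ω.toLin (1 - P) = 0) (hB : B * P = 0) (Y : QL q) :
    ω.toLin (Y * B) = 0 := by
  have h1 := State.mul_null (ω := ω) (Q := 1 - P) (by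
    rw [star_sub, star_one, hPs, sub_mul, one_mul, mul_sub, mul_one, hP, sub_self, sub_zero]
    exact hω) (Y * B)
  rwa [mul_sub, mul_one, mul_assoc, hB, mul_zero, sub_zero] at h1

/-- A ground state that is supported in the Toric Code subspace is a ground state of the Toric
Code. -/
theorem isToricCodeGroundState {ρ : Rows q} {J ε C : ℝ} {ω : State q}
    (hω : IsGroundState (interaction ρ J ε C) ω) (htc : IsFullyTC ω) :
    IsToricCodeGroundState J ω := by
  refine ⟨htc, fun Λ A hA hAT => ?_⟩
  have hAP := commute_tcRegion_of_compressed hA hAT (bar Λ)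
  obtain ⟨c, hc⟩ := exists_restrict_mul_tcRegion ρ J ε C (bar Λ)
  have hpos := hω Λ A hA
  generalize restrict (interaction ρ J ε C) (bar Λ) = H at hc hpos
  generalize restrict (tcInteraction q J 0) (bar Λ) = H₀ at hc ⊢
  -- On the Toric Code subspace, which `A` preserves, `H - H₀` is a constant and commutes with `A`.
  have hBP : ((H - H₀) * A - A * (H - H₀)) * tcRegion (bar Λ) = 0 := by
    rw [sub_mul, mul_assoc, hAP.eq, ← mul_assoc, hc, mul_assoc, hc, smul_mul_assoc,
      mul_smul_comm, hAP.eq, sub_self]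
  have hnull := State.mul_null_of_projection (sectorProj_mul_self (fun _ => none) (bar Λ))
    (star_sectorProj (fun _ => none) (bar Λ)) (htc (bar Λ)) hBP (star A)
  have hsplit : star A * (H₀ * A - A * H₀) =
      star A * (H * A - A * H) - star A * ((H - H₀) * A - A * (H - H₀)) := by
    rw [← mul_sub]
    congr 1
    rw [sub_mul, mul_sub]
    abel
  rw [hsplit, map_sub, hnull, sub_zero]
  exact hpos

end ToricCode

end ToricTiling

end

theorem mainTheorem3 (q : ℕ) (ρ : ToricTiling.Rows q) (J ε C : ℝ)
    (hJ : 0 < J) (hεJ : ε ≤ J) (hε : ε ≤ 1 / 2) (hC : 1 ≤ C) :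
    (∀ ω : ToricTiling.State q,
      ToricTiling.IsGroundState (ToricTiling.interaction ρ J ε C) ω →
        ∀ Λ : Finset ToricTiling.Site, ω.toLin (1 - ToricTiling.tcRegion Λ) = 0) ∧
    (∀ ω : ToricTiling.State q,
      ToricTiling.IsZeroTemperatureLimit (ToricTiling.interaction ρ J ε C) ω →
        ToricTiling.IsToricCodeGroundState J ω) := by
  have hground : ∀ ω : ToricTiling.State q,
      ToricTiling.IsGroundState (ToricTiling.interaction ρ J ε C) ω → ToricTiling.IsFullyTC ω :=
    fun ω hω => ToricTiling.isFullyTC_of_isGroundState hJ hεJ hε hC hω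
  refine ⟨hground, fun ω hω => ?_⟩
  have h := hω.isGroundState (ToricTiling.isLocal_interaction ρ J ε C)
    (ToricTiling.star_interaction ρ J ε C)
  exact ToricTiling.isToricCodeGroundState h (hground ω h)
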